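/- All graphs are finite and simple. A digraph $D$ is eulerian if $d^+_D(v)=d^-_D(v)$ for every vertex $v$ (connectedness is not required), and $EE(D)$ (resp. $EO(D)$) is the number of spanning eulerian subdigraphs of $D$ with an even (resp. odd) number of arcs. A graph $G$ is $f$-Alon--Tarsi, for $f:V(G)\to\mathbb{N}$, if $G$ has an orientation $D$ with $EE(D)\neq EO(D)$ and $f(v)\ge d_D^+(v)+1$ for all $v\in V(G)$. The Alon--Tarsi number $\operatorname{AT}(G)$ is the least $k$ such that $G$ is $f$-Alon--Tarsi for the constant function $f=k$, and $G$ is $k$-AT-critical if $\operatorname{AT}(G)=k$ and $\operatorname{AT}(H)<k$ for every proper subgraph $H$ of $G$. Let $d(G)$ denote the average degree of $G$. Let $k\ge 7$ and let $G$ be a $k$-AT-critical graph that is not isomorphic to $K_k$. Then $$d(G)\ \ge\ k-1+\frac{(k-3)(2k-5)}{k^3+k^2-15k+15}.$$ Moreover, for every such $k$ the right-hand side is strictly larger than the earlier lower bound of Kierstead and Rabern, $$k-1+\frac{2(k-2)(k-3)}{(k-1)(k^2+3k-12)}.$$ -/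

import Mathlib

namespace AlonTarsi

variable {V : Type*}

/-- The out-degree of a vertex in a digraph (meant for finite vertex sets). -/
noncomputable def outDeg (D : Digraph V) (v : V) : ℕ := {w : V | D.Adj v w}.ncard

/-- The in-degree of a vertex in a digraph (meant for finite vertex sets). -/
noncomputable def inDeg (D : Digraph V) (v : V) : ℕ := {w : V | D.Adj w v}.ncard

/-- The number of arcs of a digraph (meant for finite vertex sets). -/
noncomputable def arcCount (D : Digraph V) : ℕ := {p : V × V | D.Adj p.1 p.2}.ncard

/-- A digraph is eulerian if every vertex has equal in- and out-degree
(connectedness is not required). -/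
def IsEulerian (D : Digraph V) : Prop := ∀ v, outDeg D v = inDeg D v

/-- `EE(D)`: the number of spanning eulerian subdigraphs of `D` with an even number of arcs. -/
noncomputable def EE (D : Digraph V) : ℕ :=
  {A : Digraph V | A ≤ D ∧ IsEulerian A ∧ Even (arcCount A)}.ncard

/-- `EO(D)`: the number of spanning eulerian subdigraphs of `D` with an odd number of arcs. -/
noncomputable def EO (D : Digraph V) : ℕ :=
  {A : Digraph V | A ≤ D ∧ IsEulerian A ∧ Odd (arcCount A)}.ncard

/-- `D` is an orientation of `G`: each edge of `G` receives exactly one of its two directions,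
and `D` has no other arcs (in particular no loops). -/
def IsOrientation (G : SimpleGraph V) (D : Digraph V) : Prop :=
  ∀ u v, (G.Adj u v ↔ D.Adj u v ∨ D.Adj v u) ∧ ¬ (D.Adj u v ∧ D.Adj v u)

/-- `G` is `f`-Alon–Tarsi. -/
def IsAT (G : SimpleGraph V) (f : V → ℕ) : Prop :=
  ∃ D : Digraph V, IsOrientation G D ∧ EE D ≠ EO D ∧ ∀ v, outDeg D v + 1 ≤ f v

/-- The Alon–Tarsi number of a (finite) graph: the least `k` such that the graph is
`f`-Alon–Tarsi for the constant function `f = k`. -/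
noncomputable def atNumber (G : SimpleGraph V) : ℕ := sInf {k : ℕ | IsAT G (fun _ => k)}

/-- `G` is `k`-AT-critical: its Alon–Tarsi number is `k`, and every proper subgraph
(not necessarily spanning or induced) has smaller Alon–Tarsi number. -/
def IsATCritical (G : SimpleGraph V) (k : ℕ) : Prop :=
  atNumber G = k ∧ ∀ H : G.Subgraph, H ≠ ⊤ → atNumber H.coe < k

open Classical in
/-- The average degree of a finite graph. -/
noncomputable def avgDegree [Fintype V] (G : SimpleGraph V) : ℝ :=
  (∑ v, (G.degree v : ℝ)) / (Fintype.card V : ℝ)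

end AlonTarsi

/-! Write `sigma` for EE - EO, a signed count of balanced arc sets. A vertex set S is `Good` if G[S]
has an orientation with `sigma ≠ 0` whose in-degrees keep all out-degrees in S at most k - 2 even
after every edge from S to its complement is directed outwards. Balanced sets cannot use those
edges, so the count factors (`sigma_cut`), and a good S together with an orientation of G - S would
give AT(G) < k. Hence a critical graph has no nonempty good set (`IsATCritical.not_good`). It has no
clique on k vertices either: an orientation of one with out-degrees at most k - 2 repeats an
out-degree, which forces `sigma = 0` (`sigma_tournament_eq_zero`). The rest of the proof uses only
these two facts.

Good sets are produced in two ways. `Grow` builds an acyclic orientation from a root and closes it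
by one arc into the root; the number of balanced sets is odd when an even number of paths gets
closed. This yields the structure of low vertices (degree k - 1): no ears on maximal cliques
(`not_reachIn_of_clique`), end cliques in every set of minimum degree three (`exists_end_clique`),
and no connection through other low vertices between two vertices of a big clique (k - 1 low
vertices). `Rooting.good` orients whole components of low vertices together with a set Y of vertices
of degree k. Inside every big clique a sign-reversing involution (`sigma_toggle`) deletes arcs until
the digraph is acyclic. Consequently every nonempty set of edges between big cliques and degree-k
vertices has a component or a degree-k vertex meeting at most two of them (`not_three_le_fibres`).
So these edges split into paid ones, at most two per degree-k vertex, and unpaid ones, at most two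
per component (`exists_paid`).

The bound follows by discharging from the charges d(v) - (k - 1). A high vertex sends `γ` to each
neighbour in a big clique and `ε` to each other low neighbour, but nothing along unpaid edges. High
vertices keep at least `δ` each (`sum_pay_le`), and low vertices receive at least `δ` on average
(`le_sum_pay`); here `δ` is the claimed increment. -/

namespace AlonTarsi

open Finset Classical

/-! ### Signed counts of balanced arc sets -/

section Arcs

variable {V : Type*}

/-- Out-degree minus in-degree of `v` in the arc set `A`. -/
noncomputable def excess (A : Finset (V × V)) (v : V) : ℤ :=
  ∑ p ∈ A, ((if p.1 = v then 1 else 0) - (if p.2 = v then 1 else 0))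

/-- An arc set is balanced if every vertex has equal in- and out-degree. -/
def Balanced (A : Finset (V × V)) : Prop := ∀ v, excess A v = 0

/-- The signed number of balanced subsets of an arc set. -/
noncomputable def sigma (D : Finset (V × V)) : ℤ :=
  ∑ A ∈ D.powerset with Balanced A, (-1) ^ #A

lemma excess_eq (A : Finset (V × V)) (v : V) :
    excess A v = (#{p ∈ A | p.1 = v} : ℤ) - #{p ∈ A | p.2 = v} := by
  simp [excess, Finset.sum_sub_distrib]

lemma excess_union {A B : Finset (V × V)} (h : Disjoint A B) (v : V) :
    excess (A ∪ B) v = excess A v + excess B v := Finset.sum_union h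

lemma excess_insert {A : Finset (V × V)} {p : V × V} (h : p ∉ A) (v : V) :
    excess (insert p A) v =
      ((if p.1 = v then 1 else 0) - (if p.2 = v then 1 else 0)) + excess A v :=
  Finset.sum_insert h

lemma excess_erase {A : Finset (V × V)} {p : V × V} (h : p ∈ A) (v : V) :
    excess (A.erase p) v =
      excess A v - ((if p.1 = v then 1 else 0) - (if p.2 = v then 1 else 0)) := by
  have := Finset.add_sum_erase A (fun p : V × V =>
    ((if p.1 = v then 1 else 0) - (if p.2 = v then 1 else 0) : ℤ)) h
  simp only [excess]
  linarith

lemma balanced_empty : Balanced (∅ : Finset (V × V)) := fun v => by simp [excess]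

lemma Balanced.exists_out {A : Finset (V × V)} (hA : Balanced A) {p : V × V} (hp : p ∈ A) :
    ∃ w, (p.2, w) ∈ A := by
  have h := hA p.2
  rw [excess_eq] at h
  have h1 : 0 < #{q ∈ A | q.2 = p.2} := card_pos.2 ⟨p, by simp [hp]⟩
  have h2 : 0 < #{q ∈ A | q.1 = p.2} := by omega
  obtain ⟨⟨x, y⟩, hq⟩ := card_pos.1 h2
  simp only [mem_filter] at hq
  exact ⟨y, hq.2 ▸ hq.1⟩

lemma Balanced.exists_in {A : Finset (V × V)} (hA : Balanced A) {p : V × V} (hp : p ∈ A) :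
    ∃ w, (w, p.1) ∈ A := by
  have h := hA p.1
  rw [excess_eq] at h
  have h1 : 0 < #{q ∈ A | q.1 = p.1} := card_pos.2 ⟨p, by simp [hp]⟩
  have h2 : 0 < #{q ∈ A | q.2 = p.1} := by omega
  obtain ⟨⟨x, y⟩, hq⟩ := card_pos.1 h2
  simp only [mem_filter] at hq
  exact ⟨x, hq.2 ▸ hq.1⟩

/-- Take an arc whose head is as high as possible under `f`: balance supplies an arc leaving that
head, and it ends higher still. -/
lemma Balanced.eq_empty {α : Type*} [LinearOrder α] {A : Finset (V × V)} (hA : Balanced A)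
    (f : V → α) (hf : ∀ p ∈ A, f p.1 < f p.2) : A = ∅ := by
  by_contra hne
  obtain ⟨p, hp, hmax⟩ := A.exists_max_image (fun p => f p.2) (nonempty_iff_ne_empty.2 hne)
  obtain ⟨w, hw⟩ := hA.exists_out hp
  exact absurd (hmax _ hw) (not_le.2 (hf _ hw))

/-- An acyclic arc set has only the empty balanced subset. -/
lemma sigma_acyclic {α : Type*} [LinearOrder α] {D : Finset (V × V)}
    (f : V → α) (hf : ∀ p ∈ D, f p.1 < f p.2) : sigma D = 1 := by
  have : {A ∈ D.powerset | Balanced A} = {∅} := by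
    ext A
    simp only [mem_filter, mem_powerset, mem_singleton]
    constructor
    · rintro ⟨h1, h2⟩
      exact h2.eq_empty f fun p hp => hf p (h1 hp)
    · rintro rfl
      exact ⟨by simp, balanced_empty⟩
  simp [sigma, this]

/-- Modulo 2 the signs disappear and only the number of balanced subsets remains. -/
lemma sigma_ne_zero_of_odd {D : Finset (V × V)}
    (h : Odd #{A ∈ D.powerset | Balanced A}) : sigma D ≠ 0 := by
  intro h0
  have h1 : ((sigma D : ℤ) : ZMod 2) = (#{A ∈ D.powerset | Balanced A} : ZMod 2) := by
    simp [sigma, ZMod.neg_eq_self_mod_two]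
  rw [h0] at h1
  rw [← ZMod.natCast_eq_one_iff_odd] at h
  rw [h] at h1
  simp at h1

/-- If no arc enters `S` from outside, the signed count factors. -/
lemma sigma_cut {D : Finset (V × V)} (S : Finset V)
    (hD : ∀ p ∈ D, p.2 ∈ S → p.1 ∈ S) :
    sigma D = sigma {p ∈ D | p.1 ∈ S ∧ p.2 ∈ S} * sigma {p ∈ D | p.1 ∉ S ∧ p.2 ∉ S} := by
  -- The excesses over `S` sum to the number of arcs of `A` leaving `S` minus the number entering
  -- it. Nothing enters, so nothing leaves.
  have key : ∀ A ⊆ D, Balanced A → ∀ p ∈ A, p.1 ∈ S → p.2 ∈ S := by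
    intro A hAD hA
    have h1 : ∑ v ∈ S, excess A v = 0 := Finset.sum_eq_zero fun v _ => hA v
    have h2 : ∑ v ∈ S, excess A v =
        ∑ p ∈ A, ((if p.1 ∈ S then 1 else 0) - (if p.2 ∈ S then 1 else 0) : ℤ) := by
      simp only [excess]
      rw [Finset.sum_comm]
      refine Finset.sum_congr rfl fun p _ => ?_
      rw [Finset.sum_sub_distrib]
      simp
    rw [h1] at h2
    have h3 := (Finset.sum_eq_zero_iff_of_nonneg (fun p hp => ?_)).1 h2.symm
    · intro p hp hpS
      by_contra hn
      have := h3 p hp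
      simp [hpS, hn] at this
    · have := hD p (hAD hp)
      by_cases h : p.2 ∈ S
      · simp [h, this h]
      · simp only [h, if_false]
        split_ifs <;> simp
  have split : ∀ A ⊆ D, Balanced A → ∀ p ∈ A, (p.1 ∈ S ∧ p.2 ∈ S) ∨ (p.1 ∉ S ∧ p.2 ∉ S) := by
    intro A hAD hA p hp
    have h1 := key A hAD hA p hp
    have h2 := hD p (hAD hp)
    tauto
  have bal : ∀ A ⊆ D, Balanced A → Balanced {p ∈ A | p.1 ∈ S ∧ p.2 ∈ S} ∧
      Balanced {p ∈ A | p.1 ∉ S ∧ p.2 ∉ S} := by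
    intro A hAD hA
    have hsp := split A hAD hA
    constructor
    · intro v
      by_cases hv : v ∈ S
      · rw [← hA v, excess, excess, Finset.sum_filter]
        refine Finset.sum_congr rfl fun p hp => ?_
        split_ifs with h h1 h2 <;> try rfl
        all_goals
          rcases hsp p hp with h' | h'
          · exact absurd h' h
          · exfalso; aesop
      · refine Finset.sum_eq_zero fun p hp => ?_
        rw [mem_filter] at hp
        rw [if_neg, if_neg, sub_zero] <;> rintro rfl <;> tauto
    · intro v
      by_cases hv : v ∈ S
      · refine Finset.sum_eq_zero fun p hp => ?_
        rw [mem_filter] at hp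
        rw [if_neg, if_neg, sub_zero] <;> rintro rfl <;> tauto
      · rw [← hA v, excess, excess, Finset.sum_filter]
        refine Finset.sum_congr rfl fun p hp => ?_
        split_ifs with h h1 h2 <;> try rfl
        all_goals
          rcases hsp p hp with h' | h'
          · exfalso; aesop
          · exact absurd h' h
  rw [sigma, sigma, sigma, Finset.sum_mul_sum, ← Finset.sum_product']
  refine Finset.sum_bij' (fun A _ => ({p ∈ A | p.1 ∈ S ∧ p.2 ∈ S}, {p ∈ A | p.1 ∉ S ∧ p.2 ∉ S}))
    (fun q _ => q.1 ∪ q.2) ?_ ?_ ?_ ?_ ?_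
  · intro A hA
    simp only [mem_filter, mem_powerset] at hA
    simp only [mem_product, mem_filter, mem_powerset]
    exact ⟨⟨filter_subset_filter _ hA.1, (bal A hA.1 hA.2).1⟩,
      ⟨filter_subset_filter _ hA.1, (bal A hA.1 hA.2).2⟩⟩
  · rintro ⟨A, B⟩ h
    simp only [mem_product, mem_filter, mem_powerset] at h ⊢
    refine ⟨union_subset (h.1.1.trans (filter_subset _ _)) (h.2.1.trans (filter_subset _ _)), ?_⟩
    intro v
    rw [excess_union, h.1.2 v, h.2.2 v, add_zero]
    rw [Finset.disjoint_left]
    intro p hp hp'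
    have h1 := (mem_filter.1 (h.1.1 hp)).2
    have h2 := (mem_filter.1 (h.2.1 hp')).2
    exact h2.1 h1.1
  · intro A hA
    simp only [mem_filter, mem_powerset] at hA
    ext p
    simp only [mem_union, mem_filter]
    have := split A hA.1 hA.2 p
    tauto
  · rintro ⟨A, B⟩ h
    simp only [mem_product, mem_filter, mem_powerset] at h
    have h1 : ∀ p ∈ A, p.1 ∈ S ∧ p.2 ∈ S := fun p hp => (mem_filter.1 (h.1.1 hp)).2
    have h2 : ∀ p ∈ B, p.1 ∉ S ∧ p.2 ∉ S := fun p hp => (mem_filter.1 (h.2.1 hp)).2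
    refine Prod.ext ?_ ?_
    · ext p
      simp only [mem_union, mem_filter]
      have := h1 p
      have := h2 p
      tauto
    · ext p
      simp only [mem_union, mem_filter]
      have := h1 p
      have := h2 p
      tauto
  · intro A hA
    simp only [mem_filter, mem_powerset] at hA
    rw [← pow_add, ← card_union_of_disjoint]
    · congr 2
      ext p
      simp only [mem_union, mem_filter]
      have := split A hA.1 hA.2 p
      tauto
    · rw [Finset.disjoint_left]
      intro p hp hp'
      exact (mem_filter.1 hp').2.1 (mem_filter.1 hp).2.1

/-- Removing the detours at a pair `a, w` does not change the signed count. -/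
lemma sigma_toggle {D : Finset (V × V)} {a w : V}
    (hin : #{p ∈ D | p.2 = a} ≤ 1)
    (hw : ∀ p ∈ D, p.2 = w → p.1 = a)
    (haw' : (a, w) ∈ D) (haw : ∀ v, v ≠ w → (a, v) ∈ D → (w, v) ∈ D)
    (hww : (w, w) ∉ D) (hne : a ≠ w) :
    sigma D = sigma {p ∈ D | ¬ (p.1 = a ∧ p.2 ≠ w) ∧ ¬ (p.1 = w ∧ (a, p.2) ∈ D)} := by
  set D' := {p ∈ D | ¬ (p.1 = a ∧ p.2 ≠ w) ∧ ¬ (p.1 = w ∧ (a, p.2) ∈ D)} with hD'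
  have hsub : D' ⊆ D := filter_subset _ _
  -- In-degree at most one at `a` and balance leave at most one arc of `A` out of `a`.
  have outa : ∀ A ⊆ D, Balanced A → ∀ u v, (a, u) ∈ A → (a, v) ∈ A → u = v := by
    intro A hAD hA u v hu hv
    have h := hA a
    rw [excess_eq] at h
    have h1 : #{p ∈ A | p.2 = a} ≤ 1 := (card_le_card (filter_subset_filter _ hAD)).trans hin
    have h2 : #{p ∈ A | p.1 = a} ≤ 1 := by omega
    have := card_le_one.1 h2 (a, u) (by simp [hu]) (a, v) (by simp [hv])
    simpa using this
  -- Only `a` sends arcs to `w`, so a balanced set leaves `w` at most once, and then it contains `a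
  -- → w`.
  have outw : ∀ A ⊆ D, Balanced A → ∀ v, (w, v) ∈ A →
      (a, w) ∈ A ∧ ∀ u, (w, u) ∈ A → u = v := by
    intro A hAD hA v hv
    obtain ⟨z, hz⟩ := hA.exists_in hv
    have hza : z = a := hw _ (hAD hz) rfl
    refine ⟨hza ▸ hz, ?_⟩
    intro u hu
    have h := hA w
    rw [excess_eq] at h
    have h1 : #{p ∈ A | p.2 = w} ≤ 1 := by
      refine card_le_one.2 ?_
      rintro ⟨x, y⟩ hx ⟨x', y'⟩ hx'
      simp only [mem_filter] at hx hx'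
      have e1 := hw _ (hAD hx.1) hx.2
      have e2 := hw _ (hAD hx'.1) hx'.2
      simp_all
    have h2 : #{p ∈ A | p.1 = w} ≤ 1 := by omega
    have := card_le_one.1 h2 (w, u) (by simp [hu]) (w, v) (by simp [hv])
    simpa using this
  have hsplit : sigma D = ∑ A ∈ {A ∈ D.powerset | Balanced A} with A ⊆ D', (-1) ^ #A
      + ∑ A ∈ {A ∈ D.powerset | Balanced A} with ¬ A ⊆ D', (-1) ^ #A := by
    rw [sigma, Finset.sum_filter_add_sum_filter_not]
  have h1 : ({A ∈ {A ∈ D.powerset | Balanced A} | A ⊆ D'} : Finset _) =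
      {A ∈ D'.powerset | Balanced A} := by
    ext A
    simp only [mem_filter, mem_powerset]
    exact ⟨fun h => ⟨h.2, h.1.2⟩, fun h => ⟨⟨h.1.trans hsub, h.2⟩, h.1⟩⟩
  have cases : ∀ A ⊆ D, Balanced A → ¬ A ⊆ D' →
      (∃ v, v ≠ w ∧ (a, v) ∈ A) ∨ (∃ v, v ≠ w ∧ (w, v) ∈ A ∧ (a, v) ∈ D) := by
    intro A hAD hA hn
    rw [Finset.not_subset] at hn
    obtain ⟨⟨x, y⟩, hp, hp'⟩ := hn
    rw [hD', mem_filter] at hp'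
    push Not at hp'
    by_cases hc : x = a ∧ y ≠ w
    · left
      exact ⟨y, hc.2, hc.1 ▸ hp⟩
    · right
      have hh := hp' (hAD hp) (by tauto)
      refine ⟨y, ?_, hh.1 ▸ hp, hh.2⟩
      rintro rfl
      have h1 := hh.1
      simp only at h1
      subst h1
      exact hww (hAD hp)
  have h2 : ∑ A ∈ {A ∈ D.powerset | Balanced A} with ¬ A ⊆ D', (-1 : ℤ) ^ #A = 0 := by
    -- Exchange `a → v` for the detour `a → w → v` and conversely. The size changes by one, so the
    -- balanced subsets not contained in `D'` cancel in pairs.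
    let g : Finset (V × V) → Finset (V × V) := fun A =>
      if h : ∃ v, v ≠ w ∧ (a, v) ∈ A then
        insert (a, w) (insert (w, h.choose) (A.erase (a, h.choose)))
      else if h : ∃ v, v ≠ w ∧ (w, v) ∈ A ∧ (a, v) ∈ D then
        insert (a, h.choose) ((A.erase (w, h.choose)).erase (a, w))
      else A
    have g1 : ∀ A ⊆ D, Balanced A → ∀ v, v ≠ w → (a, v) ∈ A →
        g A = insert (a, w) (insert (w, v) (A.erase (a, v))) ∧ (a, w) ∉ A ∧ (w, v) ∉ A := by
      intro A hAD hA v hv hav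
      have h : ∃ v, v ≠ w ∧ (a, v) ∈ A := ⟨v, hv, hav⟩
      have e : h.choose = v := outa A hAD hA _ _ h.choose_spec.2 hav
      refine ⟨by simp only [g]; rw [dif_pos h, e], ?_, ?_⟩
      · intro hc
        exact hv (outa A hAD hA _ _ hav hc)
      · intro hc
        exact hv (outa A hAD hA _ _ hav (outw A hAD hA _ hc).1)
    have g2 : ∀ A ⊆ D, Balanced A → ∀ v, v ≠ w → (w, v) ∈ A → (a, v) ∈ D →
        g A = insert (a, v) ((A.erase (w, v)).erase (a, w)) ∧ (a, w) ∈ A ∧ (a, v) ∉ A := by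
      intro A hAD hA v hv hwv hav
      have haw := (outw A hAD hA _ hwv).1
      have hn : ¬ ∃ v, v ≠ w ∧ (a, v) ∈ A := by
        rintro ⟨u, hu, hau⟩
        exact hu (outa A hAD hA _ _ hau haw)
      have h : ∃ v, v ≠ w ∧ (w, v) ∈ A ∧ (a, v) ∈ D := ⟨v, hv, hwv, hav⟩
      have e : h.choose = v := (outw A hAD hA _ hwv).2 _ h.choose_spec.2.1
      refine ⟨by simp only [g]; rw [dif_neg hn, dif_pos h, e], haw, ?_⟩
      intro hc
      exact hn ⟨v, hv, hc⟩
    have b1 : ∀ A ⊆ D, Balanced A → ∀ v, v ≠ w → (a, v) ∈ A →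
        g A ⊆ D ∧ Balanced (g A) ∧ (w, v) ∈ g A ∧ (a, v) ∈ D ∧ #(g A) = #A + 1 ∧
        insert (a, v) (((g A).erase (w, v)).erase (a, w)) = A := by
      intro A hAD hA v hv hav
      obtain ⟨e, n1, n2⟩ := g1 A hAD hA v hv hav
      have m1 : (w, v) ∉ A.erase (a, v) := fun h => n2 (mem_of_mem_erase h)
      have m2 : (a, w) ∉ insert (w, v) (A.erase (a, v)) := by
        simp only [mem_insert, mem_erase, Prod.mk.injEq]
        tauto
      rw [e]
      refine ⟨?_, ?_, by simp, hAD hav, ?_, ?_⟩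
      · intro p hp
        simp only [mem_insert, mem_erase] at hp
        rcases hp with rfl | rfl | hp
        · exact haw'
        · exact haw v hv (hAD hav)
        · exact hAD hp.2
      · intro x
        rw [excess_insert m2, excess_insert m1, excess_erase hav, hA x]
        ring
      · rw [card_insert_of_notMem m2, card_insert_of_notMem m1, card_erase_of_mem hav]
        have : 0 < #A := card_pos.2 ⟨_, hav⟩
        omega
      · ext p
        simp only [mem_insert, mem_erase]
        by_cases h1 : p = (a, v)
        · simp [h1, hav]
        · by_cases h2 : p = (a, w)
          · simp [h2, n1, Ne.symm hv]
          · by_cases h3 : p = (w, v)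
            · simp [h3, n2, Ne.symm hne]
            · simp [h1, h2, h3]
    have b2 : ∀ A ⊆ D, Balanced A → ∀ v, v ≠ w → (w, v) ∈ A → (a, v) ∈ D →
        g A ⊆ D ∧ Balanced (g A) ∧ (a, v) ∈ g A ∧ #A = #(g A) + 1 ∧
        insert (a, w) (insert (w, v) ((g A).erase (a, v))) = A := by
      intro A hAD hA v hv hwv hav
      obtain ⟨e, n1, n2⟩ := g2 A hAD hA v hv hwv hav
      have m1 : (a, w) ∈ A.erase (w, v) := by
        simp only [mem_erase, ne_eq, Prod.mk.injEq]
        tauto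
      have m2 : (a, v) ∉ (A.erase (w, v)).erase (a, w) := by
        simp only [mem_erase]
        tauto
      rw [e]
      refine ⟨?_, ?_, by simp, ?_, ?_⟩
      · intro p hp
        simp only [mem_insert, mem_erase] at hp
        rcases hp with rfl | hp
        · exact hav
        · exact hAD hp.2.2
      · intro x
        rw [excess_insert m2, excess_erase m1, excess_erase hwv, hA x]
        ring
      · rw [card_insert_of_notMem m2, card_erase_of_mem m1, card_erase_of_mem hwv]
        have : 0 < #(A.erase (w, v)) := card_pos.2 ⟨_, m1⟩
        rw [card_erase_of_mem hwv] at this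
        omega
      · ext p
        simp only [mem_insert, mem_erase]
        by_cases h1 : p = (a, v)
        · simp [h1, n2, hv, hne]
        · by_cases h2 : p = (a, w)
          · simp [h2, n1]
          · by_cases h3 : p = (w, v)
            · simp [h3, hwv]
            · simp [h1, h2, h3]
    have key : ∀ A ⊆ D, Balanced A → ¬ A ⊆ D' → g A ⊆ D ∧ Balanced (g A) ∧ ¬ g A ⊆ D' ∧
        (-1 : ℤ) ^ #A + (-1) ^ #(g A) = 0 ∧ g A ≠ A ∧ g (g A) = A := by
      intro A hAD hA hn
      rcases cases A hAD hA hn with ⟨v, hv, h⟩ | ⟨v, hv, h, h'⟩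
      · obtain ⟨c1, c2, c3, c4, c5, c6⟩ := b1 A hAD hA v hv h
        refine ⟨c1, c2, ?_, ?_, ?_, ?_⟩
        · intro hs
          have := (mem_filter.1 (hs c3)).2.2
          exact this ⟨rfl, c4⟩
        · rw [c5, pow_succ]
          ring
        · intro h
          rw [h] at c5
          omega
        · rw [(g2 _ c1 c2 v hv c3 c4).1, c6]
      · obtain ⟨c1, c2, c3, c5, c6⟩ := b2 A hAD hA v hv h h'
        refine ⟨c1, c2, ?_, ?_, ?_, ?_⟩
        · intro hs
          have := (mem_filter.1 (hs c3)).2.1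
          exact this ⟨rfl, hv⟩
        · rw [c5, pow_succ]
          ring
        · intro h
          rw [h] at c5
          omega
        · rw [(g1 _ c1 c2 v hv c3).1, c6]
    refine Finset.sum_involution (fun A _ => g A) ?_ ?_ ?_ ?_
    all_goals
      intro A hA
      simp only [mem_filter, mem_powerset] at hA
      have := key A hA.1.1 hA.1.2 hA.2
    · exact this.2.2.2.1
    · exact fun _ => this.2.2.2.2.1
    · simp only [mem_filter, mem_powerset]
      exact ⟨⟨this.1, this.2.1⟩, this.2.2.1⟩
    · exact this.2.2.2.2.2
  rw [hsplit, h1, h2, add_zero]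
  rfl

end Arcs

/-! ### Unit flows, that is, directed paths, in acyclic arc sets -/

section Flows

variable {V : Type*}

/-- Arc sets carrying one unit from `a` to `x`. -/
noncomputable def unitFlows (D : Finset (V × V)) (a x : V) : Finset (Finset (V × V)) :=
  {A ∈ D.powerset | ∀ v, excess A v = (if v = a then 1 else 0) - (if v = x then 1 else 0)}

lemma mem_unitFlows {D A : Finset (V × V)} {a x : V} :
    A ∈ unitFlows D a x ↔ A ⊆ D ∧
      ∀ v, excess A v = (if v = a then 1 else 0) - (if v = x then 1 else 0) := by
  simp [unitFlows]

/-- The highest head occurring in the flow has no outgoing arc in it, so its excess is negative;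
only the sink `x` allows this. -/
lemma unitFlows_head_le {D A : Finset (V × V)} {a x : V} {f : V → ℕ}
    (hf : ∀ p ∈ D, f p.1 < f p.2) (hA : A ∈ unitFlows D a x) {p : V × V} (hp : p ∈ A) :
    f p.2 ≤ f x := by
  rw [mem_unitFlows] at hA
  obtain ⟨q, hq, hmax⟩ := A.exists_max_image (fun p => f p.2) ⟨p, hp⟩
  have h0 : #{r ∈ A | r.1 = q.2} = 0 := by
    rw [card_eq_zero, filter_eq_empty_iff]
    intro r hr h
    have := hmax r hr
    have := hf r (hA.1 hr)
    rw [h] at this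
    omega
  have h1 : 0 < #{r ∈ A | r.2 = q.2} := card_pos.2 ⟨q, by simp [hq]⟩
  have h2 := hA.2 q.2
  rw [excess_eq, h0] at h2
  have h3 : q.2 = x := by
    by_contra h
    rw [if_neg h] at h2
    split_ifs at h2 <;> push_cast at h2 <;> omega
  rw [← h3]
  exact hmax p hp

lemma card_unitFlows_self {D : Finset (V × V)} {a : V} {f : V → ℕ}
    (hf : ∀ p ∈ D, f p.1 < f p.2) : #(unitFlows D a a) = 1 := by
  rw [card_eq_one]
  refine ⟨∅, ?_⟩
  ext A
  rw [mem_unitFlows, mem_singleton]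
  constructor
  · rintro ⟨h1, h2⟩
    refine Balanced.eq_empty (fun v => ?_) f fun p hp => hf p (h1 hp)
    rw [h2 v, sub_self]
  · rintro rfl
    exact ⟨by simp, fun v => by simp [excess]⟩

/-- In an acyclic arc set a unit flow is a directed path. Deleting its last arc, the only one
entering `x`, gives the usual recursion for the number of paths. -/
lemma card_unitFlows_step {D : Finset (V × V)} {a x : V} {f : V → ℕ}
    (hf : ∀ p ∈ D, f p.1 < f p.2) (hax : x ≠ a) :
    #(unitFlows D a x) = ∑ p ∈ D with p.2 = x, #(unitFlows D a p.1) := by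
  rw [← card_sigma]
  have hlast : ∀ A ∈ unitFlows D a x, ∃ p ∈ A, p.2 = x ∧ (∀ q ∈ A, q.2 = x → q = p) := by
    intro A hA
    have h0 : #{r ∈ A | r.1 = x} = 0 := by
      rw [card_eq_zero, filter_eq_empty_iff]
      intro r hr h
      have h1 := unitFlows_head_le hf hA hr
      have h2 := hf r ((mem_unitFlows.1 hA).1 hr)
      rw [h] at h2
      omega
    have h2 := (mem_unitFlows.1 hA).2 x
    rw [excess_eq, h0, if_neg hax, if_pos rfl] at h2
    have h3 : #{r ∈ A | r.2 = x} = 1 := by push_cast at h2; omega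
    obtain ⟨p, hp⟩ := card_eq_one.1 h3
    have hp' : p ∈ {r ∈ A | r.2 = x} := by simp [hp]
    rw [mem_filter] at hp'
    refine ⟨p, hp'.1, hp'.2, fun q hq hqx => ?_⟩
    have : q ∈ {r ∈ A | r.2 = x} := by simp [hq, hqx]
    rw [hp] at this
    simpa using this
  symm
  refine Finset.card_bij (fun q _ => insert q.1 q.2) ?_ ?_ ?_
  · rintro ⟨p, A⟩ h
    simp only [mem_sigma, mem_filter] at h
    have hA := mem_unitFlows.1 h.2
    have hpA : p ∉ A := by
      intro hp
      have h1 := unitFlows_head_le hf h.2 hp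
      have h2 := hf p h.1.1
      omega
    rw [mem_unitFlows]
    refine ⟨insert_subset h.1.1 hA.1, fun v => ?_⟩
    rw [excess_insert hpA, hA.2, h.1.2]
    simp only [eq_comm (a := v)]
    ring
  · rintro ⟨p, A⟩ h ⟨p', A'⟩ h' heq
    simp only [mem_sigma, mem_filter] at h h' heq
    have nm : ∀ q ∈ D, q.2 = x → q ∉ A := by
      intro q hq hqx hqA
      have h1 := unitFlows_head_le hf h.2 hqA
      have h2 := hf p h.1.1
      rw [hqx, ← h.1.2] at h1
      omega
    have nm' : ∀ q ∈ D, q.2 = x → q ∉ A' := by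
      intro q hq hqx hqA
      have h1 := unitFlows_head_le hf h'.2 hqA
      have h2 := hf p' h'.1.1
      rw [hqx, ← h'.1.2] at h1
      omega
    have hpp : p = p' := by
      have : p ∈ insert p' A' := heq ▸ mem_insert_self p A
      rw [mem_insert] at this
      exact this.resolve_right (nm' p h.1.1 h.1.2)
    subst hpp
    have : A = A' := by
      rw [← erase_insert (nm p h.1.1 h.1.2), heq, erase_insert (nm' p h.1.1 h.1.2)]
    rw [this]
  · intro A hA
    obtain ⟨p, hp, hpx, -⟩ := hlast A hA
    refine ⟨⟨p, A.erase p⟩, ?_, insert_erase hp⟩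
    have hA' := mem_unitFlows.1 hA
    simp only [mem_sigma, mem_filter, mem_unitFlows]
    refine ⟨⟨hA'.1 hp, hpx⟩, (erase_subset _ _).trans hA'.1, fun v => ?_⟩
    rw [excess_erase hp, hA'.2, hpx]
    simp only [eq_comm (a := v)]
    ring

lemma unitFlows_congr {D D' : Finset (V × V)} {a x : V} {f : V → ℕ}
    (hf : ∀ p ∈ D', f p.1 < f p.2) (hD : D ⊆ D') (h : ∀ p ∈ D', f p.2 ≤ f x → p ∈ D) :
    unitFlows D' a x = unitFlows D a x := by
  ext A
  constructor
  · intro hA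
    rw [mem_unitFlows]
    exact ⟨fun p hp => h p ((mem_unitFlows.1 hA).1 hp) (unitFlows_head_le hf hA hp),
      (mem_unitFlows.1 hA).2⟩
  · intro hA
    rw [mem_unitFlows] at hA ⊢
    exact ⟨hA.1.trans hD, hA.2⟩

/-- Adding the arc `x → a` to an acyclic arc set with an even number of unit flows. -/
lemma sigma_closing_arc {D : Finset (V × V)} {a x : V} {f : V → ℕ}
    (hf : ∀ p ∈ D, f p.1 < f p.2) (hxa : (x, a) ∉ D)
    (h : Even #(unitFlows D a x)) : sigma (insert (x, a) D) ≠ 0 := by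
  refine sigma_ne_zero_of_odd ?_
  -- A nonempty balanced subset must use `x → a`, and the rest of it is a unit flow from `a` to `x`.
  -- With the empty set this is an odd number of subsets.
  have e : {A ∈ (insert (x, a) D).powerset | Balanced A} =
      insert ∅ ((unitFlows D a x).image (insert (x, a))) := by
    ext A
    simp only [mem_filter, mem_powerset, mem_insert, mem_image]
    constructor
    · rintro ⟨h1, h2⟩
      by_cases hm : (x, a) ∈ A
      · right
        refine ⟨A.erase (x, a), ?_, insert_erase hm⟩
        rw [mem_unitFlows]
        refine ⟨by rwa [← subset_insert_iff], fun v => ?_⟩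
        rw [excess_erase hm, h2 v]
        simp only [eq_comm (b := v)]
        ring
      · left
        exact h2.eq_empty f fun p hp => hf p (((subset_insert_iff_of_notMem hm).1 h1) hp)
    · rintro (rfl | ⟨B, hB, rfl⟩)
      · exact ⟨by simp, balanced_empty⟩
      · rw [mem_unitFlows] at hB
        refine ⟨insert_subset_insert _ hB.1, fun v => ?_⟩
        rw [excess_insert (fun hc => hxa (hB.1 hc)), hB.2]
        simp only [eq_comm (b := v)]
        ring
  rw [e, card_insert_of_notMem, card_image_of_injOn]
  · exact h.add_one
  · intro A hA B hB hAB
    rw [mem_coe, mem_unitFlows] at hA hB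
    rw [← erase_insert (fun hc => hxa (hA.1 hc)), ← erase_insert (fun hc => hxa (hB.1 hc))]
    exact congrArg (fun s => s.erase (x, a)) hAB
  · simp only [mem_image, not_exists, not_and]
    intro B _ hB
    exact insert_ne_empty _ _ hB

end Flows

/-! ### Tournaments with a repeated score -/

section Tournament

variable {V : Type*}

lemma sum_comp_involution {α M : Type*} [AddCommMonoid M] {D : Finset α} {c : α → α}
    (cD : ∀ p ∈ D, c p ∈ D) (cc : ∀ p ∈ D, c (c p) = p) (h : α → M) :
    ∑ p ∈ D, h (c p) = ∑ p ∈ D, h p :=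
  Finset.sum_bij' (fun p _ => c p) (fun p _ => c p) cD cD cc cc (fun _ _ => rfl)

set_option maxHeartbeats 1000000 in
/-- A tournament in which two vertices have equal excess has vanishing signed count. -/
lemma sigma_tournament_eq_zero {D : Finset (V × V)} {K : Finset V}
    (hK : ∀ p ∈ D, p.1 ∈ K ∧ p.2 ∈ K) (hloop : ∀ x, (x, x) ∉ D)
    (hD : ∀ x ∈ K, ∀ y ∈ K, x ≠ y → ((x, y) ∈ D ↔ (y, x) ∉ D))
    {u v : V} (hu : u ∈ K) (hv : v ∈ K) (huv : u ≠ v) (hex : excess D u = excess D v) :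
    sigma D = 0 := by
  set τ : V ≃ V := Equiv.swap u v with hτ
  have ττ : ∀ x, τ (τ x) = x := fun x => Equiv.swap_apply_self u v x
  have τK : ∀ x ∈ K, τ x ∈ K := by
    intro x hx
    rw [hτ, Equiv.swap_apply_def]
    split_ifs <;> assumption
  have exτ : ∀ x, excess D (τ x) = excess D x := by
    intro x
    rw [hτ, Equiv.swap_apply_def]
    split_ifs with h1 h2
    · rw [h1, hex]
    · rw [h2, hex]
    · rfl
  -- `c` moves an arc by the transposition of `u` and `v`, turning the image round when it points
  -- against `D`.
  let c : V × V → V × V := fun p =>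
    if (τ p.1, τ p.2) ∈ D then (τ p.1, τ p.2) else (τ p.2, τ p.1)
  have cD : ∀ p ∈ D, c p ∈ D := by
    intro p hp
    simp only [c]
    split_ifs with h
    · exact h
    · have h1 := hK p hp
      have hne : p.1 ≠ p.2 := by
        intro h
        apply hloop p.1
        nth_rewrite 2 [h]
        exact hp
      by_contra h2
      exact h ((hD _ (τK _ h1.1) _ (τK _ h1.2) (fun h => hne (τ.injective h))).2 h2)
  have cc : ∀ p ∈ D, c (c p) = p := by
    intro p hp
    have h1 := hK p hp
    have hne : p.1 ≠ p.2 := by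
      intro h
      apply hloop p.1
      nth_rewrite 2 [h]
      exact hp
    by_cases h : (τ p.1, τ p.2) ∈ D
    · have e : c p = (τ p.1, τ p.2) := if_pos h
      rw [e]
      simp only [c, ττ]
      rw [if_pos hp]
    · have e : c p = (τ p.2, τ p.1) := if_neg h
      rw [e]
      simp only [c, ττ]
      rw [if_neg]
      exact (hD _ h1.1 _ h1.2 hne).1 hp
  -- The arcs that get turned round. `B` will be balanced and of odd size.
  let B : Finset (V × V) := {p ∈ D | (τ p.1, τ p.2) ∉ D}
  have cB : ∀ p ∈ D, (c p ∈ B ↔ p ∈ B) := by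
    intro p hp
    have h1 := hK p hp
    have hne : p.1 ≠ p.2 := by
      intro h
      apply hloop p.1
      nth_rewrite 2 [h]
      exact hp
    have hcp := cD p hp
    by_cases h : (τ p.1, τ p.2) ∈ D
    · have e : c p = (τ p.1, τ p.2) := if_pos h
      rw [e]
      simp only [B, mem_filter, ττ]
      simp [hp, h]
    · have e : c p = (τ p.2, τ p.1) := if_neg h
      rw [e] at hcp ⊢
      simp only [B, mem_filter, ττ]
      have := (hD _ h1.1 _ h1.2 hne).1 hp
      tauto
  let χ : V → V × V → ℤ := fun x p => (if p.1 = x then 1 else 0) - (if p.2 = x then 1 else 0)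
  have χc : ∀ x p, χ x p = (if (τ p.1, τ p.2) ∈ D then 1 else -1) * χ (τ x) (c p) := by
    intro x p
    simp only [χ, c]
    split_ifs with h <;> simp_all
  have reidx : ∀ h : V × V → ℤ, ∑ p ∈ D, h (c p) = ∑ p ∈ D, h p :=
    sum_comp_involution cD cc
  -- Transport along `c` changes the excess of `D` by twice the excess of `B`, but the excess of `D`
  -- is invariant under `τ`.
  have exB : ∀ x, excess B x = 0 := by
    have h1 : ∀ x, excess D x = excess D (τ x) - 2 * excess B (τ x) := by
      intro x
      have : excess D x = ∑ p ∈ D, (χ (τ x) (c p) - 2 * (if c p ∈ B then χ (τ x) (c p) else 0)) := by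
        refine Finset.sum_congr rfl fun p hp => ?_
        change χ x p = _
        rw [χc x p, if_congr (cB p hp) rfl rfl]
        by_cases h : (τ p.1, τ p.2) ∈ D
        · have : p ∉ B := by simp [B, h]
          rw [if_pos h, if_neg this]
          ring
        · have : p ∈ B := by simp [B, h, hp]
          rw [if_neg h, if_pos this]
          ring
      rw [this, reidx (fun q => χ (τ x) q - 2 * (if q ∈ B then χ (τ x) q else 0)),
        Finset.sum_sub_distrib, ← Finset.mul_sum, ← Finset.sum_filter]
      congr 3
      ext p
      simp [B]
    intro x
    have h2 := h1 (τ x)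
    rw [ττ, exτ] at h2
    omega
  -- `c` is an involution on `B` whose only fixed point is the arc between `u` and `v`.
  have cardB : ((#B : ℕ) : ZMod 2) = 1 := by
    obtain ⟨b, hb, hbuv⟩ : ∃ b ∈ B, b = (u, v) ∨ b = (v, u) := by
      by_cases h : (u, v) ∈ D
      · exact ⟨(u, v), by simpa [B, h, hτ] using (hD u hu v hv huv).1 h, Or.inl rfl⟩
      · have h' : (v, u) ∈ D := by
          by_contra h'
          exact h ((hD u hu v hv huv).2 h')
        exact ⟨(v, u), by simpa [B, h', hτ] using h, Or.inr rfl⟩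
    have hcb : c b = b := by
      have h : (τ b.1, τ b.2) ∉ D := (mem_filter.1 hb).2
      have e : c b = (τ b.2, τ b.1) := if_neg h
      rw [e]
      rcases hbuv with rfl | rfl <;> simp [hτ]
    have h0 : ∑ p ∈ B.erase b, (1 : ZMod 2) = 0 := by
      refine Finset.sum_involution (fun p _ => c p) (fun _ _ => by decide) ?_ ?_ ?_
      · intro p hp _ hcp
        rw [mem_erase] at hp
        have hpD := (mem_filter.1 hp.2).1
        have h : (τ p.1, τ p.2) ∉ D := (mem_filter.1 hp.2).2
        have e : c p = (τ p.2, τ p.1) := if_neg h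
        rw [e] at hcp
        have h1 : τ p.1 = p.2 := congrArg Prod.snd hcp
        have hne : p.1 ≠ p.2 := by
          intro h
          apply hloop p.1
          nth_rewrite 2 [h]
          exact hpD
        rw [hτ, Equiv.swap_apply_def] at h1
        have hq : p = (u, v) ∨ p = (v, u) := by
          split_ifs at h1 with h2 h3
          · left
            exact Prod.ext h2 h1.symm
          · right
            exact Prod.ext h3 h1.symm
          · exact absurd h1 hne
        have hbD := (mem_filter.1 hb).1
        have := hD u hu v hv huv
        rcases hbuv with rfl | rfl <;> rcases hq with rfl | rfl <;> tauto
      · intro p hp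
        rw [mem_erase] at hp ⊢
        have hpD := (mem_filter.1 hp.2).1
        refine ⟨fun h => hp.1 ?_, (cB p hpD).2 hp.2⟩
        rw [← cc p hpD, h, hcb]
      · intro p hp
        exact cc p (mem_filter.1 (mem_erase.1 hp).2).1
    have h1 := Finset.sum_erase_add B (fun _ => (1 : ZMod 2)) hb
    rw [h0, zero_add] at h1
    rw [h1]
    simp
  -- Transport by `c` followed by symmetric difference with `B`: it preserves balance because `B` is
  -- balanced and flips parity because `B` is odd.
  let g : Finset (V × V) → Finset (V × V) := fun A => {p ∈ D | ¬ (c p ∈ A ↔ p ∈ B)}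
  have gg : ∀ A ⊆ D, g (g A) = A := by
    intro A hA
    ext p
    simp only [g, mem_filter]
    constructor
    · rintro ⟨hp, h⟩
      rw [cc p hp, cB p hp] at h
      have := cD p hp
      tauto
    · intro hp
      have hpD := hA hp
      refine ⟨hpD, ?_⟩
      rw [cc p hpD, cB p hpD]
      have := cD p hpD
      tauto
  have gcard : ∀ A ⊆ D, ((#(g A) : ℕ) : ZMod 2) = #A + 1 := by
    intro A hA
    have h1 : ∀ p ∈ D, (if ¬ (c p ∈ A ↔ p ∈ B) then (1 : ZMod 2) else 0) =
        (if c p ∈ A then 1 else 0) + (if p ∈ B then 1 else 0) := by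
      intro p _
      by_cases h1 : c p ∈ A <;> by_cases h2 : p ∈ B <;> simp [h1, h2]
      decide
    rw [← cardB, card_filter]
    push_cast
    rw [Finset.sum_congr rfl h1, Finset.sum_add_distrib,
      sum_comp_involution cD cc (fun p => if p ∈ A then (1 : ZMod 2) else 0),
      ← Finset.sum_filter, ← Finset.sum_filter]
    rw [filter_mem_eq_inter, inter_eq_right.2 hA, filter_mem_eq_inter,
      inter_eq_right.2 (filter_subset _ _)]
    simp only [sum_const, nsmul_eq_mul, mul_one, B]
  have gbal : ∀ A ⊆ D, Balanced A → Balanced (g A) := by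
    intro A hA hbal x
    have h1 : excess (g A) x =
        ∑ p ∈ D, ((if c p ∈ A then χ (τ x) (c p) else 0) -
          (if c p ∈ B then χ (τ x) (c p) else 0)) := by
      rw [excess, Finset.sum_filter]
      refine Finset.sum_congr rfl fun p hp => ?_
      change (if _ then χ x p else 0) = _
      rw [χc x p, if_congr (cB p hp) rfl rfl]
      by_cases h : (τ p.1, τ p.2) ∈ D
      · have h' : p ∉ B := by simp [B, h]
        by_cases h'' : c p ∈ A <;> simp [h, h', h'']
      · have h' : p ∈ B := by simp [B, h, hp]
        by_cases h'' : c p ∈ A <;> simp [h, h', h'']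
    rw [h1, reidx (fun q => (if q ∈ A then χ (τ x) q else 0) - (if q ∈ B then χ (τ x) q else 0)),
      Finset.sum_sub_distrib, ← Finset.sum_filter, ← Finset.sum_filter, filter_mem_eq_inter,
      inter_eq_right.2 hA, filter_mem_eq_inter, inter_eq_right.2 (filter_subset _ _)]
    have e1 := hbal (τ x)
    have e2 := exB (τ x)
    rw [excess] at e1 e2
    rw [e1, e2, sub_zero]
  have gpar : ∀ A ⊆ D, (-1 : ℤ) ^ #A + (-1) ^ #(g A) = 0 := by
    intro A hA
    have h := gcard A hA
    rcases Nat.even_or_odd #A with h1 | h1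
    · have h2 : Odd #(g A) := by
        rw [← ZMod.natCast_eq_one_iff_odd, h, (ZMod.natCast_eq_zero_iff_even).2 h1, zero_add]
      rw [h1.neg_one_pow, h2.neg_one_pow]
      norm_num
    · have h2 : Even #(g A) := by
        rw [← ZMod.natCast_eq_zero_iff_even, h, (ZMod.natCast_eq_one_iff_odd).2 h1]
        decide
      rw [h1.neg_one_pow, h2.neg_one_pow]
      norm_num
  refine Finset.sum_involution (fun A _ => g A) ?_ ?_ ?_ ?_
  all_goals
    intro A hA
    simp only [mem_filter, mem_powerset] at hA
  · exact gpar A hA.1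
  · intro _ h
    have h1 := gpar A hA.1
    rw [h] at h1
    rcases neg_one_pow_eq_or ℤ #A with h2 | h2 <;> rw [h2] at h1 <;> norm_num at h1
  · simp only [mem_filter, mem_powerset]
    exact ⟨filter_subset _ _, gbal A hA.1 hA.2⟩
  · exact gg A hA.1

end Tournament

/-! ### Digraphs as finite sets of arcs -/

section Digraphs

variable {V : Type*} [Fintype V]

/-- The arcs of a digraph. -/
noncomputable def arcs (D : Digraph V) : Finset (V × V) := {p | D.Adj p.1 p.2}

@[simp] lemma mem_arcs {D : Digraph V} {p : V × V} : p ∈ arcs D ↔ D.Adj p.1 p.2 := by simp [arcs]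

/-- The digraph with a given set of arcs. -/
def ofArcs (A : Finset (V × V)) : Digraph V := ⟨fun u v => (u, v) ∈ A⟩

lemma arcs_ofArcs (A : Finset (V × V)) : arcs (ofArcs A) = A := by
  ext p
  simp [ofArcs]

lemma arcs_injective : Function.Injective (arcs (V := V)) := by
  intro A B h
  ext u v
  have : (u, v) ∈ arcs A ↔ (u, v) ∈ arcs B := by rw [h]
  simpa using this

lemma arcCount_eq (D : Digraph V) : arcCount D = #(arcs D) := by
  rw [arcCount, ← Set.ncard_coe_finset]
  congr 1
  ext p
  simp

lemma outDeg_eq (D : Digraph V) (v : V) : outDeg D v = #{p ∈ arcs D | p.1 = v} := by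
  rw [outDeg, ← Set.ncard_coe_finset]
  refine Set.ncard_congr (fun w _ => (v, w)) ?_ ?_ ?_
  · intro w hw
    simpa using hw
  · intro a b _ _ h
    simpa using h
  · rintro ⟨x, y⟩ h
    simp only [coe_filter, mem_arcs, Set.mem_ofPred_eq] at h
    exact ⟨y, by simpa [← h.2] using h.1, by simp [h.2]⟩

lemma inDeg_eq (D : Digraph V) (v : V) : inDeg D v = #{p ∈ arcs D | p.2 = v} := by
  rw [inDeg, ← Set.ncard_coe_finset]
  refine Set.ncard_congr (fun w _ => (w, v)) ?_ ?_ ?_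
  · intro w hw
    simpa using hw
  · intro a b _ _ h
    simpa using h
  · rintro ⟨x, y⟩ h
    simp only [coe_filter, mem_arcs, Set.mem_ofPred_eq] at h
    exact ⟨x, by simpa [← h.2] using h.1, by simp [h.2]⟩

lemma isEulerian_iff (D : Digraph V) : IsEulerian D ↔ Balanced (arcs D) := by
  refine forall_congr' fun v => ?_
  rw [outDeg_eq, inDeg_eq, excess_eq]
  omega

lemma ncard_subdigraphs (D : Digraph V) (P : ℕ → Prop) :
    {A : Digraph V | A ≤ D ∧ IsEulerian A ∧ P (arcCount A)}.ncard =
      #{A ∈ {A ∈ (arcs D).powerset | Balanced A} | P #A} := by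
  rw [← Set.ncard_image_of_injective _ arcs_injective, ← Set.ncard_coe_finset]
  congr 1
  ext A
  simp only [Set.mem_image, Set.mem_ofPred_eq, coe_filter, mem_filter, mem_powerset]
  constructor
  · rintro ⟨A', ⟨h1, h2, h3⟩, rfl⟩
    rw [isEulerian_iff] at h2
    rw [arcCount_eq] at h3
    exact ⟨⟨fun p hp => mem_arcs.2 (h1 (mem_arcs.1 hp)), h2⟩, h3⟩
  · rintro ⟨⟨h1, h2⟩, h3⟩
    refine ⟨ofArcs A, ⟨fun u v h => ?_, ?_, ?_⟩, arcs_ofArcs A⟩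
    · exact mem_arcs.1 (h1 h : (u, v) ∈ arcs D)
    · rwa [isEulerian_iff, arcs_ofArcs]
    · rwa [arcCount_eq, arcs_ofArcs]

lemma EE_sub_EO (D : Digraph V) : (EE D : ℤ) - EO D = sigma (arcs D) := by
  rw [EE, EO, ncard_subdigraphs D Even, ncard_subdigraphs D Odd, sigma,
    ← Finset.sum_filter_add_sum_filter_not _ (fun A => Even #A)]
  have h1 : ∑ A ∈ {A ∈ {A ∈ (arcs D).powerset | Balanced A} | Even #A}, (-1 : ℤ) ^ #A =
      #{A ∈ {A ∈ (arcs D).powerset | Balanced A} | Even #A} := by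
    rw [Finset.sum_congr rfl (fun A hA => ((mem_filter.1 hA).2).neg_one_pow)]
    simp
  have h2 : ∑ A ∈ {A ∈ {A ∈ (arcs D).powerset | Balanced A} | ¬ Even #A}, (-1 : ℤ) ^ #A =
      - #{A ∈ {A ∈ (arcs D).powerset | Balanced A} | Odd #A} := by
    simp only [Nat.not_even_iff_odd]
    rw [Finset.sum_congr rfl (fun A hA => ((mem_filter.1 hA).2).neg_one_pow)]
    simp
  rw [h1, h2, sub_eq_add_neg]
  congr!

lemma EE_ne_EO_iff (D : Digraph V) : EE D ≠ EO D ↔ sigma (arcs D) ≠ 0 := by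
  rw [← EE_sub_EO]
  omega

end Digraphs

/-! ### Invariance under injections of the vertex set -/

section Transfer

variable {α β : Type*}

lemma excess_map (e : α ↪ β) (A : Finset (α × α)) (v : α) :
    excess (A.map (e.prodMap e)) (e v) = excess A v := by
  rw [excess, Finset.sum_map]
  simp only [Function.Embedding.coe_prodMap, Prod.map_fst, Prod.map_snd,
    EmbeddingLike.apply_eq_iff_eq]
  rfl

lemma excess_map_of_notMem (e : α ↪ β) (A : Finset (α × α)) {v : β} (hv : v ∉ Set.range e) :
    excess (A.map (e.prodMap e)) v = 0 := by
  have h : ∀ x, e x ≠ v := fun x hx => hv ⟨x, hx⟩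
  rw [excess, Finset.sum_map]
  simp [h, -Finset.sum_sub_distrib]

lemma balanced_map (e : α ↪ β) (A : Finset (α × α)) :
    Balanced (A.map (e.prodMap e)) ↔ Balanced A := by
  constructor
  · intro h v
    rw [← excess_map e, h]
  · intro h v
    by_cases hv : v ∈ Set.range e
    · obtain ⟨x, rfl⟩ := hv
      rw [excess_map, h]
    · exact excess_map_of_notMem e A hv

lemma sigma_map (e : α ↪ β) (D : Finset (α × α)) :
    sigma (D.map (e.prodMap e)) = sigma D := by
  symm
  refine Finset.sum_bij (fun A _ => A.map (e.prodMap e)) ?_ ?_ ?_ ?_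
  · intro A hA
    simp only [mem_filter, mem_powerset] at hA ⊢
    exact ⟨map_subset_map.2 hA.1, (balanced_map e A).2 hA.2⟩
  · intro A _ B _ h
    exact map_injective _ h
  · intro B hB
    simp only [mem_filter, mem_powerset] at hB
    obtain ⟨A, hA, rfl⟩ := subset_map_iff.1 hB.1
    refine ⟨A, ?_, rfl⟩
    simp only [mem_filter, mem_powerset]
    exact ⟨hA, (balanced_map e A).1 hB.2⟩
  · intro A _
    rw [card_map]

end Transfer

/-! ### Good vertex sets and the two consequences of criticality -/

section Good

variable {V : Type*}

/-- `D` is an orientation of the subgraph of `G` induced on `S`. -/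
def OrientsOn (G : SimpleGraph V) (S : Finset V) (D : Finset (V × V)) : Prop :=
  (∀ p ∈ D, G.Adj p.1 p.2 ∧ p.1 ∈ S ∧ p.2 ∈ S) ∧
    ∀ u ∈ S, ∀ v ∈ S, G.Adj u v → ((u, v) ∈ D ↔ (v, u) ∉ D)

/-- The number of neighbours of `v` in `S`. -/
noncomputable def degOn (G : SimpleGraph V) (S : Finset V) (v : V) : ℕ := #{u ∈ S | G.Adj v u}

lemma degOn_mono (G : SimpleGraph V) {S T : Finset V} (h : S ⊆ T) (v : V) :
    degOn G S v ≤ degOn G T v := card_le_card (filter_subset_filter _ h)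

lemma degOn_union (G : SimpleGraph V) {S T : Finset V} (h : Disjoint S T) (v : V) :
    degOn G (S ∪ T) v = degOn G S v + degOn G T v := by
  rw [degOn, filter_union, card_union_of_disjoint (disjoint_filter_filter h)]
  rfl

lemma OrientsOn.out_add_in {G : SimpleGraph V} {S : Finset V} {D : Finset (V × V)}
    (h : OrientsOn G S D) {v : V} (hv : v ∈ S) :
    #{p ∈ D | p.1 = v} + #{p ∈ D | p.2 = v} = degOn G S v := by
  rw [← card_image_of_injOn (s := {p ∈ D | p.1 = v}) (f := Prod.snd),
    ← card_image_of_injOn (s := {p ∈ D | p.2 = v}) (f := Prod.fst), ← card_union_of_disjoint]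
  · rw [degOn]
    congr 1
    ext u
    simp only [mem_union, mem_image, mem_filter, Prod.exists, exists_eq_right]
    constructor
    · rintro (hx | ⟨x, y, ⟨hx, rfl⟩, rfl⟩)
      · exact ⟨(h.1 _ hx).2.2, (h.1 _ hx).1⟩
      · exact ⟨(h.1 _ hx).2.1, (h.1 _ hx).1.symm⟩
    · rintro ⟨hu, ha⟩
      by_cases hd : (v, u) ∈ D
      · exact Or.inl hd
      · exact Or.inr ⟨u, v, ⟨(h.2 u hu v hv ha.symm).2 hd, rfl⟩, rfl⟩
  · rw [Finset.disjoint_left]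
    intro u hu hu'
    simp only [mem_image, mem_filter, Prod.exists, exists_eq_right] at hu hu'
    obtain ⟨x, y, ⟨hx, rfl⟩, rfl⟩ := hu'
    exact (h.2 _ (h.1 _ hu).2.1 _ (h.1 _ hu).2.2 (h.1 _ hu).1).1 hu hx
  · rintro ⟨a, b⟩ h1 ⟨c, d⟩ h2 h3
    simp_all
  · rintro ⟨a, b⟩ h1 ⟨c, d⟩ h2 h3
    simp_all

variable [Fintype V]

/-- The subgraph induced on `S` has an orientation with nonzero signed count in which every vertex
has enough in-neighbours for `k - 1` colours, if all edges leaving `S` are oriented away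
from `S`. -/
def Good (G : SimpleGraph V) (k : ℕ) (S : Finset V) : Prop :=
  ∃ D, OrientsOn G S D ∧ sigma D ≠ 0 ∧ ∀ v ∈ S, degOn G univ v + 2 ≤ k + #{p ∈ D | p.2 = v}

/-- The infimum in `atNumber` is over a nonempty set: orienting along any linear order of the
vertices leaves only the empty balanced subset. -/
lemma exists_isAT {V : Type*} [Finite V] (G : SimpleGraph V) : ∃ k, IsAT G (fun _ => k) := by
  have := Fintype.ofFinite V
  obtain ⟨e⟩ : Nonempty (V ≃ Fin (Fintype.card V)) := ⟨Fintype.equivFin V⟩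
  refine ⟨#(univ : Finset (V × V)) + 1, ofArcs {p | G.Adj p.1 p.2 ∧ e p.1 < e p.2}, ?_, ?_, ?_⟩
  · intro u v
    simp only [ofArcs, mem_filter, mem_univ, true_and]
    constructor
    · constructor
      · intro h
        rcases lt_trichotomy (e u) (e v) with h1 | h1 | h1
        · exact Or.inl ⟨h, h1⟩
        · exact absurd (e.injective h1) h.ne
        · exact Or.inr ⟨h.symm, h1⟩
      · rintro (h | h)
        · exact h.1
        · exact h.1.symm
    · rintro ⟨h1, h2⟩
      exact absurd h1.2 (not_lt.2 h2.2.le)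
  · rw [EE_ne_EO_iff, arcs_ofArcs, sigma_acyclic e]
    · exact one_ne_zero
    · intro p hp
      exact (mem_filter.1 hp).2.2
  · intro v
    rw [outDeg_eq]
    exact Nat.add_le_add_right (card_le_card (subset_univ _)) 1

lemma isAT_of_atNumber_lt {V : Type*} [Finite V] {G : SimpleGraph V} {k : ℕ}
    (h : atNumber G < k) : IsAT G (fun _ => k - 1) := by
  obtain ⟨D, h1, h2, h3⟩ : IsAT G (fun _ => atNumber G) := Nat.sInf_mem (exists_isAT G)
  refine ⟨D, h1, h2, fun v => ?_⟩
  have := h3 v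
  simp only at this ⊢
  omega

lemma IsOrientation.orientsOn {V : Type*} [Fintype V] {G : SimpleGraph V} {D : Digraph V}
    (h : IsOrientation G D) : OrientsOn G univ (arcs D) := by
  constructor
  · intro p hp
    exact ⟨(h _ _).1.2 (Or.inl (mem_arcs.1 hp)), mem_univ _, mem_univ _⟩
  · intro u _ v _ huv
    have h1 := (h u v).1.1 huv
    have h2 := (h u v).2
    simp only [mem_arcs]
    tauto

lemma orient_aux {a p q : Prop} (h1 : p → a) (h2 : q → a) (h3 : a → (p ↔ ¬ q)) :
    (a ↔ p ∨ q) ∧ ¬ (p ∧ q) := by tauto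

set_option maxHeartbeats 1000000 in
/-- In a critical graph no nonempty vertex set is good. -/
lemma IsATCritical.not_good {G : SimpleGraph V} {k : ℕ} (hG : IsATCritical G k) (hk : 0 < k)
    {S : Finset V} (hS : S.Nonempty) : ¬ Good G k S := by
  rintro ⟨D₁, hD₁, hs₁, hdeg⟩
  -- `H` is `G - S`, which criticality orients with out-degrees at most `k - 2`; `X` below collects
  -- the edges from `S` to the rest, directed outwards.
  let H : G.Subgraph := (⊤ : G.Subgraph).induce {v | v ∉ S}
  have hH : H ≠ ⊤ := by
    intro h
    obtain ⟨x, hx⟩ := hS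
    have : x ∈ H.verts := by rw [h]; trivial
    exact this hx
  obtain ⟨D, hD, hne, hout⟩ := isAT_of_atNumber_lt (hG.2 H hH)
  have : Fintype H.verts := Fintype.ofFinite _
  rw [EE_ne_EO_iff] at hne
  let e : H.verts ↪ V := Function.Embedding.subtype _
  let D₂ : Finset (V × V) := (arcs D).map (e.prodMap e)
  let X : Finset (V × V) := {p | G.Adj p.1 p.2 ∧ p.1 ∈ S ∧ p.2 ∉ S}
  have mem₂ : ∀ u v, (u, v) ∈ D₂ ↔ ∃ (hu : u ∉ S) (hv : v ∉ S), D.Adj ⟨u, hu⟩ ⟨v, hv⟩ := by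
    intro u v
    simp only [D₂, mem_map, mem_arcs, Prod.exists, Function.Embedding.coe_prodMap, Prod.map_apply,
      Prod.mk.injEq]
    constructor
    · rintro ⟨⟨a, ha⟩, ⟨b, hb⟩, h, rfl, rfl⟩
      exact ⟨ha, hb, h⟩
    · rintro ⟨hu, hv, h⟩
      exact ⟨⟨u, hu⟩, ⟨v, hv⟩, h, rfl, rfl⟩
  have hD₂ : OrientsOn G (univ.filter (· ∉ S)) D₂ := by
    constructor
    · rintro ⟨u, v⟩ hp
      obtain ⟨hu, hv, h⟩ := (mem₂ u v).1 hp
      have h1 : G.Adj u v := ((hD _ _).1.2 (Or.inl h)).2.2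
      exact ⟨h1, by simpa using hu, by simpa using hv⟩
    · intro u hu v hv huv
      simp only [mem_filter, mem_univ, true_and] at hu hv
      have hadj : H.coe.Adj ⟨u, hu⟩ ⟨v, hv⟩ := ⟨hu, hv, huv⟩
      have h1 := (hD ⟨u, hu⟩ ⟨v, hv⟩).1.1 hadj
      have h2 := (hD ⟨u, hu⟩ ⟨v, hv⟩).2
      rw [mem₂, mem₂]
      simp only [hu, hv, not_false_eq_true, exists_true_left]
      tauto
  let DD := D₁ ∪ X ∪ D₂
  have memDD : ∀ p, p ∈ DD ↔ p ∈ D₁ ∨ p ∈ X ∨ p ∈ D₂ := by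
    intro p
    simp only [DD, mem_union, or_assoc]
  have in₁ : ∀ p ∈ D₁, p.1 ∈ S ∧ p.2 ∈ S := fun p hp => (hD₁.1 p hp).2
  have in₂ : ∀ p ∈ D₂, p.1 ∉ S ∧ p.2 ∉ S := fun p hp => by
    simpa using (hD₂.1 p hp).2
  have inX : ∀ p, p ∈ X ↔ G.Adj p.1 p.2 ∧ p.1 ∈ S ∧ p.2 ∉ S := fun p => by simp [X]
  have hsig : sigma DD ≠ 0 := by
    rw [sigma_cut S]
    · have e1 : {p ∈ DD | p.1 ∈ S ∧ p.2 ∈ S} = D₁ := by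
        ext p
        rw [mem_filter, memDD, inX]
        have := in₁ p
        have := in₂ p
        tauto
      have e2 : {p ∈ DD | p.1 ∉ S ∧ p.2 ∉ S} = D₂ := by
        ext p
        rw [mem_filter, memDD, inX]
        have := in₁ p
        have := in₂ p
        tauto
      rw [e1, e2, sigma_map]
      exact mul_ne_zero hs₁ hne
    · intro p hp
      rw [memDD, inX] at hp
      have := in₁ p
      have := in₂ p
      tauto
  have hAT : IsAT G (fun _ => k - 1) := by
    refine ⟨ofArcs DD, ?_, ?_, ?_⟩
    · intro u v
      change (G.Adj u v ↔ (u, v) ∈ DD ∨ (v, u) ∈ DD) ∧ ¬ ((u, v) ∈ DD ∧ (v, u) ∈ DD)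
      have e : ∀ x y, (x, y) ∈ DD ↔
          (x, y) ∈ D₁ ∨ (G.Adj x y ∧ x ∈ S ∧ y ∉ S) ∨ (x, y) ∈ D₂ := by
        intro x y
        rw [memDD, inX]
      have n₁ : ∀ x y, x ∉ S ∨ y ∉ S → (x, y) ∉ D₁ := fun x y h hp => by
        have := in₁ _ hp
        tauto
      have n₂ : ∀ x y, x ∈ S ∨ y ∈ S → (x, y) ∉ D₂ := fun x y h hp => by
        have := in₂ _ hp
        tauto
      by_cases hu : u ∈ S <;> by_cases hv : v ∈ S
      · have e' : ∀ x ∈ S, ∀ y ∈ S, ((x, y) ∈ DD ↔ (x, y) ∈ D₁) := by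
          intro x hx y hy
          simp [e, hx, hy, n₂ x y (Or.inl hx)]
        rw [e' u hu v hv, e' v hv u hu]
        exact orient_aux (fun h => (hD₁.1 _ h).1) (fun h => (hD₁.1 _ h).1.symm) (hD₁.2 u hu v hv)
      · simp only [e, n₁ u v (Or.inr hv), n₁ v u (Or.inl hv), n₂ u v (Or.inl hu),
          n₂ v u (Or.inr hu), hu, hv]
        simp
      · simp only [e, n₁ u v (Or.inl hu), n₁ v u (Or.inr hu), n₂ u v (Or.inr hv),
          n₂ v u (Or.inl hv), hu, hv]
        simp [G.adj_comm]
      · have e' : ∀ x ∉ S, ∀ y ∉ S, ((x, y) ∈ DD ↔ (x, y) ∈ D₂) := by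
          intro x hx y hy
          simp [e, hx, n₁ x y (Or.inl hx)]
        rw [e' u hu v hv, e' v hv u hu]
        exact orient_aux (fun h => (hD₂.1 _ h).1) (fun h => (hD₂.1 _ h).1.symm)
          (hD₂.2 u (by simpa using hu) v (by simpa using hv))
    · rwa [EE_ne_EO_iff, arcs_ofArcs]
    · intro v
      rw [outDeg_eq, arcs_ofArcs]
      by_cases hv : v ∈ S
      · have h1 := hD₁.out_add_in hv
        have h2 := hdeg v hv
        have h3 : degOn G univ v = degOn G S v + degOn G (univ.filter (· ∉ S)) v := by
          rw [← degOn_union]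
          · congr 1
            ext x
            by_cases hx : x ∈ S <;> simp [hx]
          · rw [Finset.disjoint_left]
            intro x hx hx'
            simp [hx] at hx'
        have h4 : #{p ∈ DD | p.1 = v} ≤ #{p ∈ D₁ | p.1 = v} + degOn G (univ.filter (· ∉ S)) v := by
          have : {p ∈ DD | p.1 = v} ⊆ {p ∈ D₁ | p.1 = v} ∪
              ({u ∈ univ.filter (· ∉ S) | G.Adj v u} : Finset V).image (fun u => (v, u)) := by
            rintro ⟨x, y⟩ hp
            simp only [mem_filter, memDD, inX] at hp
            obtain ⟨hp, rfl⟩ := hp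
            have := in₂ (x, y)
            simp only [mem_union, mem_filter, mem_image, mem_univ, true_and, Prod.mk.injEq,
              exists_eq_right]
            tauto
          refine (card_le_card this).trans ((card_union_le _ _).trans ?_)
          exact Nat.add_le_add_left card_image_le _
        change _ ≤ k - 1
        omega
      · have h1 := hout ⟨v, hv⟩
        rw [outDeg_eq] at h1
        refine le_trans (Nat.add_le_add_right ?_ 1) h1
        rw [← card_map (e.prodMap e)]
        refine card_le_card ?_
        rintro ⟨x, y⟩ hp
        simp only [mem_filter, memDD, inX] at hp
        obtain ⟨hp, rfl⟩ := hp
        have h2 : (x, y) ∈ D₂ := by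
          have := in₁ (x, y)
          tauto
        obtain ⟨hx, hy, h⟩ := (mem₂ x y).1 h2
        rw [mem_map]
        exact ⟨(⟨x, hx⟩, ⟨y, hy⟩), by simpa using h, rfl⟩
  have h1 := Nat.sInf_le (s := {k | IsAT G (fun _ => k)}) hAT
  have h2 := hG.1
  rw [atNumber] at h2
  omega

/-- A critical graph other than the complete graph on `k` vertices has no `k`-clique. -/
lemma IsATCritical.card_clique_ne {G : SimpleGraph V} {k : ℕ} (hG : IsATCritical G k)
    (hk : 1 < k) (hne : ¬ Nonempty (G ≃g (⊤ : SimpleGraph (Fin k)))) {K : Finset V}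
    (hK : G.IsClique (K : Set V)) : #K ≠ k := by
  intro hcard
  let H : G.Subgraph := (⊤ : G.Subgraph).induce (K : Set V)
  by_cases hH : H = ⊤
  · apply hne
    have huniv : ∀ x, x ∈ K := by
      intro x
      have : x ∈ H.verts := by rw [hH]; trivial
      exact this
    have hc : Fintype.card V = Fintype.card (Fin k) := by
      rw [Fintype.card_fin, ← hcard, ← Finset.card_univ]
      congr 1
      ext x
      simp [huniv]
    refine ⟨⟨Fintype.equivOfCardEq hc, ?_⟩⟩
    intro a b
    simp only [SimpleGraph.top_adj, ne_eq, EmbeddingLike.apply_eq_iff_eq]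
    exact ⟨fun h => hK (huniv a) (huniv b) h, fun h => h.ne⟩
  · obtain ⟨D, hD, hs, hout⟩ := isAT_of_atNumber_lt (hG.2 H hH)
    have hfin : Fintype H.verts := Fintype.ofFinite _
    have hcardH : Fintype.card H.verts = k := by
      rw [← hcard, ← Nat.card_eq_fintype_card]
      exact Nat.card_coe_set_eq (K : Set V) |>.trans (Set.ncard_coe_finset K)
    rw [EE_ne_EO_iff] at hs
    have hadj : ∀ x y : H.verts, x ≠ y → H.coe.Adj x y := by
      intro x y hxy
      exact ⟨x.2, y.2, hK x.2 y.2 (fun h => hxy (Subtype.ext h))⟩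
    have hor := hD.orientsOn
    -- There are `k` vertices but only `k - 1` possible out-degrees. Since all degrees are `k - 1`,
    -- equal out-degrees mean equal excess.
    obtain ⟨u, -, v, -, huv, heq⟩ := Finset.exists_ne_map_eq_of_card_lt_of_maps_to
      (s := (univ : Finset H.verts)) (t := range (k - 1)) (f := fun v => outDeg D v)
      (by rw [card_range, Finset.card_univ, hcardH]; omega)
      (by
        intro v _
        have := hout v
        simp only [coe_range, Set.mem_Iio] at this ⊢
        omega)
    have hdeg : ∀ v : H.verts, degOn H.coe univ v = k - 1 := by
      intro v
      rw [degOn, ← hcardH, ← Finset.card_univ, ← card_erase_of_mem (mem_univ v)]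
      congr 1
      ext x
      simp only [mem_filter, mem_univ, true_and, mem_erase, and_true]
      exact ⟨fun h => h.ne', fun h => hadj _ _ h.symm⟩
    refine hs (sigma_tournament_eq_zero (K := univ) (by simp) ?_ ?_ (mem_univ u) (mem_univ v)
      huv ?_)
    · intro x hx
      exact (hor.1 _ hx).1.ne rfl
    · intro x hx y hy hxy
      exact hor.2 x hx y hy (hadj x y hxy)
    · have h1 := hor.out_add_in (mem_univ u)
      have h2 := hor.out_add_in (mem_univ v)
      rw [hdeg] at h1 h2
      rw [excess_eq, excess_eq]
      simp only [outDeg_eq] at heq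
      omega

end Good

/-! ### Growing acyclic orientations and closing them by one arc -/

section Grow

variable {V : Type*}

/-- The new vertex `v` is placed above all of `S` by the height function, so old path counts stay
unchanged and paths to `v` are counted by their last arc. -/
lemma exists_extend_acyclic {S : Finset V} {D : Finset (V × V)} {f : V → ℕ}
    (hD : ∀ p ∈ D, p.1 ∈ S ∧ p.2 ∈ S) (hf : ∀ p ∈ D, f p.1 < f p.2) {a v : V} (ha : a ∈ S)
    (hv : v ∉ S) {N : Finset V} (hN : N ⊆ S) :
    ∃ f' : V → ℕ, (∀ p ∈ D ∪ N.image (fun u => (u, v)), f' p.1 < f' p.2) ∧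
      (∀ u ∈ S, unitFlows (D ∪ N.image (fun u => (u, v))) a u = unitFlows D a u) ∧
      #(unitFlows (D ∪ N.image (fun u => (u, v))) a v) = ∑ u ∈ N, #(unitFlows D a u) := by
  have hlt : ∀ u ∈ S, f u < S.sup f + 1 := fun u hu => Nat.lt_succ_of_le (le_sup hu)
  let f' : V → ℕ := fun x => if x = v then S.sup f + 1 else f x
  have hfv : f' v = S.sup f + 1 := if_pos rfl
  have hfS : ∀ u ∈ S, f' u = f u := fun u hu => if_neg (ne_of_mem_of_not_mem hu hv)
  have hf' : ∀ p ∈ D ∪ N.image (fun u => (u, v)), f' p.1 < f' p.2 := by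
    intro p hp
    rw [mem_union, mem_image] at hp
    rcases hp with hp | ⟨u, hu, rfl⟩
    · rw [hfS _ (hD p hp).1, hfS _ (hD p hp).2]
      exact hf p hp
    · rw [hfS _ (hN hu), hfv]
      exact hlt u (hN hu)
  have hcongr : ∀ u ∈ S, unitFlows (D ∪ N.image (fun u => (u, v))) a u = unitFlows D a u := by
    intro u hu
    refine unitFlows_congr hf' subset_union_left ?_
    intro p hp hle
    rw [mem_union, mem_image] at hp
    rcases hp with hp | ⟨w, hw, rfl⟩
    · exact hp
    · rw [hfS u hu] at hle
      simp only [hfv] at hle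
      have := hlt u hu
      omega
  refine ⟨f', hf', hcongr, ?_⟩
  have e : {p ∈ D ∪ N.image (fun u => (u, v)) | p.2 = v} = N.image (fun u => (u, v)) := by
    ext p
    simp only [mem_filter, mem_union, mem_image]
    constructor
    · rintro ⟨h | h, h'⟩
      · exact absurd (h' ▸ (hD p h).2) hv
      · exact h
    · rintro ⟨u, hu, rfl⟩
      exact ⟨Or.inr ⟨u, hu, rfl⟩, rfl⟩
  rw [card_unitFlows_step hf' (ne_of_mem_of_not_mem ha hv).symm, e, Finset.sum_image (by simp)]
  exact Finset.sum_congr rfl fun u hu => by rw [hcongr u (hN hu)]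

/-- `N` holds the in-neighbours of `v` and `O` its out-neighbours. `O` is empty while growing and
consists of the root when closing up. -/
lemma OrientsOn.extend {G : SimpleGraph V} {S : Finset V} {D : Finset (V × V)} (hD : OrientsOn G S D) {v : V}
    (hv : v ∉ S) {N O : Finset V} (hNO : Disjoint N O) (h : N ∪ O = {u ∈ S | G.Adj v u}) :
    OrientsOn G (insert v S)
      (D ∪ N.image (fun u => (u, v)) ∪ O.image (fun u => (v, u))) := by
  have hN : ∀ u ∈ N, u ∈ S ∧ G.Adj v u := fun u hu =>
    mem_filter.1 (h ▸ mem_union_left _ hu)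
  have hO : ∀ u ∈ O, u ∈ S ∧ G.Adj v u := fun u hu =>
    mem_filter.1 (h ▸ mem_union_right _ hu)
  have hin := fun p hp => (hD.1 p hp).2
  constructor
  · intro p hp
    simp only [mem_union, mem_image] at hp
    rcases hp with (hp | ⟨u, hu, rfl⟩) | ⟨u, hu, rfl⟩
    · exact ⟨(hD.1 p hp).1, mem_insert_of_mem (hD.1 p hp).2.1, mem_insert_of_mem (hD.1 p hp).2.2⟩
    · exact ⟨(hN u hu).2.symm, mem_insert_of_mem (hN u hu).1, mem_insert_self _ _⟩
    · exact ⟨(hO u hu).2, mem_insert_self _ _, mem_insert_of_mem (hO u hu).1⟩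
  · have key : ∀ x ∈ S, G.Adj v x →
        (((v, x) ∈ D ∪ N.image (fun u => (u, v)) ∪ O.image (fun u => (v, u))) ↔ x ∈ O) ∧
        (((x, v) ∈ D ∪ N.image (fun u => (u, v)) ∪ O.image (fun u => (v, u))) ↔ x ∈ N) := by
      intro x hx hvx
      have n1 : (v, x) ∉ D := fun hp => hv (hin _ hp).1
      have n2 : (x, v) ∉ D := fun hp => hv (hin _ hp).2
      have hne : v ≠ x := hvx.ne
      constructor
      · simp [n1, hne]
      · simp [n2, hne]
    have key2 : ∀ x ∈ S, G.Adj v x → (x ∈ O ↔ x ∉ N) := by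
      intro x hx hvx
      have h1 : x ∈ N ∪ O := by rw [h]; simp [hx, hvx]
      rw [mem_union] at h1
      constructor
      · exact fun hO hN => Finset.disjoint_left.1 hNO hN hO
      · exact h1.resolve_left
    intro x hx y hy hxy
    rw [mem_insert] at hx hy
    rcases hx with rfl | hx <;> rcases hy with rfl | hy
    · exact absurd rfl hxy.ne
    · rw [(key y hy hxy).1, (key y hy hxy).2]
      exact key2 y hy hxy
    · rw [(key x hx hxy.symm).1, (key x hx hxy.symm).2]
      have := key2 x hx hxy.symm
      tauto
    · have e : ∀ x ∈ S, ∀ y ∈ S,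
          ((x, y) ∈ D ∪ N.image (fun u => (u, v)) ∪ O.image (fun u => (v, u)) ↔ (x, y) ∈ D) := by
        intro x hx y hy
        have h1 : v ≠ x := fun h => hv (h ▸ hx)
        have h2 : v ≠ y := fun h => hv (h ▸ hy)
        simp [h1, h2]
      rw [e x hx y hy, e y hy x hx]
      exact hD.2 x hx y hy hxy

variable [Fintype V]

/-- A vertex set that can be built from `a` by adding vertices with sufficiently many earlier
neighbours; `p v` is the parity of the number of increasing paths from `a` to `v`. -/
inductive Grow (G : SimpleGraph V) (k : ℕ) (a : V) : Finset V → (V → ZMod 2) → Prop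
  | base {p : V → ZMod 2} (ha : degOn G univ a + 1 ≤ k) (hp : p a = 1) : Grow G k a {a} p
  | step {S : Finset V} {p : V → ZMod 2} {v : V} (h : Grow G k a S p) (hv : v ∉ S)
      (hd : degOn G univ v + 2 ≤ k + degOn G S v) (hp : p v = ∑ u ∈ S with G.Adj v u, p u) :
      Grow G k a (insert v S) p

variable {G : SimpleGraph V} {k : ℕ} {a : V}

lemma Grow.congr {S : Finset V} {p p' : V → ZMod 2} (h : Grow G k a S p)
    (hpp : ∀ v ∈ S, p' v = p v) : Grow G k a S p' := by
  induction h with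
  | base ha hp => exact Grow.base ha (by rw [hpp _ (mem_singleton_self _), hp])
  | step h hv hd hp ih =>
    refine Grow.step (ih fun v hv => hpp v (mem_insert_of_mem hv)) hv hd ?_
    rw [hpp _ (mem_insert_self _ _), hp]
    refine Finset.sum_congr rfl fun u hu => ?_
    rw [hpp u (mem_insert_of_mem (mem_filter.1 hu).1)]

/-- Add one vertex, prescribing its value. -/
lemma Grow.add {S : Finset V} {p : V → ZMod 2} (h : Grow G k a S p) {v : V} (hv : v ∉ S)
    (hd : degOn G univ v + 2 ≤ k + degOn G S v) {c : ZMod 2}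
    (hc : c = ∑ u ∈ S with G.Adj v u, p u) :
    Grow G k a (insert v S) (Function.update p v c) := by
  have h1 : ∀ u ∈ S, Function.update p v c u = p u := fun u hu =>
    Function.update_of_ne (ne_of_mem_of_not_mem hu hv) _ _
  refine Grow.step (h.congr h1) hv hd ?_
  rw [Function.update_self]
  refine hc.trans ?_
  exact Finset.sum_congr rfl fun u hu => (h1 u (mem_filter.1 hu).1).symm

/-- Every edge is directed from the earlier to the later vertex. Then `degOn G S v` at the time of
adding `v` is its in-degree, and the path counts obey modulo 2 the recursion imposed on `p`. Only
the root may still lack an in-arc. -/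
lemma Grow.exists_orientation {S : Finset V} {p : V → ZMod 2} (h : Grow G k a S p) :
    a ∈ S ∧ degOn G univ a + 1 ≤ k ∧ ∃ (D : Finset (V × V)) (f : V → ℕ), OrientsOn G S D ∧
      (∀ p ∈ D, f p.1 < f p.2) ∧
      (∀ v ∈ S, v ≠ a → degOn G univ v + 2 ≤ k + #{p ∈ D | p.2 = v}) ∧
      ∀ v ∈ S, (#(unitFlows D a v) : ZMod 2) = p v := by
  induction h with
  | @base p ha hp =>
    refine ⟨mem_singleton_self _, ha, ∅, fun _ => 0, ⟨by simp, ?_⟩, by simp, by simp, ?_⟩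
    · intro u hu v hv huv
      rw [mem_singleton] at hu hv
      exact absurd (hu.trans hv.symm) huv.ne
    · intro v hv
      rw [mem_singleton] at hv
      rw [hv, card_unitFlows_self (f := fun _ => 0) (by simp), hp, Nat.cast_one]
  | @step S p v h hv hd hp ih =>
    obtain ⟨haS, hak, D, f, hD, hf, hdeg, hfl⟩ := ih
    obtain ⟨f', hf', hcongr, hcard⟩ := exists_extend_acyclic (fun p hp => (hD.1 p hp).2) hf haS hv
      (N := {u ∈ S | G.Adj v u}) (filter_subset _ _)
    have hor := hD.extend hv (N := {u ∈ S | G.Adj v u}) (O := ∅) (disjoint_empty_right _)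
      (union_empty _)
    simp only [image_empty, union_empty] at hor
    refine ⟨mem_insert_of_mem haS, hak, _, f', hor, hf', ?_, ?_⟩
    · intro u hu hua
      rw [mem_insert] at hu
      rcases hu with rfl | hu
      · refine hd.trans (Nat.add_le_add_left ?_ _)
        rw [degOn, ← card_image_of_injective _ (Prod.mk_left_injective u)]
        refine card_le_card fun q hq => ?_
        rw [mem_filter, mem_union]
        refine ⟨Or.inr hq, ?_⟩
        obtain ⟨w, -, rfl⟩ := mem_image.1 hq
        rfl
      · exact (hdeg u hu hua).trans (Nat.add_le_add_left
          (card_le_card (filter_subset_filter _ subset_union_left)) _)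
    · intro u hu
      rw [mem_insert] at hu
      rcases hu with rfl | hu
      · rw [hcard, hp]
        push_cast
        exact Finset.sum_congr rfl fun w hw => hfl w (mem_filter.1 hw).1
      · rw [hcongr u hu, hfl u hu]

lemma Grow.mem {S : Finset V} {p : V → ZMod 2} (h : Grow G k a S p) : a ∈ S :=
  h.exists_orientation.1

lemma Grow.apply_self {S : Finset V} {p : V → ZMod 2} (h : Grow G k a S p) : p a = 1 := by
  obtain ⟨ha, -, D, f, -, hf, -, hfl⟩ := h.exists_orientation
  rw [← hfl a ha, card_unitFlows_self hf, Nat.cast_one]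

/-- Close up a grown set by a neighbour `x` of `a` of odd value. -/
lemma Grow.good {S : Finset V} {p : V → ZMod 2} (h : Grow G k a S p) {x : V} (hx : x ∉ S)
    (hxa : G.Adj x a) (hd : degOn G univ x + 2 ≤ k + degOn G (S.erase a) x)
    (hp : ∑ u ∈ S with G.Adj x u, p u = 1) : Good G k (insert x S) := by
  have hpa := h.apply_self
  obtain ⟨ha, hak, D, f, hD, hf, hdeg, hfl⟩ := h.exists_orientation
  set N : Finset V := {u ∈ S.erase a | G.Adj x u} with hN
  have hNS : N ⊆ S := (filter_subset _ _).trans (erase_subset _ _)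
  obtain ⟨f', hf', hcongr, hcard⟩ := exists_extend_acyclic (fun p hp => (hD.1 p hp).2) hf ha hx hNS
  have hdisj : Disjoint N {a} := by
    rw [disjoint_singleton_right]
    simp [hN]
  have hunion : N ∪ {a} = {u ∈ S | G.Adj x u} := by
    ext u
    simp only [hN, mem_union, mem_filter, mem_erase, mem_singleton]
    constructor
    · rintro (h | rfl)
      · exact ⟨h.1.2, h.2⟩
      · exact ⟨ha, hxa⟩
    · rintro ⟨h1, h2⟩
      by_cases h : u = a
      · exact Or.inr h
      · exact Or.inl ⟨⟨h, h1⟩, h2⟩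
  have hor := hD.extend hx hdisj hunion
  have hxne : x ≠ a := fun h => hx (h ▸ ha)
  -- The root contributes 1, so the other neighbours of `x` sum to 0: an even number of paths from
  -- `a` reach `x`, as `sigma_closing_arc` requires.
  have hsum : ∑ u ∈ N, p u = 0 := by
    rw [← hunion, Finset.sum_union hdisj, Finset.sum_singleton, hpa] at hp
    simpa using hp
  refine ⟨_, hor, ?_, ?_⟩
  · have e : D ∪ N.image (fun u => (u, x)) ∪ image (fun u => (x, u)) {a} =
        insert (x, a) (D ∪ N.image (fun u => (u, x))) := by
      rw [image_singleton, union_comm, ← insert_eq]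
    rw [e]
    refine sigma_closing_arc hf' ?_ ?_
    · intro hc
      rw [mem_union, mem_image] at hc
      rcases hc with hc | ⟨u, -, hu⟩
      · exact hx (hD.1 _ hc).2.1
      · exact hxne (Prod.mk.inj hu).2
    · rw [← ZMod.natCast_eq_zero_iff_even, hcard]
      push_cast
      rw [← hsum]
      exact Finset.sum_congr rfl fun u hu => hfl u (hNS hu)
  · intro v hv
    rw [mem_insert] at hv
    rcases hv with rfl | hv
    · refine hd.trans (Nat.add_le_add_left ?_ _)
      rw [degOn, ← card_image_of_injective _ (Prod.mk_left_injective v)]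
      refine card_le_card fun q hq => ?_
      rw [mem_filter, mem_union, mem_union]
      refine ⟨Or.inl (Or.inr hq), ?_⟩
      obtain ⟨w, -, rfl⟩ := mem_image.1 hq
      rfl
    · by_cases hva : v = a
      · subst hva
        -- The closing arc is the in-arc that the root was still missing.
        have : 0 < #{q ∈ D ∪ N.image (fun u => (u, x)) ∪ image (fun u => (x, u)) {v} | q.2 = v} := by
          refine card_pos.2 ⟨(x, v), ?_⟩
          simp
        omega
      · refine (hdeg v hv hva).trans (Nat.add_le_add_left (card_le_card ?_) _)
        exact filter_subset_filter _ (subset_union_left.trans subset_union_left)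

end Grow

/-! ### Reachability and shortest induced paths -/

section Geodesics

variable {V : Type*}

/-- Reachability inside a vertex set. -/
def ReachIn (G : SimpleGraph V) (R : Set V) (x y : V) : Prop :=
  Relation.ReflTransGen (fun u v => G.Adj u v ∧ u ∈ R ∧ v ∈ R) x y

variable {G : SimpleGraph V} {R : Set V}

lemma ReachIn.refl (x : V) : ReachIn G R x x := Relation.ReflTransGen.refl

lemma ReachIn.trans {x y z : V} (h : ReachIn G R x y) (h' : ReachIn G R y z) : ReachIn G R x z :=
  Relation.ReflTransGen.trans h h'

lemma ReachIn.symm {x y : V} (h : ReachIn G R x y) : ReachIn G R y x := by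
  induction h with
  | refl => exact ReachIn.refl x
  | tail _ h ih => exact Relation.ReflTransGen.head ⟨h.1.symm, h.2.2, h.2.1⟩ ih

lemma ReachIn.of_adj {x y : V} (h : G.Adj x y) (hx : x ∈ R) (hy : y ∈ R) : ReachIn G R x y :=
  Relation.ReflTransGen.single ⟨h, hx, hy⟩

lemma ReachIn.mono {R' : Set V} (hR : R ⊆ R') {x y : V} (h : ReachIn G R x y) :
    ReachIn G R' x y :=
  Relation.ReflTransGen.mono (fun _ _ h => ⟨h.1, hR h.2.1, hR h.2.2⟩) _ _ h

lemma ReachIn.mem {x y : V} (h : ReachIn G R x y) (hx : x ∈ R) : y ∈ R := by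
  induction h with
  | refl => exact hx
  | tail _ h _ => exact h.2.2

/-- A set closed under taking neighbours in `R` contains everything reachable from it. -/
lemma ReachIn.mem_of_closed {X : Set V} (hX : ∀ u ∈ X, ∀ v ∈ R, G.Adj u v → v ∈ X) {x y : V}
    (h : ReachIn G R x y) (hx : x ∈ X) : y ∈ X := by
  induction h with
  | refl => exact hx
  | tail _ h ih => exact hX _ ih _ h.2.2 h.1

/-- A path leaving the complement of `Q` has a first vertex adjacent to `Q`. -/
lemma ReachIn.exists_first {Q : Set V} {x z : V} (h : ReachIn G R x z) (hx : x ∈ R) (hxQ : x ∉ Q)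
    (hz : z ∈ Q) : ∃ y, ReachIn G (R \ Q) x y ∧ y ∈ R ∧ y ∉ Q ∧ ∃ q ∈ Q, q ∈ R ∧ G.Adj y q := by
  by_contra hn
  push Not at hn
  have : z ∈ {y | ReachIn G (R \ Q) x y ∧ y ∈ R ∧ y ∉ Q} := by
    refine h.mem_of_closed ?_ ⟨ReachIn.refl x, hx, hxQ⟩
    rintro u ⟨hu1, hu2, hu3⟩ v hv huv
    have hvQ : v ∉ Q := fun hvQ => hn u hu1 hu2 hu3 v hvQ hv huv
    exact ⟨hu1.trans (ReachIn.of_adj huv ⟨hu2, hu3⟩ ⟨hv, hvQ⟩), hv, hvQ⟩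
  exact this.2.2 hz

/-- A shortest path between two sets, as an induced path. -/
lemma ReachIn.exists_geodesic {A B : V → Prop} {x y : V} (h : ReachIn G R x y) (hx : x ∈ R)
    (hA : A x) (hB : B y) :
    ∃ (n : ℕ) (q : ℕ → V), (∀ i ≤ n, q i ∈ R) ∧ A (q 0) ∧ B (q n) ∧
      (∀ i ≤ n, A (q i) → i = 0) ∧ (∀ i ≤ n, B (q i) → i = n) ∧
      (∀ i ≤ n, ∀ j ≤ n, q i = q j → i = j) ∧
      (∀ i < n, G.Adj (q i) (q (i + 1))) ∧
      (∀ i ≤ n, ∀ j ≤ n, i < j → G.Adj (q i) (q j) → j = i + 1) := by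
  -- Minimize the length over all walks in `R` from `A` to `B`: a chord, a repetition, a later
  -- vertex in `A` or an earlier one in `B` would each give a shorter walk.
  let P : ℕ → Prop := fun n => ∃ q : ℕ → V, (∀ i ≤ n, q i ∈ R) ∧ A (q 0) ∧ B (q n) ∧
    ∀ i < n, G.Adj (q i) (q (i + 1))
  have hex : ∃ n, P n := by
    have : ∀ z, ReachIn G R x z → ∃ (n : ℕ) (q : ℕ → V), (∀ i ≤ n, q i ∈ R) ∧ q 0 = x ∧ q n = z ∧
        ∀ i < n, G.Adj (q i) (q (i + 1)) := by
      intro z hz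
      induction hz with
      | refl => exact ⟨0, fun _ => x, by simpa using hx, rfl, rfl, by simp⟩
      | @tail u w _ hw ih =>
        obtain ⟨n, q, h1, h2, h3, h4⟩ := ih
        refine ⟨n + 1, fun i => if i ≤ n then q i else w, ?_, ?_, ?_, ?_⟩
        · intro i _
          simp only
          split_ifs with hi
          · exact h1 i hi
          · exact hw.2.2
        · simpa using h2
        · simp
        · intro i hi
          rcases Nat.lt_or_ge i n with hi' | hi'
          · simp only [show i ≤ n by omega, show i + 1 ≤ n by omega, if_true]
            exact h4 i hi'
          · have : i = n := by omega
            subst this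
            simp only [le_refl, if_true, show ¬ (i + 1 ≤ i) by omega, if_false, h3]
            exact hw.1
    obtain ⟨n, q, h1, h2, h3, h4⟩ := this y h
    exact ⟨n, q, h1, h2 ▸ hA, h3 ▸ hB, h4⟩
  obtain ⟨q, h1, h2, h3, h4⟩ := Nat.find_spec hex
  have hmin : ∀ m < Nat.find hex, ¬ P m := fun m hm => Nat.find_min hex hm
  set n := Nat.find hex
  have splice : ∀ i j, i < j → j ≤ n → G.Adj (q i) (q j) → j = i + 1 := by
    intro i j hij hj hadj
    by_contra hne
    refine hmin (n - (j - i - 1)) (by omega)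
      ⟨fun t => if t ≤ i then q t else q (t + (j - i - 1)), ?_, by simpa using h2, ?_, ?_⟩
    · intro t ht
      simp only
      split_ifs
      · exact h1 _ (by omega)
      · exact h1 _ (by omega)
    · simp only
      rw [if_neg (by omega), show n - (j - i - 1) + (j - i - 1) = n by omega]
      exact h3
    · intro t ht
      rcases lt_trichotomy t i with hti | hti | hti
      · simp only [show t ≤ i by omega, show t + 1 ≤ i by omega, if_true]
        exact h4 t (by omega)
      · simp only [show t ≤ i by omega, show ¬ (t + 1 ≤ i) by omega, if_true, if_false]
        rw [hti, show i + 1 + (j - i - 1) = j by omega]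
        exact hadj
      · simp only [show ¬ (t ≤ i) by omega, show ¬ (t + 1 ≤ i) by omega, if_false]
        rw [show t + 1 + (j - i - 1) = t + (j - i - 1) + 1 by omega]
        exact h4 _ (by omega)
  have inj : ∀ i j, i < j → j ≤ n → q i ≠ q j := by
    intro i j hij hj he
    refine hmin (n - (j - i)) (by omega)
      ⟨fun t => if t ≤ i then q t else q (t + (j - i)), ?_, by simpa using h2, ?_, ?_⟩
    · intro t ht
      simp only
      split_ifs
      · exact h1 _ (by omega)
      · exact h1 _ (by omega)
    · simp only
      split_ifs with ht
      · have : n - (j - i) = i := by omega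
        rw [this, he]
        have : j = n := by omega
        rw [this]
        exact h3
      · rw [show n - (j - i) + (j - i) = n by omega]
        exact h3
    · intro t ht
      rcases lt_trichotomy t i with hti | hti | hti
      · simp only [show t ≤ i by omega, show t + 1 ≤ i by omega, if_true]
        exact h4 t (by omega)
      · simp only [show t ≤ i by omega, show ¬ (t + 1 ≤ i) by omega, if_true, if_false]
        rw [hti, he, show i + 1 + (j - i) = j + 1 by omega]
        exact h4 j (by omega)
      · simp only [show ¬ (t ≤ i) by omega, show ¬ (t + 1 ≤ i) by omega, if_false]
        rw [show t + 1 + (j - i) = t + (j - i) + 1 by omega]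
        exact h4 _ (by omega)
  refine ⟨n, q, h1, h2, h3, ?_, ?_, ?_, h4, fun i _ j hj hij h => splice i j hij hj h⟩
  · intro i hi hAi
    by_contra h0
    refine hmin (n - i) (by omega) ⟨fun t => q (t + i), ?_, by simpa using hAi, ?_, ?_⟩
    · intro t ht
      exact h1 _ (by omega)
    · simp only
      rw [show n - i + i = n by omega]
      exact h3
    · intro t ht
      simp only
      rw [show t + 1 + i = t + i + 1 by omega]
      exact h4 _ (by omega)
  · intro i hi hBi
    by_contra h0
    exact hmin i (by omega) ⟨q, fun t ht => h1 t (by omega), h2, hBi,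
      fun t ht => h4 t (by omega)⟩
  · intro i hi j hj he
    rcases lt_trichotomy i j with h | h | h
    · exact absurd he (inj i j h hj)
    · exact h
    · exact absurd he.symm (inj j i h hi)

end Geodesics

/-! ### Forbidden configurations of low vertices -/

section Ears

variable {V : Type*} [Fintype V] {G : SimpleGraph V} {k : ℕ}

/-- Low vertices: those of degree `k - 1`. -/
def IsLow (G : SimpleGraph V) (k : ℕ) (v : V) : Prop := degOn G univ v + 1 = k

omit [Fintype V] in
lemma one_le_degOn {S : Finset V} {v u : V} (hu : u ∈ S) (h : G.Adj v u) : 1 ≤ degOn G S v :=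
  card_pos.2 ⟨u, by simp [hu, h]⟩

lemma IsLow.step_cond {S : Finset V} {v u : V} (hv : IsLow G k v) (hu : u ∈ S) (h : G.Adj v u) :
    degOn G univ v + 2 ≤ k + degOn G S v := by
  have := one_le_degOn hu h
  rw [IsLow] at hv
  omega

/-- Append an induced path to a grown set. -/
lemma Grow.path {a : V} {S : Finset V} {p : V → ZMod 2} (h : Grow G k a S p) (q : ℕ → V) (c : ZMod 2)
    (m : ℕ) (hS : ∀ i < m, q i ∉ S) (hlow : ∀ i < m, IsLow G k (q i))
    (hinj : ∀ i < m, ∀ j < m, q i = q j → i = j)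
    (hadj : ∀ i, i + 1 < m → G.Adj (q i) (q (i + 1)))
    (hind : ∀ i < m, ∀ j < m, i < j → G.Adj (q i) (q j) → j = i + 1)
    (h0 : 0 < m → ∃ u ∈ S, G.Adj (q 0) u) (hc : 0 < m → ∑ u ∈ S with G.Adj (q 0) u, p u = c)
    (hno : ∀ i < m, 0 < i → ∀ u ∈ S, ¬ G.Adj (q i) u) :
    ∃ p', Grow G k a (S ∪ (range m).image q) p' ∧ (∀ v ∈ S, p' v = p v) ∧
      ∀ i < m, p' (q i) = c := by
  induction m with
  | zero => exact ⟨p, by simpa using h, fun _ _ => rfl, by simp⟩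
  | succ m ih =>
    obtain ⟨p', h1, h2, h3⟩ := ih (fun i hi => hS i (by omega)) (fun i hi => hlow i (by omega))
      (fun i hi j hj => hinj i (by omega) j (by omega)) (fun i hi => hadj i (by omega))
      (fun i hi j hj => hind i (by omega) j (by omega)) (fun _ => h0 (by omega))
      (fun _ => hc (by omega)) (fun i hi => hno i (by omega))
    have hnm : q m ∉ S ∪ (range m).image q := by
      rw [mem_union, mem_image]
      rintro (hh | ⟨i, hi, he⟩)
      · exact hS m (by omega) hh
      · rw [mem_range] at hi
        have := hinj i (by omega) m (by omega) he
        omega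
    -- The first vertex of the path sees the sum `c`; each later one has only its predecessor as an
    -- earlier neighbour and inherits `c`.
    have hsum : (∃ u ∈ S ∪ (range m).image q, G.Adj (q m) u) ∧
        c = ∑ u ∈ S ∪ (range m).image q with G.Adj (q m) u, p' u := by
      rcases Nat.eq_zero_or_pos m with rfl | hm
      · obtain ⟨u, hu, hu'⟩ := h0 (by omega)
        refine ⟨⟨u, by simpa using hu, hu'⟩, ?_⟩
        simp only [range_zero, image_empty, union_empty]
        rw [← hc (by omega)]
        exact Finset.sum_congr rfl fun u hu => (h2 u (mem_filter.1 hu).1).symm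
      · have ha : G.Adj (q m) (q (m - 1)) := by
          have := hadj (m - 1) (by omega)
          rw [show m - 1 + 1 = m by omega] at this
          exact this.symm
        have hmem : q (m - 1) ∈ (range m).image q :=
          mem_image_of_mem _ (mem_range.2 (by omega))
        refine ⟨⟨_, mem_union_right _ hmem, ha⟩, ?_⟩
        have : {u ∈ S ∪ (range m).image q | G.Adj (q m) u} = {q (m - 1)} := by
          ext u
          simp only [mem_filter, mem_union, mem_singleton]
          constructor
          · rintro ⟨hu | hu, hu'⟩
            · exact absurd hu' (hno m (by omega) hm u hu)
            · obtain ⟨i, hi, rfl⟩ := mem_image.1 hu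
              rw [mem_range] at hi
              have := hind i (by omega) m (by omega) hi hu'.symm
              rw [this]
              simp
          · rintro rfl
            exact ⟨Or.inr hmem, ha⟩
        rw [this, Finset.sum_singleton, h3 _ (by omega)]
    obtain ⟨⟨u, hu, hu'⟩, hs⟩ := hsum
    refine ⟨Function.update p' (q m) c, ?_, ?_, ?_⟩
    · have h4 := h1.add hnm ((hlow m (by omega)).step_cond hu hu') hs
      rw [range_add_one, image_insert, union_insert]
      exact h4
    · intro v hv
      rw [Function.update_of_ne (ne_of_mem_of_not_mem (mem_union_left _ hv) hnm), h2 v hv]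
    · intro i hi
      rcases Nat.lt_succ_iff_lt_or_eq.1 hi with hi' | rfl
      · rw [Function.update_of_ne, h3 i hi']
        intro he
        have := hinj i (by omega) m (by omega) he
        omega
      · rw [Function.update_self]

/-- A grown set with an ear from `a` that sees an even value is good. -/
lemma Grow.good_of_ear {a : V} {S : Finset V} {p : V → ZMod 2} (h : Grow G k a S p) {q : ℕ → V}
    {n : ℕ} (hS : ∀ i ≤ n, q i ∉ S) (hlow : ∀ i ≤ n, IsLow G k (q i))
    (hinj : ∀ i ≤ n, ∀ j ≤ n, q i = q j → i = j)
    (hadj : ∀ i < n, G.Adj (q i) (q (i + 1)))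
    (hind : ∀ i ≤ n, ∀ j ≤ n, i < j → G.Adj (q i) (q j) → j = i + 1)
    (h0 : ∃ u ∈ S.erase a, G.Adj (q 0) u)
    (hno : ∀ i ≤ n, (∃ u ∈ S.erase a, G.Adj (q i) u) → i = 0)
    (hn : G.Adj (q n) a) (hna : ∀ i ≤ n, G.Adj (q i) a → i = n)
    (hsum : ∑ u ∈ S.erase a with G.Adj (q 0) u, p u = 0) :
    ∃ S : Finset V, S.Nonempty ∧ Good G k S := by
  have haS := h.mem
  have hpa := h.apply_self
  -- A one-vertex ear closes at once: it sees the sum 0 and the 1 of the root. A longer ear carries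
  -- the value 0 along to its last vertex, which sees it together with the root.
  rcases Nat.eq_zero_or_pos n with rfl | hpos
  · obtain ⟨u, hu, hu'⟩ := h0
    refine ⟨_, insert_nonempty _ _, h.good (hS 0 le_rfl) hn ((hlow 0 le_rfl).step_cond hu hu') ?_⟩
    rw [← insert_erase haS, filter_insert, if_pos hn, Finset.sum_insert (by simp), hsum, hpa,
      add_zero]
  · have hq0a : ¬ G.Adj (q 0) a := fun hc => by
      have := hna 0 (by omega) hc
      omega
    have hnoS : ∀ i ≤ n, 0 < i → i < n → ∀ u ∈ S, ¬ G.Adj (q i) u := by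
      intro i hi hi0 hin u hu hc
      by_cases hua : u = a
      · subst hua
        have := hna i hi hc
        omega
      · have := hno i hi ⟨u, mem_erase.2 ⟨hua, hu⟩, hc⟩
        omega
    obtain ⟨p', h1, h2, h3⟩ := h.path q 0 n (fun i hi => hS i hi.le) (fun i hi => hlow i hi.le)
      (fun i hi j hj => hinj i hi.le j hj.le) (fun i hi => hadj i (by omega))
      (fun i hi j hj => hind i hi.le j hj.le)
      (fun _ => by
        obtain ⟨u, hu, hu'⟩ := h0
        exact ⟨u, mem_of_mem_erase hu, hu'⟩)
      (fun _ => by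
        rw [← insert_erase haS, filter_insert, if_neg hq0a, hsum])
      (fun i hi hi0 => hnoS i hi.le hi0 hi)
    have hprev : G.Adj (q n) (q (n - 1)) := by
      have := hadj (n - 1) (by omega)
      rw [show n - 1 + 1 = n by omega] at this
      exact this.symm
    have hmem : q (n - 1) ∈ S ∪ (range n).image q :=
      mem_union_right _ (mem_image_of_mem _ (mem_range.2 (by omega)))
    have hne : q (n - 1) ≠ a := (ne_of_mem_of_not_mem haS (hS (n - 1) (by omega))).symm
    refine ⟨_, insert_nonempty _ _, h1.good (x := q n) ?_ hn
      ((hlow n le_rfl).step_cond (mem_erase.2 ⟨hne, hmem⟩) hprev) ?_⟩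
    · rw [mem_union, mem_image]
      rintro (hh | ⟨i, hi, he⟩)
      · exact hS n le_rfl hh
      · rw [mem_range] at hi
        have := hinj i (by omega) n (by omega) he
        omega
    · have : {u ∈ S ∪ (range n).image q | G.Adj (q n) u} = {a, q (n - 1)} := by
        ext u
        simp only [mem_filter, mem_union, mem_singleton, mem_insert]
        constructor
        · rintro ⟨hu | hu, hu'⟩
          · left
            by_contra hua
            have := hno n le_rfl ⟨u, mem_erase.2 ⟨hua, hu⟩, hu'⟩
            omega
          · obtain ⟨i, hi, rfl⟩ := mem_image.1 hu
            rw [mem_range] at hi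
            have := hind i (by omega) n (by omega) hi hu'.symm
            right
            rw [this]
            simp
        · rintro (rfl | rfl)
          · exact ⟨Or.inl haS, hn⟩
          · exact ⟨mem_union.1 hmem, hprev⟩
      rw [this, Finset.sum_pair hne.symm, h2 a haS, hpa, h3 _ (by omega), add_zero]

/-- The values are 1, 1 and 1 + 1 = 0. Having both parities available in a triangle lets the ear
arguments choose the sum that an outside vertex sees. -/
lemma exists_grow_triangle {a w b : V} (ha : IsLow G k a) (hw : IsLow G k w) (hb : IsLow G k b)
    (haw : G.Adj a w) (hab : G.Adj a b) (hwb : G.Adj w b) :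
    ∃ p, Grow G k a {b, w, a} p ∧ p w = 1 ∧ p b = 0 := by
  have h0 : Grow G k a {a} (fun _ => 1) := Grow.base ha.le rfl
  have h1 := h0.add (v := w) (by simpa using haw.ne') (hw.step_cond (mem_singleton_self a) haw.symm)
    (c := 1) (by simp [filter_singleton, haw.symm])
  have hs : {u ∈ ({w, a} : Finset V) | G.Adj b u} = {w, a} := by
    ext u
    simp only [mem_filter, mem_insert, mem_singleton]
    constructor
    · exact fun h => h.1
    · rintro (rfl | rfl)
      · exact ⟨Or.inl rfl, hwb.symm⟩
      · exact ⟨Or.inr rfl, hab.symm⟩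
  have h2 := h1.add (v := b) (c := 0) (by simp [hwb.ne', hab.ne'])
    (hb.step_cond (mem_insert_self _ _) hwb.symm) (by
      rw [hs, Finset.sum_pair haw.ne', Function.update_self, Function.update_of_ne haw.ne]
      decide)
  refine ⟨_, h2, ?_, ?_⟩
  · rw [Function.update_of_ne hwb.ne, Function.update_self]
  · rw [Function.update_self]

variable (hng : ∀ S : Finset V, S.Nonempty → ¬ Good G k S)
include hng

/-- A maximal clique of low vertices has no ears. -/
lemma not_reachIn_of_clique {Q S : Finset V} (hQS : Q ⊆ S) (hS : ∀ v ∈ S, IsLow G k v)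
    (hQ : G.IsClique (Q : Set V)) (h3 : 3 ≤ #Q) (hmax : ∀ v ∈ S, v ∉ Q → ∃ u ∈ Q, ¬ G.Adj v u)
    {a b x y : V} (ha : a ∈ Q) (hb : b ∈ Q) (hab : a ≠ b) (hy : y ∈ S) (hyQ : y ∉ Q)
    (hxa : G.Adj x a) (hyb : G.Adj y b) : ¬ ReachIn G (S \ Q : Set V) y x := by
  intro hr
  have hfin : ¬ ∃ S : Finset V, S.Nonempty ∧ Good G k S := fun ⟨S, h1, h2⟩ => hng S h1 h2
  obtain ⟨n, q, hR, hA, hB, hA', hB', hinj, hadj, hind⟩ := hr.exists_geodesic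
    (A := fun v => ∃ u ∈ Q.erase a, G.Adj v u) (B := fun v => G.Adj v a)
    ⟨hy, hyQ⟩ ⟨b, mem_erase.2 ⟨hab.symm, hb⟩, hyb⟩ hxa
  -- If `q 0` misses some `w`, the triangle grown in the order `a`, `w`, `c` gives `c` the value 0,
  -- and apart from possibly `a` this is all that `q 0` sees.
  by_cases hw : ∃ w ∈ Q.erase a, ¬ G.Adj (q 0) w
  · obtain ⟨w, hw, hqw⟩ := hw
    obtain ⟨c, hc, hqc⟩ := hA
    have hcQ := mem_of_mem_erase hc
    have hwQ := mem_of_mem_erase hw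
    have hwc : w ≠ c := fun h => hqw (h ▸ hqc)
    have hwa : w ≠ a := ne_of_mem_erase hw
    have hca : c ≠ a := ne_of_mem_erase hc
    obtain ⟨p, hp, -, hpc⟩ := exists_grow_triangle (hS a (hQS ha)) (hS w (hQS hwQ)) (hS c (hQS hcQ))
      (hQ ha hwQ hwa.symm) (hQ ha hcQ hca.symm) (hQ hwQ hcQ hwc)
    have hsub : ({c, w, a} : Finset V) ⊆ Q := by
      intro u hu
      simp only [mem_insert, mem_singleton] at hu
      rcases hu with rfl | rfl | rfl <;> assumption
    refine hfin (hp.good_of_ear (q := q) (n := n) (fun i hi hc => (hR i hi).2 (hsub hc))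
      (fun i hi => hS _ (hR i hi).1) hinj hadj hind ⟨c, by simp [hca], hqc⟩ ?_ hB
      (fun i hi h => hB' i hi h) ?_)
    · rintro i hi ⟨u, hu, hqu⟩
      exact hA' i hi ⟨u, erase_subset_erase _ hsub hu, hqu⟩
    · have : {u ∈ ({c, w, a} : Finset V).erase a | G.Adj (q 0) u} = {c} := by
        ext u
        simp only [mem_filter, mem_erase, mem_insert, mem_singleton]
        constructor
        · rintro ⟨⟨h1, h2 | rfl | h2⟩, h3⟩
          · exact h2
          · exact absurd h3 hqw
          · exact absurd h2 h1
        · rintro rfl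
          exact ⟨⟨hca, Or.inl rfl⟩, hqc⟩
      rw [this, Finset.sum_singleton, hpc]
  -- Otherwise `q 0` sees all of `Q` except `a`, by maximality. For the triangle grown in the order
  -- `s`, `a`, `c` it sees the values 1 and 0, so `q 0` alone closes up at `s`.
  · push Not at hw
    have hq0 := hR 0 (Nat.zero_le _)
    have hqa : ¬ G.Adj (q 0) a := by
      intro h
      obtain ⟨u, hu, hu'⟩ := hmax (q 0) hq0.1 hq0.2
      by_cases hua : u = a
      · exact hu' (hua ▸ h)
      · exact hu' (hw u (mem_erase.2 ⟨hua, hu⟩))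
    have hcard : 1 < #(Q.erase a) := by
      rw [card_erase_of_mem ha]
      omega
    obtain ⟨s, hs, c, hc, hsc⟩ := one_lt_card.1 hcard
    have hsQ := mem_of_mem_erase hs
    have hcQ := mem_of_mem_erase hc
    have hsa : s ≠ a := ne_of_mem_erase hs
    have hca : c ≠ a := ne_of_mem_erase hc
    obtain ⟨p, hp, -, hpc⟩ := exists_grow_triangle (hS s (hQS hsQ)) (hS a (hQS ha)) (hS c (hQS hcQ))
      (hQ hsQ ha hsa) (hQ hsQ hcQ hsc) (hQ ha hcQ hca.symm)
    have hps := hp.apply_self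
    have hsub : ({c, a, s} : Finset V) ⊆ Q := by
      intro u hu
      simp only [mem_insert, mem_singleton] at hu
      rcases hu with rfl | rfl | rfl <;> assumption
    refine hfin ⟨_, insert_nonempty _ _, hp.good (x := q 0) (fun h => hq0.2 (hsub h)) (hw s hs)
      ((hS _ hq0.1).step_cond (u := c) (by simp [hsc.symm]) (hw c hc)) ?_⟩
    have : {u ∈ ({c, a, s} : Finset V) | G.Adj (q 0) u} = {c, s} := by
      ext u
      simp only [mem_filter, mem_insert, mem_singleton]
      constructor
      · rintro ⟨h1 | rfl | h1, h2⟩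
        · exact Or.inl h1
        · exact absurd h2 hqa
        · exact Or.inr h1
      · rintro (rfl | rfl)
        · exact ⟨Or.inl rfl, hw _ hc⟩
        · exact ⟨Or.inr (Or.inr rfl), hw _ hs⟩
    rw [this, Finset.sum_pair hsc.symm, hpc, hps, zero_add]

/-- A vertex of degree `k` outside a clique of low vertices, missing one of its vertices, has at
most two neighbours in it. -/
lemma degOn_clique_le_two {K : Finset V} (hK : ∀ v ∈ K, IsLow G k v) (hQ : G.IsClique (K : Set V))
    {y w : V} (hy : degOn G univ y = k) (hyK : y ∉ K) (hw : w ∈ K) (hyw : ¬ G.Adj y w) :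
    degOn G K y ≤ 2 := by
  by_contra hn
  push Not at hn
  obtain ⟨a, b, c, ha, hb, hc, hab, hac, hbc⟩ := Finset.two_lt_card_iff.1 hn
  rw [mem_filter] at ha hb hc
  have hwa : w ≠ a := fun h => hyw (h ▸ ha.2)
  have hwb : w ≠ b := fun h => hyw (h ▸ hb.2)
  have hwc : w ≠ c := fun h => hyw (h ▸ hc.2)
  -- The order `a`, `w`, `b`, `c` gives the values 1, 1, 0, 0. Missing `w`, the vertex `y` sees the
  -- sum 1, and `b`, `c` are the two in-neighbours that degree `k` calls for.
  obtain ⟨p, hp, hpw, hpb⟩ := exists_grow_triangle (hK a ha.1) (hK w hw) (hK b hb.1)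
    (hQ ha.1 hw hwa.symm) (hQ ha.1 hb.1 hab) (hQ hw hb.1 hwb)
  have hpa := hp.apply_self
  have hs : {u ∈ ({b, w, a} : Finset V) | G.Adj c u} = {b, w, a} := by
    ext u
    simp only [mem_filter, mem_insert, mem_singleton]
    constructor
    · exact fun h => h.1
    · rintro (rfl | rfl | rfl)
      · exact ⟨Or.inl rfl, hQ hc.1 hb.1 hbc.symm⟩
      · exact ⟨Or.inr (Or.inl rfl), hQ hc.1 hw hwc.symm⟩
      · exact ⟨Or.inr (Or.inr rfl), hQ hc.1 ha.1 hac.symm⟩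
  have h2 := hp.add (v := c) (c := 0) (by simp [hbc.symm, hwc.symm, hac.symm])
    ((hK c hc.1).step_cond (mem_insert_self _ _) (hQ hc.1 hb.1 hbc.symm)) (by
      rw [hs, Finset.sum_insert (by simp [hwb.symm, hab.symm]), Finset.sum_pair hwa, hpb, hpw, hpa]
      decide)
  have hsub : insert c ({b, w, a} : Finset V) ⊆ K := by
    intro u hu
    simp only [mem_insert, mem_singleton] at hu
    rcases hu with rfl | rfl | rfl | rfl
    exacts [hc.1, hb.1, hw, ha.1]
  refine hng _ (insert_nonempty _ _) (h2.good (x := y) (fun h => hyK (hsub h)) ha.2 ?_ ?_)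
  · rw [hy]
    refine Nat.add_le_add_left ?_ _
    rw [← card_pair hbc]
    refine card_le_card ?_
    intro u hu
    simp only [mem_insert, mem_singleton] at hu
    rcases hu with rfl | rfl
    · simp [hab.symm, hb.2]
    · simp [hac.symm, hc.2]
  · have : {u ∈ insert c ({b, w, a} : Finset V) | G.Adj y u} = {c, b, a} := by
      ext u
      simp only [mem_filter, mem_insert, mem_singleton]
      constructor
      · rintro ⟨h1 | h1 | rfl | h1, h3⟩
        · exact Or.inl h1
        · exact Or.inr (Or.inl h1)
        · exact absurd h3 hyw
        · exact Or.inr (Or.inr h1)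
      · rintro (rfl | rfl | rfl)
        · exact ⟨Or.inl rfl, hc.2⟩
        · exact ⟨Or.inr (Or.inl rfl), hb.2⟩
        · exact ⟨Or.inr (Or.inr (Or.inr rfl)), ha.2⟩
    rw [this, Finset.sum_insert (by simp [hbc.symm, hac.symm]), Finset.sum_pair hab.symm,
      Function.update_self, Function.update_of_ne hbc, Function.update_of_ne hac, hpb, hpa]
    decide

/-- In a triangle-free set of low vertices, the neighbourhood of a vertex of degree at least three
is not connected in the complement of the vertex. -/
lemma not_all_reachIn_of_triangle_free {B : Finset V} (hB : ∀ v ∈ B, IsLow G k v)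
    (htri : ∀ x ∈ B, ∀ y ∈ B, ∀ z ∈ B, G.Adj x y → G.Adj y z → ¬ G.Adj x z)
    {v : V} (hv : v ∈ B) (h3 : 3 ≤ degOn G B v) :
    ∃ x ∈ B, ∃ y ∈ B, G.Adj v x ∧ G.Adj v y ∧ ¬ ReachIn G (B \ {v} : Set V) x y := by
  by_contra hn
  push Not at hn
  have hfin : ¬ ∃ S : Finset V, S.Nonempty ∧ Good G k S := fun ⟨S, h1, h2⟩ => hng S h1 h2
  obtain ⟨n1, n2, -, hn1, hn2, -, h12, -, -⟩ := Finset.two_lt_card_iff.1 h3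
  rw [mem_filter] at hn1 hn2
  -- Together with `v`, a shortest path in `B - v` from `n1` to another neighbour of `v` forms an
  -- induced cycle. Below, a third neighbour of `v` yields an induced path `r` off the cycle that
  -- starts next to `q` and ends next to `v`.
  obtain ⟨n, q, hR, hA, hC, hA', hC', hinj, hadj, hind⟩ :=
    (hn n1 hn1.1 n2 hn2.1 hn1.2 hn2.2).exists_geodesic (A := fun x => x = n1)
      (B := fun x => G.Adj v x ∧ x ≠ n1) ⟨by exact_mod_cast hn1.1, by simpa using hn1.2.ne'⟩ rfl
      ⟨hn2.2, h12.symm⟩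
  have hqB : ∀ i ≤ n, q i ∈ B := fun i hi => (hR i hi).1
  have hqv : ∀ i ≤ n, q i ≠ v := fun i hi => (hR i hi).2
  have hn0 : 0 < n := by
    rcases Nat.eq_zero_or_pos n with rfl | h
    · exact absurd hA hC.2
    · exact h
  have hvq : ∀ i ≤ n, G.Adj v (q i) ↔ i = 0 ∨ i = n := by
    intro i hi
    constructor
    · intro h
      by_cases h1 : q i = n1
      · exact Or.inl (hA' i hi h1)
      · exact Or.inr (hC' i hi ⟨h, h1⟩)
    · rintro (rfl | rfl)
      · rw [hA]
        exact hn1.2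
      · exact hC.1
  have hn2' : 2 ≤ n := by
    by_contra h
    have h1 : n = 1 := by omega
    subst h1
    exact htri v hv _ (hqB 0 (by omega)) _ (hqB 1 le_rfl) ((hvq 0 (by omega)).2 (Or.inl rfl))
      (hadj 0 (by omega)) ((hvq 1 le_rfl).2 (Or.inr rfl))
  -- a third neighbour of `v`
  obtain ⟨u, hu, hu0, hun⟩ : ∃ u, (u ∈ B ∧ G.Adj v u) ∧ u ≠ q 0 ∧ u ≠ q n := by
    by_contra hc
    push Not at hc
    have : {u ∈ B | G.Adj v u} ⊆ {q 0, q n} := by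
      intro u hu
      rw [mem_filter] at hu
      rw [mem_insert, mem_singleton]
      by_cases h : u = q 0
      · exact Or.inl h
      · exact Or.inr (hc u hu h)
    have := (card_le_card this).trans card_le_two
    rw [degOn] at h3
    omega
  set Q : Set V := {x | ∃ i ≤ n, q i = x} with hQ
  have huQ : u ∉ Q := by
    rintro ⟨i, hi, rfl⟩
    rcases (hvq i hi).1 hu.2 with rfl | rfl
    · exact hu0 rfl
    · exact hun rfl
  obtain ⟨y, hy1, hy2, hy3, z, hzQ, -, hyz⟩ :=
    (hn u hu.1 n1 hn1.1 hu.2 hn1.2).exists_first (Q := Q) ⟨hu.1, hu.2.ne'⟩ huQ ⟨0, by omega, hA⟩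
  obtain ⟨m, r, rR, rA, rC, rA', rC', rinj, radj, rind⟩ :=
    hy1.symm.exists_geodesic (A := fun x => ∃ z ∈ Q, G.Adj x z) (B := fun x => G.Adj x v)
      ⟨hy2, hy3⟩ ⟨z, hzQ, hyz⟩ hu.2.symm
  -- Growing from `v` along both arms of the cycle, stopping short of `q i`, gives every vertex the
  -- value 1.
  have grow : ∀ i ≤ n, ∃ S p, Grow G k v S p ∧ (∀ x ∈ S, p x = 1) ∧
      ∀ x, x ∈ S ↔ x = v ∨ ∃ t ≤ n, t ≠ i ∧ q t = x := by
    intro i hi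
    have h0 : Grow G k v {v} (fun _ => 1) := Grow.base (hB v hv).le rfl
    obtain ⟨p1, g1, a1, b1⟩ := h0.path q 1 i
      (fun t ht => by simpa using hqv t (by omega)) (fun t ht => hB _ (hqB t (by omega)))
      (fun s hs t ht => hinj s (by omega) t (by omega)) (fun t ht => hadj t (by omega))
      (fun s hs t ht => hind s (by omega) t (by omega))
      (fun hi => ⟨v, mem_singleton_self v, ((hvq 0 (by omega)).2 (Or.inl rfl)).symm⟩)
      (fun hi => by
        have := ((hvq 0 (by omega)).2 (Or.inl rfl)).symm
        simp [filter_singleton, this])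
      (fun t ht ht0 u hu hc => by
        rw [mem_singleton] at hu
        rw [hu] at hc
        have := (hvq t (by omega)).1 hc.symm
        omega)
    have p1one : ∀ x ∈ {v} ∪ (range i).image q, p1 x = 1 := by
      intro x hx
      rw [mem_union, mem_image] at hx
      rcases hx with hx | ⟨t, ht, rfl⟩
      · rw [a1 x hx]
      · exact b1 t (mem_range.1 ht)
    have nmem : ∀ t, t < n - i → q (n - t) ∉ {v} ∪ (range i).image q := by
      intro t ht hc
      rw [mem_union, mem_singleton, mem_image] at hc
      rcases hc with hc | ⟨s, hs, hc⟩
      · exact hqv _ (by omega) hc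
      · rw [mem_range] at hs
        have := hinj s (by omega) (n - t) (by omega) hc
        omega
    have qn : i < n → {x ∈ {v} ∪ (range i).image q | G.Adj (q n) x} = {v} := by
      intro hin
      ext x
      simp only [mem_filter, mem_union, mem_singleton, mem_image, mem_range]
      constructor
      · rintro ⟨h | ⟨s, hs, rfl⟩, h'⟩
        · exact h
        · have := hind s (by omega) n le_rfl (by omega) h'.symm
          omega
      · rintro rfl
        exact ⟨Or.inl rfl, ((hvq n le_rfl).2 (Or.inr rfl)).symm⟩
    obtain ⟨p2, g2, a2, b2⟩ := g1.path (fun t => q (n - t)) 1 (n - i) nmem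
      (fun t ht => hB _ (hqB _ (by omega)))
      (fun s hs t ht h => by
        have := hinj _ (by omega) _ (by omega) h
        omega)
      (fun t ht => by
        have := hadj (n - (t + 1)) (by omega)
        rw [show n - (t + 1) + 1 = n - t by omega] at this
        exact this.symm)
      (fun s hs t ht hst h => by
        have := hind _ (by omega) _ (by omega) (by omega) h.symm
        omega)
      (fun h => ⟨v, by simp, ((hvq n le_rfl).2 (Or.inr rfl)).symm⟩)
      (fun h => by
        simp only [Nat.sub_zero]
        rw [qn (by omega), Finset.sum_singleton]
        exact p1one v (by simp))
      (fun t ht ht0 u hu hc => by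
        rw [mem_union, mem_singleton, mem_image] at hu
        rcases hu with rfl | ⟨s, hs, rfl⟩
        · have := (hvq _ (by omega)).1 hc.symm
          omega
        · rw [mem_range] at hs
          have := hind s (by omega) _ (by omega) (by omega) hc.symm
          omega)
    refine ⟨_, p2, g2, ?_, ?_⟩
    · intro x hx
      rw [mem_union] at hx
      rcases hx with hx | hx
      · rw [a2 x hx, p1one x hx]
      · obtain ⟨t, ht, rfl⟩ := mem_image.1 hx
        exact b2 t (mem_range.1 ht)
    · intro x
      simp only [mem_union, mem_singleton, mem_image, mem_range]
      constructor
      · rintro ((h | ⟨t, ht, rfl⟩) | ⟨t, ht, rfl⟩)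
        · exact Or.inl h
        · exact Or.inr ⟨t, by omega, by omega, rfl⟩
        · exact Or.inr ⟨n - t, by omega, by omega, rfl⟩
      · rintro (h | ⟨t, ht, hti, rfl⟩)
        · exact Or.inl (Or.inl h)
        · rcases Nat.lt_or_ge t i with h | h
          · exact Or.inl (Or.inr ⟨t, h, rfl⟩)
          · exact Or.inr ⟨n - t, by omega, by rw [show n - (n - t) = t by omega]⟩
  -- `M` indexes the vertices of the path `q` seen by `r 0`. For `r` to be a usable ear, the values
  -- seen there must sum to 0.
  set M : Finset ℕ := {t ∈ range (n + 1) | G.Adj (r 0) (q t)} with hM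
  have final : ∀ (S : Finset V) (p : V → ZMod 2), Grow G k v S p →
      (∀ x ∈ S, x = v ∨ x ∈ Q) → (∃ x ∈ S.erase v, G.Adj (r 0) x) →
      ∑ x ∈ S.erase v with G.Adj (r 0) x, p x = 0 → False := by
    intro S p hp hSQ h0 hsum
    refine hfin (hp.good_of_ear (q := r) (n := m) ?_ (fun i hi => hB _ (rR i hi).1.1) rinj radj rind
      h0 ?_ rC rC' hsum)
    · intro i hi hc
      rcases hSQ _ hc with h | h
      · exact (rR i hi).1.2 h
      · exact (rR i hi).2 h
    · rintro i hi ⟨x, hx, hx'⟩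
      refine rA' i hi ⟨x, ?_, hx'⟩
      exact (hSQ x (mem_of_mem_erase hx)).resolve_left (ne_of_mem_erase hx)
  obtain ⟨_, ⟨j, hj, rfl⟩, hrj⟩ := rA
  have hjM : j ∈ M := by simp [hM, hj, hrj]
  have sum_erase : ∀ i ≤ n, ∀ (S : Finset V) (p : V → ZMod 2), (∀ x ∈ S, p x = 1) →
      (∀ x, x ∈ S ↔ x = v ∨ ∃ t ≤ n, t ≠ i ∧ q t = x) →
      ∑ x ∈ S.erase v with G.Adj (r 0) x, p x = #(M.erase i) := by
    intro i hi S p hp1 hS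
    rw [Finset.sum_congr rfl (fun x hx => hp1 x (mem_of_mem_erase (mem_filter.1 hx).1)),
      Finset.sum_const, nsmul_eq_mul, mul_one]
    congr 1
    symm
    refine Finset.card_bij (fun t _ => q t) ?_ ?_ ?_
    · intro t ht
      simp only [hM, mem_erase, mem_filter, mem_range] at ht
      rw [mem_filter, mem_erase, hS]
      exact ⟨⟨hqv t (by omega), Or.inr ⟨t, by omega, ht.1, rfl⟩⟩, ht.2.2⟩
    · intro s hs t ht h
      simp only [hM, mem_erase, mem_filter, mem_range] at hs ht
      exact hinj s (by omega) t (by omega) h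
    · intro x hx
      rw [mem_filter, mem_erase, hS] at hx
      obtain ⟨t, ht, hti, rfl⟩ := hx.1.2.resolve_left hx.1.1
      refine ⟨t, ?_, rfl⟩
      simp only [hM, mem_erase, mem_filter, mem_range]
      exact ⟨hti, by omega, hx.2⟩
  rcases Nat.even_or_odd #M with hev | hodd
  · obtain ⟨i, hi, hiM⟩ : ∃ i ≤ n, i ∉ M := by
      by_contra hc
      push Not at hc
      have c0 := (mem_filter.1 (hc 0 (by omega))).2
      have c1 := (mem_filter.1 (hc 1 (by omega))).2
      exact htri _ (rR 0 (by omega)).1.1 _ (hqB 0 (by omega)) _ (hqB 1 (by omega)) c0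
        (hadj 0 (by omega)) c1
    obtain ⟨S, p, hp, hp1, hS⟩ := grow i hi
    refine final S p hp ?_ ⟨q j, ?_, hrj⟩ ?_
    · intro x hx
      rcases (hS x).1 hx with h | ⟨t, ht, -, rfl⟩
      · exact Or.inl h
      · exact Or.inr ⟨t, ht, rfl⟩
    · rw [mem_erase, hS]
      exact ⟨hqv j hj, Or.inr ⟨j, hj, fun h => hiM (h ▸ hjM), rfl⟩⟩
    · rw [sum_erase i hi S p hp1 hS, erase_eq_of_notMem hiM]
      exact ZMod.natCast_eq_zero_iff_even.2 hev
  -- Odd case: leave out a seen vertex `q j` and add it last. It has two earlier neighbours, both of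
  -- value 1, so it gets 0 and the sum seen by `r 0` becomes even.
  · obtain ⟨S, p, hp, hp1, hS⟩ := grow j hj
    have hjS : q j ∉ S := by
      rw [hS]
      rintro (h | ⟨t, ht, htj, h⟩)
      · exact hqv j hj h
      · exact htj (hinj t ht j hj h)
    have hcyc : ∃ x y, x ≠ y ∧ {u ∈ S | G.Adj (q j) u} = {x, y} := by
      have hdesc : ∀ u, u ∈ S ∧ G.Adj (q j) u ↔
          (u = v ∧ (j = 0 ∨ j = n)) ∨ (0 < j ∧ u = q (j - 1)) ∨ (j < n ∧ u = q (j + 1)) := by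
        intro u
        rw [hS]
        constructor
        · rintro ⟨h | ⟨t, ht, htj, rfl⟩, h'⟩
          · subst h
            exact Or.inl ⟨rfl, (hvq j hj).1 h'.symm⟩
          · rcases Nat.lt_or_gt_of_ne htj with h | h
            · have := hind t ht j hj h h'.symm
              exact Or.inr (Or.inl ⟨by omega, by rw [this]; simp⟩)
            · have := hind j hj t ht h h'
              exact Or.inr (Or.inr ⟨by omega, by rw [this]⟩)
        · rintro (⟨rfl, h⟩ | ⟨h, rfl⟩ | ⟨h, rfl⟩)
          · exact ⟨Or.inl rfl, ((hvq j hj).2 h).symm⟩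
          · refine ⟨Or.inr ⟨j - 1, by omega, by omega, rfl⟩, ?_⟩
            have := hadj (j - 1) (by omega)
            rw [show j - 1 + 1 = j by omega] at this
            exact this.symm
          · exact ⟨Or.inr ⟨j + 1, by omega, by omega, rfl⟩, hadj j h⟩
      rcases Nat.eq_zero_or_pos j with h0 | h0
      · refine ⟨v, q (j + 1), (hqv _ (by omega)).symm, ?_⟩
        ext u
        rw [mem_filter, hdesc, mem_insert, mem_singleton]
        have : j < n := by omega
        simp [h0, show 0 < n by omega]
      · rcases Nat.lt_or_ge j n with h1 | h1
        · refine ⟨q (j - 1), q (j + 1), fun h => ?_, ?_⟩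
          · have := hinj _ (by omega) _ (by omega) h
            omega
          · ext u
            rw [mem_filter, hdesc, mem_insert, mem_singleton]
            simp [h0, h1, show j ≠ 0 by omega, show j ≠ n by omega]
        · refine ⟨v, q (j - 1), (hqv _ (by omega)).symm, ?_⟩
          ext u
          rw [mem_filter, hdesc, mem_insert, mem_singleton]
          simp [show j = n by omega, show 0 < n by omega]
    obtain ⟨x, y, hxy, hcyc⟩ := hcyc
    have hmemx : x ∈ S ∧ G.Adj (q j) x := by
      rw [← mem_filter, hcyc]
      simp
    have hmemy : y ∈ S ∧ G.Adj (q j) y := by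
      rw [← mem_filter, hcyc]
      simp
    have hg := hp.add (c := 0) hjS ((hB _ (hqB j hj)).step_cond hmemx.1 hmemx.2) (by
      rw [hcyc, Finset.sum_pair hxy, hp1 x hmemx.1, hp1 y hmemy.1]
      decide)
    refine final _ _ hg ?_ ⟨q j, ?_, hrj⟩ ?_
    · intro x hx
      rw [mem_insert] at hx
      rcases hx with rfl | hx
      · exact Or.inr ⟨j, hj, rfl⟩
      · rcases (hS x).1 hx with h | ⟨t, ht, -, rfl⟩
        · exact Or.inl h
        · exact Or.inr ⟨t, ht, rfl⟩
    · rw [mem_erase]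
      exact ⟨hqv j hj, mem_insert_self _ _⟩
    · have hodd' : ((#(M.erase j) : ℕ) : ZMod 2) = 0 := by
        rw [ZMod.natCast_eq_zero_iff_even, card_erase_of_mem hjM]
        exact Nat.Odd.sub_odd hodd odd_one
      rw [erase_insert_of_ne (hqv j hj).symm.symm, filter_insert, if_pos hrj, Finset.sum_insert,
        Function.update_self, zero_add, ← hodd', ← sum_erase j hj S p hp1 hS]
      · refine Finset.sum_congr rfl fun x hx => ?_
        exact Function.update_of_ne
          (ne_of_mem_of_not_mem (mem_of_mem_erase (mem_filter.1 hx).1) hjS) _ _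
      · intro h
        exact hjS (mem_of_mem_erase (mem_filter.1 h).1)

end Ears

/-! ### End cliques of sets of low vertices -/

section EndClique

variable {V : Type*} [Fintype V] {G : SimpleGraph V} {k : ℕ}

/-- A set of low vertices of minimum degree at least three has a clique attached to the rest at
one vertex only. -/
lemma exists_end_clique (hng : ∀ S : Finset V, S.Nonempty → ¬ Good G k S) {S : Finset V}
    (hne : S.Nonempty) (hS : ∀ v ∈ S, IsLow G k v) (h3 : ∀ v ∈ S, 3 ≤ degOn G S v) :
    ∃ (B : Finset V) (c : V), B ⊆ S ∧ c ∈ B ∧ 1 < #B ∧ G.IsClique (B : Set V) ∧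
      ∀ v ∈ B, v ≠ c → ∀ u ∈ S, G.Adj v u → u ∈ B := by
  -- A nonempty `X` attached to the rest of `S` only through `c`, of size `m`. A minimal one serves
  -- as an end block without its cut vertex.
  let P : ℕ → Prop := fun m => ∃ (c : V) (X : Finset V), c ∈ S ∧ X ⊆ S ∧ X.Nonempty ∧ c ∉ X ∧
    (∀ x ∈ X, ∀ u ∈ S, G.Adj x u → u = c ∨ u ∈ X) ∧ #X = m
  have hex : ∃ m, P m := by
    obtain ⟨c, hc⟩ := hne
    refine ⟨_, c, S.erase c, hc, erase_subset _ _, ?_, notMem_erase _ _, ?_, rfl⟩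
    · obtain ⟨u, hu⟩ := card_pos.1 (show 0 < degOn G S c from lt_of_lt_of_le (by norm_num) (h3 c hc))
      rw [mem_filter] at hu
      exact ⟨u, mem_erase.2 ⟨hu.2.ne', hu.1⟩⟩
    · intro x _ u hu _
      rw [mem_erase]
      tauto
  obtain ⟨c, X, hcS, hXS, hXne, hcX, hX, hXm⟩ := Nat.find_spec hex
  have hmin : ∀ (c' : V) (X' : Finset V), c' ∈ S → X' ⊆ S → X'.Nonempty → c' ∉ X' →
      (∀ x ∈ X', ∀ u ∈ S, G.Adj x u → u = c' ∨ u ∈ X') → #X ≤ #X' := by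
    intro c' X' h1 h2 h3 h4 h5
    rw [hXm]
    exact Nat.find_min' hex ⟨c', X', h1, h2, h3, h4, h5, rfl⟩
  set B := insert c X with hB
  have hBS : B ⊆ S := insert_subset hcS hXS
  have hXB : ∀ x ∈ X, ∀ u ∈ S, G.Adj x u → u ∈ B := fun x hx u hu h =>
    mem_insert.2 (hX x hx u hu h)
  -- Without triangles some neighbour of `v` cannot reach `c` avoiding `v`; its component, attached
  -- only at `v`, is smaller than `X`.
  have htri : ∃ x ∈ B, ∃ y ∈ B, ∃ z ∈ B, G.Adj x y ∧ G.Adj y z ∧ G.Adj x z := by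
    by_contra hn
    push Not at hn
    obtain ⟨v, hv⟩ := hXne
    have hdeg : degOn G B v = degOn G S v := by
      rw [degOn, degOn]
      congr 1
      ext u
      rw [mem_filter, mem_filter]
      exact ⟨fun h => ⟨hBS h.1, h.2⟩, fun h => ⟨hXB v hv u h.1 h.2, h.2⟩⟩
    obtain ⟨x, hx, y, hy, hvx, hvy, hnr⟩ := not_all_reachIn_of_triangle_free hng
      (fun v hv => hS v (hBS hv)) hn (mem_insert_of_mem hv) (hdeg ▸ h3 v (hXS hv))
    have hreach : ∀ x ∈ B, G.Adj v x → ReachIn G (B \ {v} : Set V) x c := by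
      intro x hx hvx
      by_contra hxc
      have hxR : x ∈ (B \ {v} : Set V) := ⟨hx, hvx.ne'⟩
      let Z : Finset V := {z ∈ B | ReachIn G (B \ {v} : Set V) x z}
      have hZR : ∀ z ∈ Z, z ∈ B ∧ z ≠ v := fun z hz => ((mem_filter.1 hz).2).mem hxR
      have hcZ : c ∉ Z := fun h => hxc (mem_filter.1 h).2
      have hZX : Z ⊆ X.erase v := by
        intro z hz
        rw [mem_erase]
        refine ⟨(hZR z hz).2, ?_⟩
        rcases mem_insert.1 (hZR z hz).1 with rfl | h
        · exact absurd hz hcZ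
        · exact h
      have := hmin v Z (hXS hv) (hZX.trans ((erase_subset _ _).trans hXS))
        ⟨x, mem_filter.2 ⟨hx, ReachIn.refl x⟩⟩ (fun h => (hZR v h).2 rfl) (by
          intro z hz u hu hzu
          by_cases huv : u = v
          · exact Or.inl huv
          · right
            have huB := hXB z (mem_of_mem_erase (hZX hz)) u hu hzu
            refine mem_filter.2 ⟨huB, ((mem_filter.1 hz).2).trans (ReachIn.of_adj hzu ?_ ?_)⟩
            · exact hZR z hz
            · exact ⟨huB, huv⟩)
      have h1 := card_le_card hZX
      have h2 := card_erase_lt_of_mem hv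
      omega
    exact hnr ((hreach x hx hvx).trans (hreach y hy hvy).symm)
  obtain ⟨Q, hQ, hQmax⟩ := exists_max_image
    (B.powerset.filter fun Q : Finset V => G.IsClique (Q : Set V)) card ⟨∅, by simp⟩
  rw [mem_filter, mem_powerset] at hQ
  have hQ3 : 3 ≤ #Q := by
    obtain ⟨x, hx, y, hy, z, hz, hxy, hyz, hxz⟩ := htri
    have h1 : #({x, y, z} : Finset V) = 3 := card_eq_three.2 ⟨x, y, z, hxy.ne, hxz.ne, hyz.ne, rfl⟩
    rw [← h1]
    refine hQmax _ ?_
    rw [mem_filter, mem_powerset]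
    refine ⟨?_, ?_⟩
    · intro u hu
      simp only [mem_insert, mem_singleton] at hu
      rcases hu with rfl | rfl | rfl <;> assumption
    · simp only [coe_insert, coe_singleton]
      rw [SimpleGraph.isClique_insert, SimpleGraph.isClique_insert]
      simp [hxy, hyz, hxz]
  have hQne : ∀ d : V, ∃ u ∈ Q, u ≠ d := by
    intro d
    obtain ⟨u, hu, v, hv, huv⟩ := one_lt_card.1 (show 1 < #Q by omega)
    by_cases h : u = d
    · exact ⟨v, hv, fun h' => huv (h.trans h'.symm)⟩
    · exact ⟨u, hu, h⟩
  -- `Q` is maximal even within `S`, because it contains a vertex of `X`, whose neighbours in `S`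
  -- all lie in `B`.
  have hmax : ∀ v ∈ S, v ∉ Q → ∃ u ∈ Q, ¬ G.Adj v u := by
    intro v hv hvQ
    by_contra hn
    push Not at hn
    obtain ⟨u, hu, huc⟩ := hQne c
    have huX : u ∈ X := (mem_insert.1 (hQ.1 hu)).resolve_left huc
    have hvB : v ∈ B := hXB u huX v hv (hn u hu).symm
    have := hQmax (insert v Q) (by
      rw [mem_filter, mem_powerset, coe_insert, SimpleGraph.isClique_insert]
      exact ⟨insert_subset hvB hQ.1, hQ.2, fun b hb _ => hn b hb⟩)
    rw [card_insert_of_notMem hvQ] at this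
    omega
  -- Since `Q` has no ears, each component of `S \ Q` is attached to `Q` at no more than one vertex.
  have hattach : ∀ x ∈ S, x ∉ Q → ∃ a ∈ Q, ∀ u ∈ Q, ∀ z, ReachIn G (S \ Q : Set V) x z →
      G.Adj z u → u = a := by
    intro x hx hxQ
    by_cases h : ∃ a ∈ Q, ∃ z, ReachIn G (S \ Q : Set V) x z ∧ G.Adj z a
    · obtain ⟨a, ha, z, hz, hza⟩ := h
      refine ⟨a, ha, fun u hu z' hz' hzu => ?_⟩
      by_contra hua
      have hm := hz'.mem (show x ∈ (S \ Q : Set V) from ⟨hx, hxQ⟩)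
      exact not_reachIn_of_clique hng (hQ.1.trans hBS) hS hQ.2 hQ3 hmax ha hu (Ne.symm hua)
        hm.1 hm.2 hza hzu (hz'.symm.trans hz)
    · push Not at h
      obtain ⟨a, ha, -⟩ := hQne x
      exact ⟨a, ha, fun u hu z hz hzu => absurd hzu (h u hu z hz)⟩
  have hQB : Q = B := by
    by_contra hQB
    obtain ⟨z, hzB, hzQ⟩ : ∃ z ∈ B, z ∉ Q := by
      by_contra hn
      push Not at hn
      exact hQB (Subset.antisymm hQ.1 hn)
    by_cases hcQ : c ∈ Q
    -- If `c` lies in `Q`, the component of `z` is a smaller choice of `X`.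
    · have hzX : z ∈ X := by
        rcases mem_insert.1 hzB with rfl | h
        · exact absurd hcQ hzQ
        · exact h
      obtain ⟨a, ha, hattach⟩ := hattach z (hBS hzB) hzQ
      let Z : Finset V := {y ∈ S | ReachIn G (S \ Q : Set V) z y}
      have hzR : z ∈ (S \ Q : Set V) := ⟨hBS hzB, hzQ⟩
      have hZR : ∀ y ∈ Z, y ∈ (S \ Q : Set V) := fun y hy => ((mem_filter.1 hy).2).mem hzR
      have hZX : Z ⊆ X := by
        intro y hy
        refine ((mem_filter.1 hy).2).mem_of_closed (X := (X : Set V)) ?_ hzX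
        intro u hu v hv huv
        rcases hX u hu v hv.1 huv with rfl | h
        · exact absurd hcQ hv.2
        · exact h
      have h1 := hmin a Z (hBS (hQ.1 ha)) (hZX.trans hXS)
        ⟨z, mem_filter.2 ⟨hBS hzB, ReachIn.refl z⟩⟩ (fun h => (hZR a h).2 ha) (by
          intro y hy u hu hyu
          by_cases huQ : u ∈ Q
          · exact Or.inl (hattach u huQ y (mem_filter.1 hy).2 hyu)
          · exact Or.inr (mem_filter.2 ⟨hu, ((mem_filter.1 hy).2).trans
              (ReachIn.of_adj hyu (hZR y hy) ⟨hu, huQ⟩)⟩))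
      obtain ⟨u, hu, huc⟩ := hQne c
      have huX : u ∈ X := (mem_insert.1 (hQ.1 hu)).resolve_left huc
      have h2 := card_lt_card (Finset.ssubset_iff_subset_ne.2
        ⟨hZX, fun h => (hZR u (h ▸ huX)).2 hu⟩)
      omega
    -- If `c` lies outside `Q`, drop from `X` the component of `c` and its attaching vertex `a`,
    -- which takes over the role of `c`.
    · have hQX : Q ⊆ X := by
        intro u hu
        rcases mem_insert.1 (hQ.1 hu) with rfl | h
        · exact absurd hu hcQ
        · exact h
      obtain ⟨a, ha, hattach⟩ := hattach c hcS hcQ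
      have hcR : c ∈ (S \ Q : Set V) := ⟨hcS, hcQ⟩
      let X' : Finset V := {x ∈ X | ¬ ReachIn G (S \ Q : Set V) c x ∧ x ≠ a}
      have h1 := hmin a X' (hBS (hQ.1 ha)) ((filter_subset _ _).trans hXS) (by
          obtain ⟨u, hu, hua⟩ := hQne a
          exact ⟨u, mem_filter.2 ⟨hQX hu, fun h => (h.mem hcR).2 hu, hua⟩⟩)
        (fun h => (mem_filter.1 h).2.2 rfl) (by
          intro x hx u hu hxu
          rw [mem_filter] at hx
          by_cases hua : u = a
          · exact Or.inl hua
          · right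
            have hnr : ¬ ReachIn G (S \ Q : Set V) c u := by
              intro hr
              by_cases hxQ : x ∈ Q
              · exact hx.2.2 (hattach x hxQ u hr hxu.symm)
              · exact hx.2.1 (hr.trans (ReachIn.of_adj hxu.symm (hr.mem hcR) ⟨hXS hx.1, hxQ⟩))
            refine mem_filter.2 ⟨?_, hnr, hua⟩
            rcases hX x hx.1 u hu hxu with rfl | h
            · exact absurd (ReachIn.refl u) hnr
            · exact h)
      have h2 := card_lt_card (Finset.ssubset_iff_subset_ne.2
        ⟨filter_subset (fun x => ¬ ReachIn G (S \ Q : Set V) c x ∧ x ≠ a) X, fun h => by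
          have : a ∈ X' := by
            change a ∈ filter _ X
            rw [h]
            exact hQX ha
          exact (mem_filter.1 this).2.2 rfl⟩)
      change #X' < #X at h2
      omega
  have hB2 : 1 < #B := by
    rw [← hQB]
    omega
  refine ⟨B, c, hBS, mem_insert_self _ _, hB2, hQB ▸ hQ.2, ?_⟩
  intro v hv hvc u hu hvu
  exact hXB v ((mem_insert.1 hv).resolve_left hvc) u hu hvu

end EndClique

/-! ### Cliques of k - 1 low vertices -/

section BigCliques

variable {V : Type*} [Fintype V] {G : SimpleGraph V} {k : ℕ}

/-- A clique of `k - 1` low vertices. -/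
def IsBig (G : SimpleGraph V) (k : ℕ) (K : Finset V) : Prop :=
  (∀ v ∈ K, IsLow G k v) ∧ G.IsClique (K : Set V) ∧ #K + 1 = k

/-- The vertex lies in a clique of `k - 1` low vertices. -/
def InBig (G : SimpleGraph V) (k : ℕ) (v : V) : Prop := ∃ K, IsBig G k K ∧ v ∈ K

lemma InBig.isLow {v : V} (h : InBig G k v) : IsLow G k v := by
  obtain ⟨K, hK, hv⟩ := h
  exact hK.1 v hv

omit [Fintype V] in
lemma degOn_clique {K : Finset V} (hK : G.IsClique (K : Set V)) {v : V} (hv : v ∈ K) :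
    degOn G K v + 1 = #K := by
  have : {u ∈ K | G.Adj v u} = K.erase v := by
    ext u
    rw [mem_filter, mem_erase]
    exact ⟨fun h => ⟨h.2.ne', h.1⟩, fun h => ⟨h.2, hK hv h.2 h.1.symm⟩⟩
  rw [degOn, this, card_erase_add_one hv]

lemma IsBig.degOn_compl {K : Finset V} (hK : IsBig G k K) {v : V} (hv : v ∈ K) :
    degOn G (univ \ K) v = 1 := by
  have h1 := degOn_clique hK.2.1 hv
  have h2 := hK.1 v hv
  have h3 := hK.2.2
  have h4 : degOn G univ v = degOn G K v + degOn G (univ \ K) v := by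
    rw [← degOn_union _ disjoint_sdiff, union_sdiff_of_subset (subset_univ _)]
  rw [IsLow] at h2
  omega

/-- The unique neighbour outside a big clique. -/
lemma IsBig.exists_outer {K : Finset V} (hK : IsBig G k K) {v : V} (hv : v ∈ K) :
    ∃ u, u ∉ K ∧ G.Adj v u ∧ ∀ x, x ∉ K → G.Adj v x → x = u := by
  obtain ⟨u, hu⟩ := card_eq_one.1 (hK.degOn_compl hv)
  have h : ∀ x, x ∉ K ∧ G.Adj v x ↔ x = u := by
    intro x
    rw [← mem_singleton, ← hu, mem_filter]
    simp
  exact ⟨u, ((h u).2 rfl).1, ((h u).2 rfl).2, fun x h1 h2 => (h x).1 ⟨h1, h2⟩⟩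

lemma IsBig.outer_unique {K : Finset V} (hK : IsBig G k K) {v x y : V} (hv : v ∈ K) (hx : x ∉ K)
    (hy : y ∉ K) (hvx : G.Adj v x) (hvy : G.Adj v y) : x = y := by
  obtain ⟨u, -, -, hu⟩ := hK.exists_outer hv
  rw [hu x hx hvx, hu y hy hvy]

/-- The set of low vertices. -/
noncomputable def lowSet (G : SimpleGraph V) (k : ℕ) : Finset V := {v | IsLow G k v}

lemma mem_lowSet {v : V} : v ∈ lowSet G k ↔ IsLow G k v := by simp [lowSet]

lemma IsBig.subset_lowSet {K : Finset V} (hK : IsBig G k K) : K ⊆ lowSet G k :=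
  fun v hv => mem_lowSet.2 (hK.1 v hv)

variable (hk : 7 ≤ k) (hng : ∀ S : Finset V, S.Nonempty → ¬ Good G k S)
  (hcl : ∀ K : Finset V, G.IsClique (K : Set V) → #K ≠ k)

include hcl in
lemma IsBig.exists_not_adj {K : Finset V} (hK : IsBig G k K) {v : V} (hv : v ∉ K) :
    ∃ u ∈ K, ¬ G.Adj v u := by
  by_contra hn
  push Not at hn
  refine hcl (insert v K) ?_ ?_
  · rw [coe_insert, SimpleGraph.isClique_insert]
    exact ⟨hK.2.1, fun b hb _ => hn b hb⟩
  · rw [card_insert_of_notMem hv, hK.2.2]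

include hk hng hcl in
/-- Distinct vertices of a big clique are not joined by a path of low vertices outside it. -/
lemma IsBig.not_reachIn {K : Finset V} (hK : IsBig G k K) {a b x y : V} (ha : a ∈ K) (hb : b ∈ K)
    (hab : a ≠ b) (hy : IsLow G k y) (hyK : y ∉ K) (hxa : G.Adj x a) (hyb : G.Adj y b) :
    ¬ ReachIn G ({v | IsLow G k v} \ K : Set V) y x := by
  have h := not_reachIn_of_clique hng (S := lowSet G k) hK.subset_lowSet
    (fun v hv => mem_lowSet.1 hv) hK.2.1 (by have := hK.2.2; omega)
    (fun v _ hvK => hK.exists_not_adj hcl hvK) ha hb hab (mem_lowSet.2 hy) hyK hxa hyb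
  intro hr
  refine h (hr.mono ?_)
  rintro v ⟨h1, h2⟩
  exact ⟨mem_coe.2 (mem_lowSet.2 h1), h2⟩

include hk hng hcl in
-- A shared vertex has only one neighbour outside `K`, so at most one vertex of `K'` is outside, and
-- it would be a one-vertex ear on `K`.
lemma IsBig.eq_of_mem {K K' : Finset V} (hK : IsBig G k K) (hK' : IsBig G k K') {v : V}
    (hv : v ∈ K) (hv' : v ∈ K') : K = K' := by
  by_contra hne
  obtain ⟨p, hp', hp⟩ : ∃ p ∈ K', p ∉ K := by
    by_contra hn
    push Not at hn
    exact hne (eq_of_subset_of_card_le hn (by have := hK.2.2; have := hK'.2.2; omega)).symm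
  have h1 : #(K' \ K) ≤ 1 := by
    refine card_le_one.2 fun x hx y hy => ?_
    rw [mem_sdiff] at hx hy
    exact hK.outer_unique hv hx.2 hy.2 (hK'.2.1 hv' hx.1 (ne_of_mem_of_not_mem hv hx.2))
      (hK'.2.1 hv' hy.1 (ne_of_mem_of_not_mem hv hy.2))
  have h2 := card_sdiff_add_card_inter K' K
  have h3 := hK'.2.2
  obtain ⟨a, ha, b, hb, hab⟩ := one_lt_card.1 (show 1 < #(K' ∩ K) by omega)
  rw [mem_inter] at ha hb
  exact hK.not_reachIn hk hng hcl ha.2 hb.2 hab (hK'.1 p hp') hp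
    (hK'.2.1 hp' ha.1 (ne_of_mem_of_not_mem ha.2 hp).symm)
    (hK'.2.1 hp' hb.1 (ne_of_mem_of_not_mem hb.2 hp).symm) (ReachIn.refl p)

end BigCliques

/-! ### Charge collected by sets of low vertices -/

section Potential

variable {V : Type*} [Fintype V] {G : SimpleGraph V} {k : ℕ}

/-- The charge weight of a low vertex. -/
noncomputable def wt (G : SimpleGraph V) (k : ℕ) (ε γ : ℝ) (v : V) : ℝ :=
  if InBig G k v then γ else ε

/-- The charge collected by the vertices of `S` from outside `S`, minus the demand `δ` of each. -/
noncomputable def psi (G : SimpleGraph V) (k : ℕ) (ε γ δ : ℝ) (S : Finset V) : ℝ :=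
  ∑ v ∈ S, (wt G k ε γ v * (k - 1 - degOn G S v) - δ)

variable {ε γ δ : ℝ}

lemma psi_union {A C : Finset V} (h : Disjoint A C) :
    psi G k ε γ δ (A ∪ C) = psi G k ε γ δ A + psi G k ε γ δ C
      - ∑ v ∈ A, wt G k ε γ v * degOn G C v - ∑ v ∈ C, wt G k ε γ v * degOn G A v := by
  rw [psi, psi, psi, Finset.sum_union h]
  have h1 : ∑ v ∈ A, (wt G k ε γ v * (k - 1 - degOn G (A ∪ C) v) - δ) =
      ∑ v ∈ A, (wt G k ε γ v * (k - 1 - degOn G A v) - δ) -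
        ∑ v ∈ A, wt G k ε γ v * degOn G C v := by
    rw [← Finset.sum_sub_distrib]
    refine Finset.sum_congr rfl fun v _ => ?_
    rw [degOn_union G h]
    push_cast
    ring
  have h2 : ∑ v ∈ C, (wt G k ε γ v * (k - 1 - degOn G (A ∪ C) v) - δ) =
      ∑ v ∈ C, (wt G k ε γ v * (k - 1 - degOn G C v) - δ) -
        ∑ v ∈ C, wt G k ε γ v * degOn G A v := by
    rw [← Finset.sum_sub_distrib]
    refine Finset.sum_congr rfl fun v _ => ?_
    rw [degOn_union G h]
    push_cast
    ring
  rw [h1, h2]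
  ring

omit [Fintype V] in
lemma sum_degOn_comm (G : SimpleGraph V) (A C : Finset V) :
    ∑ v ∈ A, degOn G C v = ∑ v ∈ C, degOn G A v := by
  simp only [degOn, card_filter]
  rw [Finset.sum_comm]
  simp only [G.adj_comm]

variable (hk : 7 ≤ k) (hng : ∀ S : Finset V, S.Nonempty → ¬ Good G k S)
  (hcl : ∀ K : Finset V, G.IsClique (K : Set V) → #K ≠ k)

include hk hng in
/-- A set of low vertices without big cliques collects much charge. -/
lemma le_psi_of_not_inBig (hε : 0 ≤ ε) (h0 : γ + ε ≤ ε * (k - 1) - δ) (h1 : δ ≤ ε * (k - 5))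
    (h2 : δ ≤ 2 * ε) (h3 : 4 * ε ≤ (k - 2) * (2 * ε - δ)) (h4 : γ ≤ 3 * ε)
    {S : Finset V} (hne : S.Nonempty) (hS : ∀ v ∈ S, IsLow G k v) (hb : ∀ v ∈ S, ¬ InBig G k v) :
    γ + ε ≤ psi G k ε γ δ S := by
  induction hn : #S using Nat.strong_induction_on generalizing S with
  | _ n ih =>
  subst hn
  have hwt : ∀ v ∈ S, wt G k ε γ v = ε := fun v hv => if_neg (hb v hv)
  -- removing a part `R`
  have remove : ∀ R ⊆ S, R.Nonempty → R ≠ S → 2 * ε * ∑ v ∈ R, (degOn G (S \ R) v : ℝ) ≤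
      psi G k ε γ δ R → γ + ε ≤ psi G k ε γ δ S := by
    intro R hR hRne hRS hle
    have e : psi G k ε γ δ S = psi G k ε γ δ R + psi G k ε γ δ (S \ R)
        - 2 * ε * ∑ v ∈ R, (degOn G (S \ R) v : ℝ) := by
      have e1 := psi_union (G := G) (k := k) (ε := ε) (γ := γ) (δ := δ) (disjoint_sdiff (s := R) (t := S))
      rw [union_sdiff_of_subset hR] at e1
      rw [e1, Finset.sum_congr rfl (fun v hv => by rw [hwt v (hR hv)]),
        Finset.sum_congr (s₁ := S \ R) rfl (fun v hv => by rw [hwt v (sdiff_subset hv)]),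
        ← Finset.mul_sum, ← Finset.mul_sum, ← Nat.cast_sum, ← Nat.cast_sum,
        sum_degOn_comm G (S \ R) R]
      ring
    have hlt : #(S \ R) < #S := card_lt_card (sdiff_ssubset hR hRne)
    have := ih _ hlt (sdiff_nonempty.2 fun h => hRS (Subset.antisymm hR h))
      (fun v hv => hS v (sdiff_subset hv)) (fun v hv => hb v (sdiff_subset hv)) rfl
    linarith
  -- A vertex with at most two neighbours in `S` can be split off, since its `ε (k - 1) - δ` covers
  -- the loss of `2 ε` per edge. If there is none, an end clique is split off.
  by_cases hlow : ∃ v ∈ S, degOn G S v ≤ 2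
  · obtain ⟨v, hv, hd⟩ := hlow
    have hpsi : psi G k ε γ δ {v} = ε * (k - 1) - δ := by
      rw [psi, Finset.sum_singleton, hwt v hv]
      have : degOn G {v} v = 0 := by simp [degOn, filter_singleton]
      rw [this]
      push_cast
      ring
    by_cases hSv : {v} = S
    · rw [← hSv, hpsi]
      exact h0
    · refine remove {v} (singleton_subset_iff.2 hv) (singleton_nonempty v) hSv ?_
      rw [Finset.sum_singleton, hpsi]
      have : (degOn G (S \ {v}) v : ℝ) ≤ 2 := by
        exact_mod_cast (degOn_mono G sdiff_subset v).trans hd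
      nlinarith
  · push Not at hlow
    obtain ⟨B, c, hBS, hcB, hB2, hB, hatt⟩ := exists_end_clique hng hne hS fun v hv => hlow v hv
    have hcard : #B + 2 ≤ k := by
      by_contra hn
      obtain ⟨K, hKB, hK⟩ := exists_subset_card_eq (s := B) (n := k - 1) (by omega)
      have hbig : IsBig G k K := ⟨fun v hv => hS v (hBS (hKB hv)),
        hB.subset (by exact_mod_cast hKB), by omega⟩
      obtain ⟨v, hv⟩ := card_pos.1 (show 0 < #K by omega)
      exact hb v (hBS (hKB hv)) ⟨K, hbig, hv⟩
    have hdegB : ∀ v ∈ B, (degOn G B v : ℝ) = #B - 1 := by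
      intro v hv
      rw [← degOn_clique hB hv]
      push_cast
      ring
    have hB1 : 1 ≤ #B := card_pos.2 ⟨c, hcB⟩
    -- With at most `k - 3` vertices the end clique goes without `c`, each vertex losing at most one
    -- edge. With `k - 2` vertices it goes whole; then only `c` has edges to the rest, at most two.
    rcases Nat.lt_or_ge (#B + 2) k with hlt | hge
    · have hne' : (B.erase c).Nonempty := by
        rw [← card_pos, card_erase_of_mem hcB]
        omega
      refine remove (B.erase c) ((erase_subset _ _).trans hBS) hne'
        (fun h => notMem_erase c B (h ▸ hBS hcB)) ?_
      have d1 : ∀ v ∈ B.erase c, (degOn G (S \ B.erase c) v : ℝ) ≤ 1 := by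
        intro v hv
        have : degOn G (S \ B.erase c) v ≤ 1 := by
          refine (card_le_card (t := {c}) ?_).trans (card_singleton c).le
          intro u hu
          rw [mem_filter, mem_sdiff] at hu
          rw [mem_singleton]
          by_contra huc
          exact hu.1.2 (mem_erase.2 ⟨huc, hatt v (mem_of_mem_erase hv) (ne_of_mem_erase hv) u
            hu.1.1 hu.2⟩)
        exact_mod_cast this
      have d2 : ∀ v ∈ B.erase c, (degOn G (B.erase c) v : ℝ) = #B - 2 := by
        intro v hv
        have hcl' : G.IsClique ((B.erase c : Finset V) : Set V) :=
          hB.subset (by exact_mod_cast erase_subset c B)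
        have := degOn_clique hcl' hv
        rw [card_erase_of_mem hcB] at this
        have h' : degOn G (B.erase c) v + 2 = #B := by omega
        rw [← h']
        push_cast
        ring
      have e1 : psi G k ε γ δ (B.erase c) = (#B - 1) * (ε * (k + 1 - #B) - δ) := by
        rw [psi, Finset.sum_congr rfl (fun v hv => by
          rw [hwt v (hBS (mem_of_mem_erase hv)), d2 v hv]), Finset.sum_const,
          card_erase_of_mem hcB, nsmul_eq_mul, Nat.cast_sub hB1]
        push_cast
        ring
      have e2 : ∑ v ∈ B.erase c, (degOn G (S \ B.erase c) v : ℝ) ≤ #B - 1 := by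
        refine (Finset.sum_le_sum d1).trans ?_
        rw [Finset.sum_const, card_erase_of_mem hcB, nsmul_eq_mul, Nat.cast_sub hB1]
        simp
      have hkB : (#B : ℝ) + 3 ≤ k := by exact_mod_cast hlt
      have hB2' : (1 : ℝ) ≤ #B := by exact_mod_cast hB1
      have e3 : δ ≤ ε * (k - 1 - #B) := by nlinarith
      have e4 : 2 * ε * ∑ v ∈ B.erase c, (degOn G (S \ B.erase c) v : ℝ) ≤ 2 * ε * (#B - 1) :=
        mul_le_mul_of_nonneg_left e2 (by linarith)
      rw [e1]
      nlinarith
    · have hBk : (#B : ℝ) = k - 2 := by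
        have : #B + 2 = k := by omega
        rw [← this]
        push_cast
        ring
      have e1 : psi G k ε γ δ B = (k - 2) * (2 * ε - δ) := by
        rw [psi, Finset.sum_congr rfl (fun v hv => by
          rw [hwt v (hBS hv), hdegB v hv, hBk]), Finset.sum_const, nsmul_eq_mul, hBk]
        ring
      by_cases hBS' : B = S
      · rw [← hBS', e1]
        linarith
      · refine remove B hBS ⟨c, hcB⟩ hBS' ?_
        have e2 : ∑ v ∈ B, (degOn G (S \ B) v : ℝ) = degOn G (S \ B) c := by
          refine Finset.sum_eq_single_of_mem c hcB fun v hv hvc => ?_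
          have : degOn G (S \ B) v = 0 := by
            rw [degOn, card_eq_zero, filter_eq_empty_iff]
            intro u hu hvu
            rw [mem_sdiff] at hu
            exact hu.2 (hatt v hv hvc u hu.1 hvu)
          exact_mod_cast this
        have e3 : (degOn G (S \ B) c : ℝ) ≤ 2 := by
          have a1 := degOn_clique hB hcB
          have a2 := hS c (hBS hcB)
          have a3 := degOn_mono G (subset_univ (B ∪ S \ B)) c
          rw [degOn_union G disjoint_sdiff] at a3
          rw [IsLow] at a2
          exact_mod_cast (show degOn G (S \ B) c ≤ 2 by omega)
        rw [e1, e2]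
        nlinarith

include hk hng hcl in
/-- A set of low vertices that is a union of big cliques and vertices outside big cliques
collects enough charge, with a surplus. -/
lemma le_psi (hε : 0 ≤ ε) (hεγ : ε ≤ γ) (hγδ : γ * (k - 3) = δ * (k - 1))
    (h0 : γ + ε ≤ ε * (k - 1) - δ) (h1 : δ ≤ ε * (k - 5))
    (h2 : δ ≤ 2 * ε) (h3 : 4 * ε ≤ (k - 2) * (2 * ε - δ)) (h4 : γ ≤ 3 * ε)
    {S : Finset V} (hne : S.Nonempty) (hS : ∀ v ∈ S, IsLow G k v)
    (hclosed : ∀ K, IsBig G k K → ∀ v ∈ K, v ∈ S → K ⊆ S) :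
    γ + ε ≤ psi G k ε γ δ S ∧ ((∃ v ∈ S, InBig G k v) → 2 * γ ≤ psi G k ε γ δ S) := by
  induction hn : #S using Nat.strong_induction_on generalizing S with
  | _ n ih =>
  subst hn
  by_cases hb : ∃ v ∈ S, InBig G k v
  swap
  · push Not at hb
    refine ⟨le_psi_of_not_inBig hk hng hε h0 h1 h2 h3 h4 hne hS hb, ?_⟩
    rintro ⟨v, hv, hv'⟩
    exact absurd hv' (hb v hv)
  suffices hmain : 2 * γ ≤ psi G k ε γ δ S from ⟨by linarith, fun _ => hmain⟩
  obtain ⟨v₀, hv₀, K, hK, hv₀K⟩ := hb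
  have hKS : K ⊆ S := hclosed K hK v₀ hv₀K hv₀
  have hwtK : ∀ v ∈ K, wt G k ε γ v = γ := fun v hv => if_pos ⟨K, hK, hv⟩
  by_cases hout : ∃ v ∈ K, ∃ v' ∈ S, v' ∉ K ∧ G.Adj v v'
  · obtain ⟨v, hv, v', hv', hv'K, hadj⟩ := hout
    -- `C` is the part of `S \ K` reachable from `v'`. As `K` has no ears, `v v'` is the only edge
    -- between `C` and the rest; cutting it costs `γ` at `v` and the weight of `v'` at the other
    -- end.
    let C : Finset V := {u ∈ S | ReachIn G (S \ K : Set V) v' u}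
    have hCS : C ⊆ S := filter_subset _ _
    have hv'C : v' ∈ C := mem_filter.2 ⟨hv', ReachIn.refl v'⟩
    have hCR : ∀ u ∈ C, u ∈ (S \ K : Set V) := fun u hu => ((mem_filter.1 hu).2).mem ⟨hv', hv'K⟩
    have hKA : K ⊆ S \ C := fun u hu => mem_sdiff.2 ⟨hKS hu, fun h => (hCR u h).2 hu⟩
    have hcross : ∀ u ∈ C, ∀ x ∈ S \ C, G.Adj u x → x = v ∧ u = v' := by
      intro u hu x hx hux
      rw [mem_sdiff] at hx
      have hxK : x ∈ K := by
        by_contra hxK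
        exact hx.2 (mem_filter.2 ⟨hx.1, ((mem_filter.1 hu).2).trans
          (ReachIn.of_adj hux (hCR u hu) ⟨hx.1, hxK⟩)⟩)
      have hxv : x = v := by
        by_contra hxv
        refine hK.not_reachIn hk hng hcl hxK hv hxv (hS v' hv') hv'K hux hadj.symm
          (((mem_filter.1 hu).2).mono ?_)
        rintro w ⟨hw1, hw2⟩
        exact ⟨hS w hw1, hw2⟩
      subst hxv
      exact ⟨rfl, hK.outer_unique hxK (hCR u hu).2 hv'K hux.symm hadj⟩
    have hclosedC : ∀ K', IsBig G k K' → ∀ u ∈ K', u ∈ C → K' ⊆ C := by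
      intro K' hK' u hu huC w hw
      by_cases hwu : w = u
      · exact hwu ▸ huC
      have hK'S := hclosed K' hK' u hu (hCS huC)
      have hwK : w ∉ K := by
        intro hwK
        have := hK.eq_of_mem hk hng hcl hK' hwK hw
        exact (hCR u huC).2 (this ▸ hu)
      exact mem_filter.2 ⟨hK'S hw, ((mem_filter.1 huC).2).trans
        (ReachIn.of_adj (hK'.2.1 hu hw (Ne.symm hwu)) (hCR u huC) ⟨hK'S hw, hwK⟩)⟩
    have hclosedA : ∀ K', IsBig G k K' → ∀ u ∈ K', u ∈ S \ C → K' ⊆ S \ C := by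
      intro K' hK' u hu huA w hw
      rw [mem_sdiff] at huA ⊢
      exact ⟨hclosed K' hK' u hu huA.1 hw, fun hwC => huA.2 (hclosedC K' hK' w hw hwC hu)⟩
    have hvA : v ∈ S \ C := hKA hv
    have hA := (ih #(S \ C) (card_lt_card (sdiff_ssubset hCS ⟨v', hv'C⟩)) ⟨v, hvA⟩
      (fun u hu => hS u (sdiff_subset hu)) hclosedA rfl).2 ⟨v, hvA, K, hK, hv⟩
    have hC := ih #C (card_lt_card (Finset.ssubset_iff_subset_ne.2
      ⟨hCS, fun h => (mem_sdiff.1 hvA).2 (h ▸ hKS hv)⟩)) ⟨v', hv'C⟩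
      (fun u hu => hS u (hCS hu)) hclosedC rfl
    -- Both parts of the induction hypothesis are shaped for this cost: `2 γ` if `v'` lies in a big
    -- clique and `γ + ε` if not.
    have hC' : γ + wt G k ε γ v' ≤ psi G k ε γ δ C := by
      rw [wt]
      split_ifs with h
      · have := hC.2 ⟨v', hv'C, h⟩
        linarith
      · exact hC.1
    have e1 := psi_union (G := G) (k := k) (ε := ε) (γ := γ) (δ := δ) (sdiff_disjoint (s := C) (t := S))
    rw [sdiff_union_of_subset hCS] at e1
    have s1 : ∑ x ∈ S \ C, wt G k ε γ x * degOn G C x = γ := by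
      rw [Finset.sum_eq_single_of_mem v hvA]
      · have : {u ∈ C | G.Adj v u} = {v'} := by
          ext u
          rw [mem_filter, mem_singleton]
          constructor
          · rintro ⟨h1, h2⟩
            exact (hcross u h1 v hvA h2.symm).2
          · rintro rfl
            exact ⟨hv'C, hadj⟩
        rw [hwtK v hv, degOn, this, card_singleton]
        simp
      · intro x hx hxv
        have : degOn G C x = 0 := by
          rw [degOn, card_eq_zero, filter_eq_empty_iff]
          intro u hu hxu
          exact hxv (hcross u hu x hx hxu.symm).1
        rw [this]
        simp
    have s2 : ∑ x ∈ C, wt G k ε γ x * degOn G (S \ C) x = wt G k ε γ v' := by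
      rw [Finset.sum_eq_single_of_mem v' hv'C]
      · have : {u ∈ S \ C | G.Adj v' u} = {v} := by
          ext u
          rw [mem_filter, mem_singleton]
          constructor
          · rintro ⟨h1, h2⟩
            exact (hcross v' hv'C u h1 h2).1
          · rintro rfl
            exact ⟨hvA, hadj.symm⟩
        rw [degOn, this, card_singleton]
        simp
      · intro x hx hxv
        have : degOn G (S \ C) x = 0 := by
          rw [degOn, card_eq_zero, filter_eq_empty_iff]
          intro u hu hxu
          exact hxv (hcross x hx u hu hxu).2
        rw [this]
        simp
    rw [e1, s1, s2]
    linarith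
  · push Not at hout
    have hk1 : (#K : ℝ) = k - 1 := by
      rw [← hK.2.2]
      push_cast
      ring
    -- The relation between `γ` and `δ` is chosen so that a big clique by itself has surplus exactly
    -- `2 γ`, the price of two unpaid edges.
    have eK : psi G k ε γ δ K = 2 * γ := by
      have hd : ∀ v ∈ K, (degOn G K v : ℝ) = k - 2 := by
        intro v hv
        have := degOn_clique hK.2.1 hv
        have h' : (degOn G K v : ℝ) + 1 = #K := by exact_mod_cast this
        rw [hk1] at h'
        linarith
      rw [psi, Finset.sum_congr rfl (fun v hv => by rw [hwtK v hv, hd v hv]), Finset.sum_const,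
        nsmul_eq_mul, hk1]
      linarith
    by_cases hKS' : K = S
    · rw [← hKS', eK]
    · have e1 := psi_union (G := G) (k := k) (ε := ε) (γ := γ) (δ := δ)
        (disjoint_sdiff (s := K) (t := S))
      rw [union_sdiff_of_subset hKS] at e1
      have s1 : ∑ x ∈ K, wt G k ε γ x * degOn G (S \ K) x = 0 := by
        refine Finset.sum_eq_zero fun x hx => ?_
        have : degOn G (S \ K) x = 0 := by
          rw [degOn, card_eq_zero, filter_eq_empty_iff]
          intro u hu hxu
          rw [mem_sdiff] at hu
          exact hout x hx u hu.1 hu.2 hxu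
        rw [this]
        simp
      have s2 : ∑ x ∈ S \ K, wt G k ε γ x * degOn G K x = 0 := by
        refine Finset.sum_eq_zero fun x hx => ?_
        rw [mem_sdiff] at hx
        have : degOn G K x = 0 := by
          rw [degOn, card_eq_zero, filter_eq_empty_iff]
          intro u hu hxu
          exact hout u hu x hx.1 hx.2 hxu.symm
        rw [this]
        simp
      have hC := (ih #(S \ K) (card_lt_card (sdiff_ssubset hKS ⟨v₀, hv₀K⟩))
        (sdiff_nonempty.2 fun h => hKS' (Subset.antisymm hKS h))
        (fun u hu => hS u (sdiff_subset hu)) (by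
          intro K' hK' u hu huS w hw
          rw [mem_sdiff] at huS ⊢
          refine ⟨hclosed K' hK' u hu huS.1 hw, fun hwK => huS.2 ?_⟩
          rw [hK.eq_of_mem hk hng hcl hK' hwK hw]
          exact hu) rfl).1
      rw [e1, s1, s2, eK]
      linarith

end Potential

/-! ### Toggling several cliques, and choosing roots by Hall's theorem -/

section Selection

variable {V : Type*} {G : SimpleGraph V} {k : ℕ}

/-- Iterated toggling: in each part `K i`, keep the arc `e i → w i` and delete all other arcs
leaving `e i` or `w i` inside `K i`. -/
lemma sigma_toggle_all {ι : Type*} (I : Finset ι) {D : Finset (V × V)} (K : ι → Finset V)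
    (e w : ι → V) (hK : ∀ i ∈ I, ∀ j ∈ I, i ≠ j → Disjoint (K i) (K j))
    (he : ∀ i ∈ I, e i ∈ K i) (hw : ∀ i ∈ I, w i ∈ K i) (hew : ∀ i ∈ I, e i ≠ w i)
    (hloop : ∀ v, (v, v) ∉ D) (hin : ∀ i ∈ I, #{p ∈ D | p.2 = e i} ≤ 1)
    (hinw : ∀ i ∈ I, ∀ p ∈ D, p.2 = w i → p.1 = e i)
    (hout : ∀ i ∈ I, ∀ v, (e i, v) ∈ D ↔ v ∈ K i ∧ v ≠ e i)
    (houtw : ∀ i ∈ I, ∀ v ∈ K i, v ≠ e i → v ≠ w i → (w i, v) ∈ D) :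
    sigma D = sigma {p ∈ D | ∀ i ∈ I, ¬ (p.1 = e i ∧ p.2 ≠ w i) ∧
      ¬ (p.1 = w i ∧ p.2 ∈ K i ∧ p.2 ≠ e i)} := by
  induction I using Finset.induction_on with
  | empty => simp
  | insert i I hi ih =>
    rw [ih (fun a ha b hb => hK a (mem_insert_of_mem ha) b (mem_insert_of_mem hb))
      (fun a ha => he a (mem_insert_of_mem ha)) (fun a ha => hw a (mem_insert_of_mem ha))
      (fun a ha => hew a (mem_insert_of_mem ha)) (fun a ha => hin a (mem_insert_of_mem ha))
      (fun a ha => hinw a (mem_insert_of_mem ha)) (fun a ha => hout a (mem_insert_of_mem ha))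
      (fun a ha => houtw a (mem_insert_of_mem ha))]
    set D' := {p ∈ D | ∀ i ∈ I, ¬ (p.1 = e i ∧ p.2 ≠ w i) ∧
      ¬ (p.1 = w i ∧ p.2 ∈ K i ∧ p.2 ≠ e i)} with hD'
    have hii := mem_insert_self i I
    -- The cliques are disjoint, so the other toggles leave all arcs out of `K i` in place.
    have hkeep : ∀ u ∈ K i, ∀ v, (u, v) ∈ D' ↔ (u, v) ∈ D := by
      intro u hu v
      rw [hD', mem_filter]
      refine ⟨fun h => h.1, fun h => ⟨h, fun j hj => ?_⟩⟩
      have hd := Finset.disjoint_left.1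
        (hK i hii j (mem_insert_of_mem hj) (fun h => hi (h ▸ hj))) hu
      refine ⟨fun h => hd ?_, fun h => hd ?_⟩
      · rw [show u = e j from h.1]
        exact he j (mem_insert_of_mem hj)
      · rw [show u = w j from h.1]
        exact hw j (mem_insert_of_mem hj)
    have hsub : D' ⊆ D := filter_subset _ _
    have hout' : ∀ v, (e i, v) ∈ D' ↔ v ∈ K i ∧ v ≠ e i := fun v => by
      rw [hkeep _ (he i hii), hout i hii]
    rw [sigma_toggle (a := e i) (w := w i)
      ((card_le_card (filter_subset_filter _ hsub)).trans (hin i hii))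
      (fun p hp => hinw i hii p (hsub hp))
      ((hout' _).2 ⟨hw i hii, (hew i hii).symm⟩) ?_ (fun h => hloop _ (hsub h)) (hew i hii)]
    · congr 1
      ext p
      rw [mem_filter, hout', hD', mem_filter, mem_filter]
      simp only [mem_insert, forall_eq_or_imp]
      tauto
    · intro v hv h
      rw [hout'] at h
      rw [hkeep _ (hw i hii)]
      exact houtw i hii v h.1 h.2 hv

/-- Choice of one element from each of the given sets of size at least three without using up
more than all but two elements of any class of size at least three. -/
lemma exists_choice {ι α β : Type*} [Nonempty α] (I : Finset ι) (E : Finset α) (A : ι → Finset α) (f : α → β)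
    (hA : ∀ i ∈ I, A i ⊆ E) (hdisj : ∀ i ∈ I, ∀ j ∈ I, i ≠ j → Disjoint (A i) (A j))
    (h3 : ∀ i ∈ I, 3 ≤ #(A i)) (hf : ∀ x ∈ E, 3 ≤ #{z ∈ E | f z = f x}) :
    ∃ g : ι → α, (∀ i ∈ I, g i ∈ A i) ∧
      ∀ x ∈ E, #{i ∈ I | f (g i) = f x} + 2 ≤ #{z ∈ E | f z = f x} := by
  -- Each class of `f` in `E` offers its size minus two tokens; Hall's theorem hands one token to
  -- every index.
  let t : I → Finset (β × ℕ) := fun i =>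
    ((A i).image f).biUnion fun b => (range (#{z ∈ E | f z = b} - 2)).image fun n => (b, n)
  have hall : ∀ s : Finset I, #s ≤ #(s.biUnion t) := by
    intro s
    let U : Finset α := s.biUnion fun i => A i
    have hU : 3 * #s ≤ #U := by
      rw [card_biUnion fun (i : I) _ (j : I) _ hij => hdisj i i.2 j j.2 fun h => hij (Subtype.ext h)]
      calc 3 * #s = ∑ i ∈ s, 3 := by rw [Finset.sum_const, smul_eq_mul, mul_comm]
        _ ≤ _ := Finset.sum_le_sum fun i _ => h3 i i.2
    have hUE : U ⊆ E := biUnion_subset.2 fun i _ => hA i i.2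
    have h1 : #U ≤ ∑ b ∈ U.image f, #{z ∈ E | f z = b} := by
      rw [card_eq_sum_card_image f U]
      exact Finset.sum_le_sum fun b _ => card_le_card (filter_subset_filter _ hUE)
    -- `n ≤ 3 (n - 2)` for `n ≥ 3`, so the tokens number at least a third of `#U`, which suffices as
    -- `U` has three elements per index.
    have h2 : ∑ b ∈ U.image f, #{z ∈ E | f z = b} ≤
        3 * ∑ b ∈ U.image f, (#{z ∈ E | f z = b} - 2) := by
      rw [Finset.mul_sum]
      refine Finset.sum_le_sum fun b hb => ?_
      obtain ⟨x, hx, rfl⟩ := mem_image.1 hb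
      have := hf x (hUE hx)
      omega
    have h4 : s.biUnion t = (U.image f).biUnion fun b =>
        (range (#{z ∈ E | f z = b} - 2)).image fun n => (b, n) := by
      ext ⟨b, n⟩
      simp only [t, U, mem_biUnion, mem_image]
      constructor
      · rintro ⟨i, hi, c, ⟨x, hx, rfl⟩, h⟩
        exact ⟨_, ⟨x, ⟨i, hi, hx⟩, rfl⟩, h⟩
      · rintro ⟨c, ⟨x, ⟨i, hi, hx⟩, rfl⟩, h⟩
        exact ⟨i, hi, _, ⟨x, hx, rfl⟩, h⟩
    have h5 : #(s.biUnion t) = ∑ b ∈ U.image f, (#{z ∈ E | f z = b} - 2) := by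
      rw [h4, card_biUnion]
      · refine Finset.sum_congr rfl fun b _ => ?_
        rw [card_image_of_injective _ (fun m n h => (Prod.mk.inj h).2), card_range]
      · intro b _ c _ hbc
        rw [Function.onFun, Finset.disjoint_left]
        rintro ⟨x, n⟩ h h'
        simp only [mem_image, Prod.mk.injEq] at h h'
        obtain ⟨_, _, rfl, _⟩ := h
        obtain ⟨_, _, rfl, _⟩ := h'
        exact hbc rfl
    omega
  obtain ⟨h, hinj, hmem⟩ := (all_card_le_biUnion_card_iff_exists_injective t).1 hall
  have hex : ∀ i : I, ∃ x ∈ A i, f x = (h i).1 ∧ (h i).2 < #{z ∈ E | f z = f x} - 2 := by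
    intro i
    have := hmem i
    simp only [t, mem_biUnion, mem_image, mem_range] at this
    obtain ⟨b, ⟨x, hx, rfl⟩, n, hn, hb⟩ := this
    refine ⟨x, hx, by rw [← hb], by rw [← hb]; exact hn⟩
  choose g hgA hg1 hg2 using hex
  let g' : ι → α := fun i => if hi : i ∈ I then g ⟨i, hi⟩ else Classical.arbitrary α
  have hg' : ∀ i (hi : i ∈ I), g' i = g ⟨i, hi⟩ := fun i hi => dif_pos hi
  refine ⟨g', fun i hi => hg' i hi ▸ hgA ⟨i, hi⟩, fun x hx => ?_⟩
  have : #{i ∈ I | f (g' i) = f x} ≤ #(range (#{z ∈ E | f z = f x} - 2)) := by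
    refine card_le_card_of_injOn (fun i => if hi : i ∈ I then (h ⟨i, hi⟩).2 else 0) ?_ ?_
    · intro i hi
      obtain ⟨hi, hi'⟩ := mem_filter.1 (mem_coe.1 hi)
      rw [hg' i hi] at hi'
      simp only [hi, dif_pos, coe_range, Set.mem_Iio]
      have := hg2 ⟨i, hi⟩
      rwa [hi'] at this
    · intro i hi j hj hij
      obtain ⟨hi, hi'⟩ := mem_filter.1 (mem_coe.1 hi)
      obtain ⟨hj, hj'⟩ := mem_filter.1 (mem_coe.1 hj)
      rw [hg' i hi] at hi'
      rw [hg' j hj] at hj'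
      simp only [hi, hj, dif_pos] at hij
      have : h ⟨i, hi⟩ = h ⟨j, hj⟩ := Prod.ext (by rw [← hg1, ← hg1, hi', hj']) hij
      exact congrArg Subtype.val (hinj this)
  rw [card_range] at this
  have := hf x hx
  omega

end Selection

/-! ### Breadth-first distances in the low graph -/

section Distances

variable {V : Type*} [Fintype V] {G : SimpleGraph V} {k : ℕ}

/-- The subgraph of edges between low vertices. -/
def lowGraph (G : SimpleGraph V) (k : ℕ) : SimpleGraph V where
  Adj u v := G.Adj u v ∧ IsLow G k u ∧ IsLow G k v
  symm := ⟨fun _ _ h => ⟨h.1.symm, h.2.2, h.2.1⟩⟩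
  loopless := ⟨fun _ h => h.1.ne rfl⟩

lemma exists_parent {a v : V} (h : (lowGraph G k).Reachable a v) (hne : v ≠ a) :
    ∃ u, (lowGraph G k).Adj v u ∧ (lowGraph G k).Reachable a u ∧
      (lowGraph G k).dist a u + 1 = (lowGraph G k).dist a v := by
  obtain ⟨p, hp⟩ := h.symm.exists_walk_length_eq_dist
  cases p with
  | nil => exact absurd rfl hne
  | cons hadj q =>
    rename_i u
    refine ⟨u, hadj, q.reachable.symm, ?_⟩
    rw [SimpleGraph.Walk.length_cons, SimpleGraph.dist_comm] at hp
    have h1 : (lowGraph G k).dist a u ≤ q.length := by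
      rw [SimpleGraph.dist_comm]
      exact SimpleGraph.dist_le q
    have h2 := (SimpleGraph.Adj.symm hadj).reachable.dist_triangle_right a
    rw [SimpleGraph.dist_eq_one_iff_adj.2 (SimpleGraph.Adj.symm hadj)] at h2
    omega

lemma dist_le_dist_add_one {a u v : V} (h : (lowGraph G k).Adj u v) :
    (lowGraph G k).dist a u ≤ (lowGraph G k).dist a v + 1 := by
  have := (SimpleGraph.Adj.symm h).reachable.dist_triangle_right a
  rw [SimpleGraph.dist_eq_one_iff_adj.2 (SimpleGraph.Adj.symm h)] at this
  omega

/-- After `v`, a shortest path to `a` meets only distances below `n`, hence no vertex of `K`. -/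
lemma reachIn_of_dist_le {a : V} {K : Finset V} (ha : IsLow G k a) {n : ℕ} {v : V}
    (h : (lowGraph G k).Reachable a v) (hv : v ∉ K) (hn : (lowGraph G k).dist a v = n)
    (hK : ∀ x ∈ K, n ≤ (lowGraph G k).dist a x) :
    ReachIn G ({v | IsLow G k v} \ K : Set V) v a := by
  induction n generalizing v with
  | zero =>
    rw [h.dist_eq_zero_iff] at hn
    exact hn ▸ ReachIn.refl _
  | succ n ih =>
    have hne : v ≠ a := by
      rintro rfl
      simp at hn
    obtain ⟨u, hu, hau, hd⟩ := exists_parent h hne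
    have huK : u ∉ K := fun hu' => by
      have := hK u hu'
      omega
    have hvu : ReachIn G ({v | IsLow G k v} \ K : Set V) v u :=
      ReachIn.of_adj hu.1 ⟨hu.2.1, hv⟩ ⟨hu.2.2, huK⟩
    exact hvu.trans
      (ih hau huK (by omega) fun x hx => (Nat.le_succ n).trans (hK x hx))

variable (hk : 7 ≤ k) (hng : ∀ S : Finset V, S.Nonempty → ¬ Good G k S)
  (hcl : ∀ K : Finset V, G.IsClique (K : Set V) → #K ≠ k)

include hk hng hcl in
/-- A big clique is entered at one vertex when searching from `a`. -/
lemma IsBig.exists_entry {K : Finset V} (hK : IsBig G k K) {a : V} (ha : IsLow G k a)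
    (hreach : ∀ v ∈ K, (lowGraph G k).Reachable a v) :
    ∃ e ∈ K, (e ≠ a → ∃ u, u ∉ K ∧ IsLow G k u ∧ G.Adj e u ∧
        (lowGraph G k).dist a u < (lowGraph G k).dist a e) ∧
      ∀ v ∈ K, v ≠ e → v ≠ a ∧ (lowGraph G k).dist a e < (lowGraph G k).dist a v ∧
        ((lowGraph G k).dist a v = (lowGraph G k).dist a e + 1) ∧
        ∀ u, u ∉ K → IsLow G k u → G.Adj v u →
          (lowGraph G k).dist a v < (lowGraph G k).dist a u := by
  have hKne : K.Nonempty := card_pos.1 (by have := hK.2.2; omega)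
  obtain ⟨e, he, hmin⟩ := exists_min_image K (fun v => (lowGraph G k).dist a v) hKne
  have hadj : ∀ v ∈ K, v ≠ e → (lowGraph G k).Adj v e := fun v hv hne =>
    ⟨hK.2.1 hv he hne, hK.1 v hv, hK.1 e he⟩
  have hparent : ∀ v ∈ K, v ≠ a → (lowGraph G k).dist a v = (lowGraph G k).dist a e →
      ∃ u, u ∉ K ∧ (lowGraph G k).Adj v u ∧ (lowGraph G k).dist a u < (lowGraph G k).dist a v ∧
        ReachIn G ({v | IsLow G k v} \ K : Set V) u a := by
    intro v hv hva hd
    obtain ⟨u, hu, hau, hd'⟩ := exists_parent (hreach v hv) hva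
    have huK : u ∉ K := fun h => by
      have := hmin u h
      omega
    refine ⟨u, huK, hu, by omega, reachIn_of_dist_le ha hau huK rfl fun x hx => ?_⟩
    have := hmin x hx
    omega
  have haK : a ∈ K → e = a := by
    intro h
    have := hmin a h
    rw [SimpleGraph.dist_self, Nat.le_zero, (hreach e he).dist_eq_zero_iff] at this
    exact this.symm
  refine ⟨e, he, fun hea => ?_, fun v hv hve => ?_⟩
  · obtain ⟨u, h1, h2, h3, -⟩ := hparent e he hea rfl
    exact ⟨u, h1, h2.2.2, h2.1, h3⟩
  · have hva : v ≠ a := fun h => hve ((haK (h ▸ hv)).trans h.symm).symm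
    -- Two vertices of `K` at minimal distance would be joined outside `K` through their parents and
    -- `a`, giving an ear.
    have hne : (lowGraph G k).dist a v ≠ (lowGraph G k).dist a e := by
      intro hd
      obtain ⟨u, h1, h2, h3, h4⟩ := hparent v hv hva hd
      have hea : e ≠ a := by
        rintro rfl
        rw [SimpleGraph.dist_self, (hreach v hv).dist_eq_zero_iff] at hd
        exact hve hd.symm
      obtain ⟨u', h1', h2', h3', h4'⟩ := hparent e he hea rfl
      exact hK.not_reachIn hk hng hcl hv he hve h2'.2.2 h1' h2.1.symm h2'.1.symm (h4'.trans h4.symm)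
    have hlt := lt_of_le_of_ne (hmin v hv) hne.symm
    have hle := dist_le_dist_add_one (a := a) (hadj v hv hve)
    refine ⟨hva, hlt, by omega, fun u huK hu hvu => ?_⟩
    -- An outer neighbour `u` no farther than `v` would also reach `a` outside `K`, giving an ear
    -- with the parent of `e`, or a one-vertex ear `u` if `e = a`.
    by_contra hn
    have hvu' : (lowGraph G k).Adj v u := ⟨hvu, hK.1 v hv, hu⟩
    have hau : (lowGraph G k).Reachable a u := (hreach v hv).trans hvu'.reachable
    have hue : ¬ G.Adj u e := fun h =>
      hK.not_reachIn hk hng hcl hv he hve hu huK hvu.symm h (ReachIn.refl u)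
    have hreachu : ReachIn G ({v | IsLow G k v} \ K : Set V) u a := by
      by_cases hua : u = a
      · exact hua ▸ ReachIn.refl _
      obtain ⟨x, hx, hax, hd⟩ := exists_parent hau hua
      have hxK : x ∉ K := by
        intro hxK
        by_cases hxe : x = e
        · exact hue (hxe ▸ hx.1)
        · have h1 := hmin x hxK
          have hxv : x = v := by
            by_contra hxv
            exact hK.not_reachIn hk hng hcl hxK hv hxv hu huK hx.1 hvu.symm (ReachIn.refl u)
          subst hxv
          omega
      have hux : ReachIn G ({v | IsLow G k v} \ K : Set V) u x :=
        ReachIn.of_adj hx.1 ⟨hu, huK⟩ ⟨hx.2.2, hxK⟩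
      refine hux.trans (reachIn_of_dist_le ha hax hxK rfl fun y hy => ?_)
      have := hmin y hy
      omega
    by_cases hea : e = a
    · have hne : (lowGraph G k).dist a u ≠ 0 := by
        rw [ne_eq, hau.dist_eq_zero_iff]
        rintro rfl
        exact huK (hea ▸ he)
      have h1 : (lowGraph G k).dist a u = 1 := by
        rw [hea, SimpleGraph.dist_self] at hle
        omega
      rw [SimpleGraph.dist_eq_one_iff_adj, ← hea] at h1
      exact hue h1.1.symm
    · obtain ⟨u', h1', h2', h3', h4'⟩ := hparent e he hea rfl
      exact hK.not_reachIn hk hng hcl hv he hve h2'.2.2 h1' hvu.symm h2'.1.symm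
        (h4'.trans hreachu.symm)

end Distances

/-! ### A search order adapted to big cliques -/

section Search

variable {V : Type*} [Fintype V] {G : SimpleGraph V} {k : ℕ}

/-- The component of a vertex in the graph of low vertices. -/
def lowComp (G : SimpleGraph V) (k : ℕ) (v : V) : (lowGraph G k).ConnectedComponent :=
  (lowGraph G k).connectedComponentMk v

lemma lowComp_eq {u v : V} : lowComp G k u = lowComp G k v ↔ (lowGraph G k).Reachable u v :=
  SimpleGraph.ConnectedComponent.eq

lemma lowComp_eq_of_adj {u v : V} (hu : IsLow G k u) (hv : IsLow G k v) (h : G.Adj u v) :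
    lowComp G k u = lowComp G k v :=
  lowComp_eq.2 (SimpleGraph.Adj.reachable ⟨h, hu, hv⟩)

lemma IsBig.lowComp_eq {K : Finset V} (hK : IsBig G k K) {u v : V} (hu : u ∈ K) (hv : v ∈ K) :
    lowComp G k u = lowComp G k v := by
  by_cases h : u = v
  · rw [h]
  · exact lowComp_eq_of_adj (hK.1 u hu) (hK.1 v hv) (hK.2.1 hu hv h)

variable (hk : 7 ≤ k) (hng : ∀ S : Finset V, S.Nonempty → ¬ Good G k S)
  (hcl : ∀ K : Finset V, G.IsClique (K : Set V) → #K ≠ k)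

include hk hng hcl in
/-- A search order of the components of low vertices from the roots `a`, with the first two
vertices `e K` and `w K` of every big clique, where `w K` minimizes a cost. -/
lemma exists_search [Nonempty V] {𝒯 : Finset (lowGraph G k).ConnectedComponent}
    {a : (lowGraph G k).ConnectedComponent → V} (hlow : ∀ T ∈ 𝒯, IsLow G k (a T))
    (ha : ∀ T ∈ 𝒯, lowComp G k (a T) = T) {val : V → ℕ} (hval : Function.Injective val)
    (c : V → ℕ) :
    ∃ (ord : V → ℕ ×ₗ ℕ) (e w : Finset V → V), Function.Injective ord ∧
      (∀ v, IsLow G k v → lowComp G k v ∈ 𝒯 → v ≠ a (lowComp G k v) →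
        ∃ u, IsLow G k u ∧ G.Adj u v ∧ ord u < ord v) ∧
      ∀ K, IsBig G k K → (∀ v ∈ K, lowComp G k v ∈ 𝒯) →
        e K ∈ K ∧ w K ∈ K ∧ e K ≠ w K ∧
        (e K ≠ a (lowComp G k (e K)) → ∃ u, u ∉ K ∧ IsLow G k u ∧ G.Adj (e K) u ∧
          ord u < ord (e K)) ∧
        ∀ v ∈ K, v ≠ e K → v ≠ a (lowComp G k v) ∧ ord (e K) < ord v ∧
          (v ≠ w K → ord (w K) < ord v) ∧ c (w K) ≤ c v ∧
          ∀ u, u ∉ K → IsLow G k u → G.Adj v u → ord v < ord u := by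
  let d : V → ℕ := fun v => (lowGraph G k).dist (a (lowComp G k v)) v
  have hreach : ∀ v, lowComp G k v ∈ 𝒯 → (lowGraph G k).Reachable (a (lowComp G k v)) v :=
    fun v hv => lowComp_eq.1 (ha _ hv)
  have hentry : ∀ K, IsBig G k K → (∀ v ∈ K, lowComp G k v ∈ 𝒯) → ∃ e ∈ K,
      (e ≠ a (lowComp G k e) → ∃ u, u ∉ K ∧ IsLow G k u ∧ G.Adj e u ∧ d u < d e) ∧
      ∀ v ∈ K, v ≠ e → v ≠ a (lowComp G k v) ∧ d e < d v ∧ d v = d e + 1 ∧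
        ∀ u, u ∉ K → IsLow G k u → G.Adj v u → d v < d u := by
    intro K hK hKT
    obtain ⟨v₀, hv₀⟩ : K.Nonempty := card_pos.1 (by have := hK.2.2; omega)
    have hcc : ∀ v ∈ K, lowComp G k v = lowComp G k v₀ := fun v hv => hK.lowComp_eq hv hv₀
    have hd : ∀ v ∈ K, d v = (lowGraph G k).dist (a (lowComp G k v₀)) v := fun v hv => by
      simp only [d, hcc v hv]
    have hd' : ∀ v ∈ K, ∀ u, IsLow G k u → G.Adj v u →
        d u = (lowGraph G k).dist (a (lowComp G k v₀)) u := fun v hv u hu h => by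
      simp only [d, lowComp_eq_of_adj hu (hK.1 v hv) h.symm, hcc v hv]
    obtain ⟨e, he, h1, h2⟩ := hK.exists_entry hk hng hcl (hlow _ (hKT v₀ hv₀))
      (fun v hv => hcc v hv ▸ hreach v (hKT v hv))
    refine ⟨e, he, fun hea => ?_, fun v hv hve => ?_⟩
    · rw [hcc e he] at hea
      obtain ⟨u, h3, h4, h5, h6⟩ := h1 hea
      exact ⟨u, h3, h4, h5, by rwa [hd' e he u h4 h5, hd e he]⟩
    · obtain ⟨h3, h4, h5, h6⟩ := h2 v hv hve
      rw [hcc v hv, hd v hv, hd e he]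
      exact ⟨h3, h4, h5, fun u huK hu hvu => by
        rw [hd' v hv u hu hvu]
        exact h6 u huK hu hvu⟩
  have hpair : ∀ K, ∃ e w, IsBig G k K → (∀ v ∈ K, lowComp G k v ∈ 𝒯) →
      e ∈ K ∧ w ∈ K ∧ e ≠ w ∧
      (e ≠ a (lowComp G k e) → ∃ u, u ∉ K ∧ IsLow G k u ∧ G.Adj e u ∧ d u < d e) ∧
      ∀ v ∈ K, v ≠ e → v ≠ a (lowComp G k v) ∧ d e < d v ∧ d v = d e + 1 ∧ c w ≤ c v ∧
        ∀ u, u ∉ K → IsLow G k u → G.Adj v u → d v < d u := by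
    intro K
    by_cases hK : IsBig G k K ∧ ∀ v ∈ K, lowComp G k v ∈ 𝒯
    · obtain ⟨e, he, h1, h2⟩ := hentry K hK.1 hK.2
      obtain ⟨w, hw, hmin⟩ := exists_min_image (K.erase e) c (card_pos.1 (by
        rw [card_erase_of_mem he]
        have := hK.1.2.2
        omega))
      refine ⟨e, w, fun _ _ => ⟨he, mem_of_mem_erase hw, (ne_of_mem_erase hw).symm, h1,
        fun v hv hve => ?_⟩⟩
      obtain ⟨h3, h4, h5, h6⟩ := h2 v hv hve
      exact ⟨h3, h4, h5, hmin v (mem_erase.2 ⟨hve, hv⟩), h6⟩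
    · exact ⟨Classical.arbitrary V, Classical.arbitrary V, fun h1 h2 => absurd ⟨h1, h2⟩ hK⟩
  choose e w hew using hpair
  let isW : V → Prop := fun v => ∃ K, IsBig G k K ∧ (∀ v ∈ K, lowComp G k v ∈ 𝒯) ∧ v ∈ K ∧ w K = v
  -- Distances are doubled so that each `w K` can precede the other vertices of its level; `val`
  -- breaks ties.
  let ord : V → ℕ ×ₗ ℕ := fun v => toLex (2 * d v + (if isW v then 0 else 1), val v)
  have hord : ∀ u v, d u < d v → ord u < ord v := by
    intro u v h
    rw [Prod.Lex.toLex_lt_toLex]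
    left
    simp only
    split_ifs <;> omega
  refine ⟨ord, e, w, fun u v h => hval (congrArg (fun x => (ofLex x).2) h), ?_, ?_⟩
  · intro v hv hvT hva
    obtain ⟨u, h1, h2, h3⟩ := exists_parent (hreach v hvT) hva
    refine ⟨u, h1.2.2, h1.1.symm, hord u v ?_⟩
    have : lowComp G k u = lowComp G k v := lowComp_eq_of_adj h1.2.2 h1.2.1 h1.1.symm
    simp only [d, this]
    omega
  · intro K hK hKT
    obtain ⟨h1, h2, h3, h4, h5⟩ := hew K hK hKT
    refine ⟨h1, h2, h3, fun h => ?_, fun v hv hve => ?_⟩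
    · obtain ⟨u, h6, h7, h8, h9⟩ := h4 h
      exact ⟨u, h6, h7, h8, hord _ _ h9⟩
    · obtain ⟨h6, h7, h8, h9, h10⟩ := h5 v hv hve
      refine ⟨h6, hord _ _ h7, fun hvw => ?_, h9, fun u hu hul hvu => hord _ _ (h10 u hu hul hvu)⟩
      have hw := (h5 (w K) h2 h3.symm).2.2.1
      have hW : isW (w K) := ⟨K, hK, hKT, h2, rfl⟩
      have hV : ¬ isW v := by
        rintro ⟨K', hK', hKT', hvK', hwv⟩
        rw [hK'.eq_of_mem hk hng hcl hK hvK' hv] at hwv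
        exact hvw hwv.symm
      rw [Prod.Lex.toLex_lt_toLex]
      left
      simp only [if_pos hW, if_neg hV]
      omega

end Search

/-! ### Orientations of components rooted at vertices of degree k -/

section Rooting

variable {V : Type*} [Fintype V] {G : SimpleGraph V} {k : ℕ}

/-- Data for orienting components of low vertices together with a set `Y` of vertices of degree
`k`: every component `T` has a root `a T` entered from `φ T`. -/
structure Rooting (G : SimpleGraph V) (k : ℕ) (Y : Finset V)
    (𝒯 : Finset (lowGraph G k).ConnectedComponent) (val : V → ℕ)
    (M : (lowGraph G k).ConnectedComponent → ℕ)
    (a φ : (lowGraph G k).ConnectedComponent → V) : Prop where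
  val_injective : Function.Injective val
  val_pos : ∀ v, 0 < val v
  degOn_eq : ∀ y ∈ Y, degOn G univ y = k
  inBig : ∀ T ∈ 𝒯, InBig G k (a T)
  lowComp_root : ∀ T ∈ 𝒯, lowComp G k (a T) = T
  mem : ∀ T ∈ 𝒯, φ T ∈ Y
  adj : ∀ T ∈ 𝒯, G.Adj (a T) (φ T)
  lt_val : ∀ T ∈ 𝒯, M T < val (φ T)
  count : ∀ y ∈ Y, #{T ∈ 𝒯 | φ T = y} + 2 ≤ #{t | InBig G k t ∧ lowComp G k t ∈ 𝒯 ∧ G.Adj t y}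
  val_le : ∀ K, IsBig G k K → (∀ v ∈ K, lowComp G k v ∈ 𝒯) →
    k ≤ #{v ∈ K | ∃ y ∈ Y, G.Adj v y} + 2 →
      ∃ v ∈ K, ∃ y ∈ Y, G.Adj v y ∧ val y ≤ M (lowComp G k v)

variable (hk : 7 ≤ k) (hng : ∀ S : Finset V, S.Nonempty → ¬ Good G k S)
  (hcl : ∀ K : Finset V, G.IsClique (K : Set V) → #K ≠ k)

include hk hng hcl in
-- Arcs between low vertices follow the search order, and arcs inside `Y` go from large to small
-- `val`. Roots are entered from `Y`, other vertices of big cliques point to `Y`, and for the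
-- remaining low vertices the threshold `M` decides. Toggling the big cliques makes this acyclic, so
-- `sigma` is 1, while `count` secures two in-arcs at every vertex of `Y`.
lemma Rooting.good [Nonempty V] {Y : Finset V} {𝒯 : Finset (lowGraph G k).ConnectedComponent} {val : V → ℕ}
    {M : (lowGraph G k).ConnectedComponent → ℕ} {a φ : (lowGraph G k).ConnectedComponent → V}
    (h : Rooting G k Y 𝒯 val M a φ) :
    Good G k {v | v ∈ Y ∨ IsLow G k v ∧ lowComp G k v ∈ 𝒯} := by
  -- A vertex of a big clique has at most one neighbour in `Y`, so its cost is the `val` of that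
  -- neighbour, or 0: `w K` avoids `Y` if it can and otherwise has the lowest neighbour available.
  let c : V → ℕ := fun v => ∑ y ∈ Y with G.Adj v y, val y
  obtain ⟨ord, e, w, hinj, hpar, hK⟩ := exists_search hk hng hcl
    (fun T hT => (h.inBig T hT).isLow) h.lowComp_root h.val_injective c
  set S : Finset V := {v | v ∈ Y ∨ IsLow G k v ∧ lowComp G k v ∈ 𝒯} with hS
  have memS : ∀ v, v ∈ S ↔ v ∈ Y ∨ IsLow G k v ∧ lowComp G k v ∈ 𝒯 := fun v => by simp [hS]
  have hYL : ∀ v, v ∈ Y → ¬ IsLow G k v := by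
    intro v hv hl
    have := h.degOn_eq v hv
    rw [IsLow] at hl
    omega
  have hc : ∀ K, IsBig G k K → ∀ v ∈ K, ∀ y ∈ Y, G.Adj v y → c v = val y := by
    intro K hK v hv y hy hvy
    have : {y ∈ Y | G.Adj v y} = {y} := by
      ext x
      rw [mem_filter, mem_singleton]
      constructor
      · rintro ⟨h1, h2⟩
        exact hK.outer_unique hv (fun h' => hYL x h1 (hK.1 x h')) (fun h' => hYL y hy (hK.1 y h'))
          h2 hvy
      · rintro rfl
        exact ⟨hy, hvy⟩
    simp only [c, this, Finset.sum_singleton]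
  -- the orientation
  let R : V → V → Prop := fun u v =>
    if u ∈ Y then
      if v ∈ Y then val v < val u
      else (InBig G k v ∧ v = a (lowComp G k v)) ∨ (¬ InBig G k v ∧ M (lowComp G k v) < val u)
    else
      if v ∈ Y then
        (InBig G k u ∧ u ≠ a (lowComp G k u)) ∨ (¬ InBig G k u ∧ val v ≤ M (lowComp G k u))
      else ord u < ord v
  have RYY : ∀ u v, u ∈ Y → v ∈ Y → (R u v ↔ val v < val u) := fun u v hu hv => by
    simp only [R, if_pos hu, if_pos hv]
  have RYL : ∀ u v, u ∈ Y → v ∉ Y → (R u v ↔ (InBig G k v ∧ v = a (lowComp G k v)) ∨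
      (¬ InBig G k v ∧ M (lowComp G k v) < val u)) := fun u v hu hv => by
    simp only [R, if_pos hu, if_neg hv]
  have RLY : ∀ u v, u ∉ Y → v ∈ Y → (R u v ↔ (InBig G k u ∧ u ≠ a (lowComp G k u)) ∨
      (¬ InBig G k u ∧ val v ≤ M (lowComp G k u))) := fun u v hu hv => by
    simp only [R, if_neg hu, if_pos hv]
  have RLL : ∀ u v, u ∉ Y → v ∉ Y → (R u v ↔ ord u < ord v) := fun u v hu hv => by
    simp only [R, if_neg hu, if_neg hv]
  have hR : ∀ u v, u ≠ v → (R u v ↔ ¬ R v u) := by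
    intro u v huv
    by_cases hu : u ∈ Y <;> by_cases hv : v ∈ Y
    · rw [RYY u v hu hv, RYY v u hv hu, not_lt]
      exact ⟨fun h => h.le, fun h' => lt_of_le_of_ne h' fun e => huv (h.val_injective e).symm⟩
    · rw [RYL u v hu hv, RLY v u hv hu, ← not_lt]
      tauto
    · rw [RLY u v hu hv, RYL v u hv hu, ← not_lt]
      tauto
    · rw [RLL u v hu hv, RLL v u hv hu, not_lt]
      exact ⟨fun h => h.le, fun h' => lt_of_le_of_ne h' fun e => huv (hinj e)⟩
  let D : Finset (V × V) := {p | G.Adj p.1 p.2 ∧ p.1 ∈ S ∧ p.2 ∈ S ∧ R p.1 p.2}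
  have memD : ∀ u v, (u, v) ∈ D ↔ G.Adj u v ∧ u ∈ S ∧ v ∈ S ∧ R u v := fun u v => by simp [D]
  have hD : OrientsOn G S D := by
    constructor
    · rintro ⟨u, v⟩ hp
      rw [memD] at hp
      exact ⟨hp.1, hp.2.1, hp.2.2.1⟩
    · intro u hu v hv huv
      rw [memD, memD, hR u v huv.ne]
      have := huv.symm
      tauto
  refine ⟨D, hD, ?_, ?_⟩
  · let 𝒦 : Finset (Finset V) := {K | IsBig G k K ∧ ∀ v ∈ K, lowComp G k v ∈ 𝒯}
    have mem𝒦 : ∀ K, K ∈ 𝒦 ↔ IsBig G k K ∧ ∀ v ∈ K, lowComp G k v ∈ 𝒯 := fun K => by simp [𝒦]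
    have hKY : ∀ K ∈ 𝒦, ∀ v ∈ K, v ∉ Y := fun K hK v hv h' =>
      hYL v h' (((mem𝒦 K).1 hK).1.1 v hv)
    have hKS : ∀ K ∈ 𝒦, ∀ v ∈ K, v ∈ S := fun K hK v hv =>
      (memS v).2 (Or.inr ⟨((mem𝒦 K).1 hK).1.1 v hv, ((mem𝒦 K).1 hK).2 v hv⟩)
    have hKB : ∀ K ∈ 𝒦, ∀ v ∈ K, InBig G k v := fun K hK v hv => ⟨K, ((mem𝒦 K).1 hK).1, hv⟩
    have hlow : ∀ v ∈ S, v ∉ Y → IsLow G k v ∧ lowComp G k v ∈ 𝒯 := fun v hv hvY =>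
      ((memS v).1 hv).resolve_left hvY
    have hroot : ∀ K ∈ 𝒦, ∀ v ∈ K, v = a (lowComp G k v) → ∀ x, x ∉ K → G.Adj v x →
        x = φ (lowComp G k v) := by
      intro K hK v hv hva x hx hvx
      obtain ⟨hb, hT⟩ := (mem𝒦 K).1 hK
      have h4 := h.mem _ (hT v hv)
      have h5 := h.adj _ (hT v hv)
      rw [← hva] at h5
      exact hb.outer_unique hv hx (fun h' => hYL _ h4 (hb.1 _ h')) hvx h5
    have hin : ∀ K ∈ 𝒦, ∀ u, (u, e K) ∈ D → u ∉ K := by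
      intro K hKK u hu huK
      obtain ⟨hb, hT⟩ := (mem𝒦 K).1 hKK
      obtain ⟨he, hw, hew, h4, h5⟩ := hK K hb hT
      rw [memD] at hu
      have := (h5 u huK hu.1.ne).2.1
      rw [RLL _ _ (hKY K hKK u huK) (hKY K hKK _ he)] at hu
      exact lt_asymm this hu.2.2.2
    have hinK : ∀ K ∈ 𝒦, ∀ v ∈ K, v ≠ e K → ∀ u, (u, v) ∈ D → u ∈ K ∧ ord u < ord v := by
      intro K hKK v hv hve u hu
      obtain ⟨hb, hT⟩ := (mem𝒦 K).1 hKK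
      obtain ⟨h6, -, -, -, h7⟩ := (hK K hb hT).2.2.2.2 v hv hve
      rw [memD] at hu
      have huY : u ∉ Y := by
        intro huY
        rw [RYL u v huY (hKY K hKK v hv)] at hu
        rcases hu.2.2.2 with h' | h'
        · exact h6 h'.2
        · exact h'.1 (hKB K hKK v hv)
      rw [RLL u v huY (hKY K hKK v hv)] at hu
      refine ⟨?_, hu.2.2.2⟩
      by_contra huK
      exact lt_asymm (h7 u huK (hlow u hu.2.1 huY).1 hu.1.symm) hu.2.2.2
    -- The only outer neighbour of `e K` is its predecessor in the search or, at a root, the value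
    -- of `φ`; in both cases the edge points into `K`.
    have hout : ∀ K ∈ 𝒦, ∀ v, (e K, v) ∈ D → v ∈ K := by
      intro K hKK v hv
      obtain ⟨hb, hT⟩ := (mem𝒦 K).1 hKK
      obtain ⟨he, hw, hew, h4, h5⟩ := hK K hb hT
      rw [memD] at hv
      by_contra hvK
      by_cases hea : e K = a (lowComp G k (e K))
      · have h6 : v ∈ Y := by
          rw [hroot K hKK _ he hea v hvK hv.1]
          exact h.mem _ (hT _ he)
        rw [RLY _ v (hKY K hKK _ he) h6] at hv
        rcases hv.2.2.2 with h' | h'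
        · exact h'.2 hea
        · exact h'.1 (hKB K hKK _ he)
      · obtain ⟨u, hu, hul, huadj, huo⟩ := h4 hea
        have huv := hb.outer_unique he hu hvK huadj hv.1
        subst huv
        rw [RLL _ _ (hKY K hKK _ he) (fun h' => hYL _ h' hul)] at hv
        exact lt_asymm huo hv.2.2.2
    -- If `w K` has a neighbour in `Y`, then by minimal cost so does every vertex of `K` but perhaps
    -- `e K`, and `val_le` applies. Its witness cannot be `e K`, so it bounds the cost of `w K`.
    have hwM : ∀ K ∈ 𝒦, ∀ y ∈ Y, G.Adj (w K) y → val y ≤ M (lowComp G k (w K)) := by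
      intro K hKK y hy hwy
      obtain ⟨hb, hT⟩ := (mem𝒦 K).1 hKK
      obtain ⟨he, hw, hew, h4, h5⟩ := hK K hb hT
      have hcw := hc K hb (w K) hw y hy hwy
      have hall : ∀ v ∈ K, v ≠ e K → ∃ y ∈ Y, G.Adj v y := by
        intro v hv hve
        have h6 := (h5 v hv hve).2.2.2.1
        rw [hcw] at h6
        have h7 : 0 < c v := lt_of_lt_of_le (h.val_pos y) h6
        by_contra hn
        push Not at hn
        have : {y ∈ Y | G.Adj v y} = ∅ := filter_eq_empty_iff.2 hn
        simp only [c, this, Finset.sum_empty, lt_self_iff_false] at h7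
      have hfull : k ≤ #{v ∈ K | ∃ y ∈ Y, G.Adj v y} + 2 := by
        have h6 : K.erase (e K) ⊆ {v ∈ K | ∃ y ∈ Y, G.Adj v y} := fun v hv =>
          mem_filter.2 ⟨mem_of_mem_erase hv, hall v (mem_of_mem_erase hv) (ne_of_mem_erase hv)⟩
        have h7 := card_le_card h6
        rw [card_erase_of_mem he] at h7
        have := hb.2.2
        omega
      obtain ⟨x, hx, z, hz, hxz, hle⟩ := h.val_le K hb hT hfull
      have hxe : x ≠ e K := by
        rintro rfl
        have hzK : z ∉ K := fun h' => hKY K hKK z h' hz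
        by_cases hea : e K = a (lowComp G k (e K))
        · rw [hroot K hKK _ he hea z hzK hxz] at hle
          exact absurd (h.lt_val _ (hT _ he)) (not_lt.2 hle)
        · obtain ⟨u, hu, hul, huadj, -⟩ := h4 hea
          rw [hb.outer_unique he hzK hu hxz huadj] at hz
          exact hYL u hz hul
      have h6 := (h5 x hx hxe).2.2.2.1
      rw [hcw, hc K hb x hx z hz hxz] at h6
      rw [hb.lowComp_eq hw hx]
      exact h6.trans hle
    rw [sigma_toggle_all 𝒦 (fun K => K) e w]
    · let rest : V → Prop := fun v => ∃ K ∈ 𝒦, v ∈ K ∧ v ≠ e K ∧ v ≠ w K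
      let key : V → ℕ := fun v => if v ∈ Y then 2 * val v else 2 * M (lowComp G k v) + 1
      let f : V → ℤ ×ₗ ℕ ×ₗ ℕ := fun v =>
        toLex (if rest v then -(1 + ∑ u, (key u : ℤ)) else -(key v : ℤ), ord v)
      rw [sigma_acyclic f]
      · exact one_ne_zero
      have hkey : ∀ v, (key v : ℤ) < 1 + ∑ u, (key u : ℤ) := by
        intro v
        have := Finset.single_le_sum (f := fun u => (key u : ℤ)) (fun u _ => Nat.cast_nonneg _)
          (mem_univ v)
        omega
      rintro ⟨u, v⟩ hp
      simp only [mem_filter] at hp ⊢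
      obtain ⟨hp, hp'⟩ := hp
      rw [Prod.Lex.toLex_lt_toLex]
      by_cases hv : rest v
      · have hv' := hv
        obtain ⟨K, hKK, hvK, hve, hvw⟩ := hv
        obtain ⟨huK, huv⟩ := hinK K hKK v hvK hve u hp
        have hu : rest u := by
          refine ⟨K, hKK, huK, fun h' => ?_, fun h' => ?_⟩
          · exact (hp' K hKK).1 ⟨h', hvw⟩
          · exact (hp' K hKK).2 ⟨h', hvK, hve⟩
        right
        exact ⟨by simp only [if_pos hv', if_pos hu], huv⟩
      by_cases hu : rest u
      · left
        simp only [if_pos hu, if_neg hv]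
        have := hkey v
        omega
      simp only [if_neg hu, if_neg hv, neg_lt_neg_iff, neg_inj, Nat.cast_lt, Nat.cast_inj]
      have hpD := hp
      rw [memD] at hp
      obtain ⟨huv, huS, hvS, hRuv⟩ := hp
      by_cases huY : u ∈ Y <;> by_cases hvY : v ∈ Y
      · left
        rw [RYY u v huY hvY] at hRuv
        simp only [key, if_pos huY, if_pos hvY]
        omega
      · left
        rw [RYL u v huY hvY] at hRuv
        simp only [key, if_pos huY, if_neg hvY]
        obtain ⟨hvl, hvT⟩ := hlow v hvS hvY
        rcases hRuv with ⟨⟨K, hb, hvK⟩, hva⟩ | ⟨-, h'⟩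
        · have hKK : K ∈ 𝒦 := (mem𝒦 K).2 ⟨hb, fun x hx => hb.lowComp_eq hvK hx ▸ hvT⟩
          rw [hroot K hKK v hvK hva u (fun h' => hKY K hKK u h' huY) huv.symm]
          have := h.lt_val _ hvT
          omega
        · omega
      · left
        rw [RLY u v huY hvY] at hRuv
        simp only [key, if_neg huY, if_pos hvY]
        obtain ⟨hul, huT⟩ := hlow u huS huY
        rcases hRuv with ⟨⟨K, hb, huK⟩, hua⟩ | ⟨-, h'⟩
        · have hKK : K ∈ 𝒦 := (mem𝒦 K).2 ⟨hb, fun x hx => hb.lowComp_eq huK hx ▸ huT⟩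
          by_cases hue : u = e K
          · rw [hue] at hpD
            exact absurd hvY (hKY K hKK v (hout K hKK v hpD))
          · have huw : u = w K := by
              by_contra huw
              exact hu ⟨K, hKK, huK, hue, huw⟩
            rw [huw] at huv ⊢
            have := hwM K hKK v hvY huv
            omega
        · omega
      · right
        rw [RLL u v huY hvY] at hRuv
        simp only [key, if_neg huY, if_neg hvY]
        rw [lowComp_eq_of_adj (hlow u huS huY).1 (hlow v hvS hvY).1 huv]
        exact ⟨rfl, hRuv⟩
    · intro K hKK K' hKK' hne
      rw [Finset.disjoint_left]
      intro v hv hv'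
      exact hne (((mem𝒦 K).1 hKK).1.eq_of_mem hk hng hcl ((mem𝒦 K').1 hKK').1 hv hv')
    · exact fun K hKK => (hK K ((mem𝒦 K).1 hKK).1 ((mem𝒦 K).1 hKK).2).1
    · exact fun K hKK => (hK K ((mem𝒦 K).1 hKK).1 ((mem𝒦 K).1 hKK).2).2.1
    · exact fun K hKK => (hK K ((mem𝒦 K).1 hKK).1 ((mem𝒦 K).1 hKK).2).2.2.1
    · intro v hv
      rw [memD] at hv
      exact hv.1.ne rfl
    · intro K hKK
      obtain ⟨hb, hT⟩ := (mem𝒦 K).1 hKK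
      refine card_le_one.2 ?_
      rintro ⟨u, v⟩ hp ⟨u', v'⟩ hp'
      obtain ⟨hp, rfl⟩ := mem_filter.1 hp
      obtain ⟨hp', hv'⟩ := mem_filter.1 hp'
      simp only at hv'
      subst hv'
      have h1 := hin K hKK u hp
      have h2 := hin K hKK u' hp'
      rw [memD] at hp hp'
      rw [hb.outer_unique (hK K hb hT).1 h1 h2 hp.1.symm hp'.1.symm]
    · rintro K hKK ⟨u, v⟩ hp rfl
      obtain ⟨hb, hT⟩ := (mem𝒦 K).1 hKK
      obtain ⟨he, hw, hew, h4, h5⟩ := hK K hb hT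
      obtain ⟨huK, huw⟩ := hinK K hKK (w K) hw hew.symm u hp
      by_contra hue
      have hne : u ≠ w K := by
        rintro rfl
        exact lt_irrefl _ huw
      exact lt_asymm huw ((h5 u huK hue).2.2.1 hne)
    · intro K hKK v
      obtain ⟨hb, hT⟩ := (mem𝒦 K).1 hKK
      obtain ⟨he, hw, hew, h4, h5⟩ := hK K hb hT
      constructor
      · intro hv
        refine ⟨hout K hKK v hv, ?_⟩
        rw [memD] at hv
        exact hv.1.ne'
      · rintro ⟨hv, hve⟩
        rw [memD, RLL _ _ (hKY K hKK _ he) (hKY K hKK v hv)]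
        exact ⟨hb.2.1 he hv hve.symm, hKS K hKK _ he, hKS K hKK v hv, (h5 v hv hve).2.1⟩
    · intro K hKK v hv hve hvw
      obtain ⟨hb, hT⟩ := (mem𝒦 K).1 hKK
      obtain ⟨he, hw, hew, h4, h5⟩ := hK K hb hT
      rw [memD, RLL _ _ (hKY K hKK _ hw) (hKY K hKK v hv)]
      exact ⟨hb.2.1 hw hv hvw.symm, hKS K hKK _ hw, hKS K hKK v hv, (h5 v hv hve).2.2.1 hvw⟩
  · have hcard : ∀ v, #{u | (u, v) ∈ D} ≤ #{p ∈ D | p.2 = v} := by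
      intro v
      refine card_le_card_of_injOn (fun u => (u, v)) ?_ ?_
      · intro u hu
        have hu := mem_filter.1 (mem_coe.1 hu)
        exact mem_coe.2 (mem_filter.2 ⟨hu.2, rfl⟩)
      · intro u _ u' _ h'
        exact (Prod.mk.inj h').1
    intro v hv
    refine le_trans ?_ (Nat.add_le_add_left (hcard v) k)
    rcases (memS v).1 hv with hvY | ⟨hvl, hvT⟩
    · rw [h.degOn_eq v hvY, Nat.add_le_add_iff_left]
      have h1 := h.count v hvY
      -- Every edge between `v` and a big clique of these components is an in-arc at `v`, unless it
      -- leads to a root entered from `v`.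
      have h2 : #{t | InBig G k t ∧ lowComp G k t ∈ 𝒯 ∧ G.Adj t v} ≤
          #{u | (u, v) ∈ D} + #{T ∈ 𝒯 | φ T = v} := by
        have h3 : ({t | InBig G k t ∧ lowComp G k t ∈ 𝒯 ∧ G.Adj t v} : Finset V) ⊆
            ({u | (u, v) ∈ D} : Finset V) ∪ ({T ∈ 𝒯 | φ T = v} : Finset _).image a := by
          intro t ht
          simp only [mem_filter, mem_univ, true_and] at ht
          obtain ⟨ht1, ht2, ht3⟩ := ht
          rw [mem_union]
          by_cases hta : t = a (lowComp G k t)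
          · right
            refine mem_image.2 ⟨_, mem_filter.2 ⟨ht2, ?_⟩, hta.symm⟩
            obtain ⟨K, hK, htK⟩ := ht1
            have h4 := h.mem _ ht2
            have h5 := h.adj _ ht2
            rw [← hta] at h5
            exact hK.outer_unique htK (fun h' => hYL _ h4 (hK.1 _ h'))
              (fun h' => hYL _ hvY (hK.1 _ h')) h5 ht3
          · left
            rw [mem_filter, memD, RLY t v (fun h' => hYL t h' ht1.isLow) hvY]
            exact ⟨mem_univ _, ht3, (memS t).2 (Or.inr ⟨ht1.isLow, ht2⟩), hv, Or.inl ⟨ht1, hta⟩⟩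
        refine (card_le_card h3).trans ((card_union_le _ _).trans ?_)
        exact Nat.add_le_add_left card_image_le _
      omega
    · have h1 : 0 < #{u | (u, v) ∈ D} := by
        refine card_pos.2 ?_
        by_cases hva : v = a (lowComp G k v)
        · have h2 := h.mem _ hvT
          refine ⟨φ (lowComp G k v), mem_filter.2 ⟨mem_univ _, ?_⟩⟩
          rw [memD, RYL _ v h2 (fun h' => hYL v h' hvl)]
          refine ⟨?_, (memS _).2 (Or.inl h2), hv, Or.inl ⟨?_, hva⟩⟩
          · have := (h.adj _ hvT).symm
            rwa [← hva] at this
          · have := h.inBig _ hvT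
            rwa [← hva] at this
        · obtain ⟨u, h2, h3, h4⟩ := hpar v hvl hvT hva
          refine ⟨u, mem_filter.2 ⟨mem_univ _, ?_⟩⟩
          rw [memD, RLL u v (fun h' => hYL u h' h2) (fun h' => hYL v h' hvl)]
          exact ⟨h3, (memS u).2 (Or.inr ⟨h2, by rwa [lowComp_eq_of_adj h2 hvl h3]⟩), hv, h4⟩
      rw [IsLow] at hvl
      omega

end Rooting

/-! ### Edges between big cliques and vertices of degree k -/

section Core

variable {V : Type*} [Fintype V] {G : SimpleGraph V} {k : ℕ}
  (hk : 7 ≤ k) (hng : ∀ S : Finset V, S.Nonempty → ¬ Good G k S)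
  (hcl : ∀ K : Finset V, G.IsClique (K : Set V) → #K ≠ k)

include hk hng hcl in
/-- If a component meets big cliques with almost all vertices adjacent to `Y`, one may choose three
edges to `Y` above a threshold which each of these cliques reaches. -/
lemma exists_threshold {Y : Finset V} (hY : ∀ y ∈ Y, degOn G univ y = k) {val : V → ℕ}
    (hval : Function.Injective val) (hpos : ∀ v, 0 < val v) {C : Finset V}
    (h3 : 3 ≤ #{p : V × V | InBig G k p.1 ∧ p.1 ∈ C ∧ p.2 ∈ Y ∧ G.Adj p.1 p.2}) :
    ∃ (M : ℕ) (A : Finset (V × V)),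
      (∀ p ∈ A, InBig G k p.1 ∧ p.1 ∈ C ∧ p.2 ∈ Y ∧ G.Adj p.1 p.2 ∧ M < val p.2) ∧ 3 ≤ #A ∧
      ∀ K, IsBig G k K → K ⊆ C → k ≤ #{v ∈ K | ∃ y ∈ Y, G.Adj v y} + 2 →
        ∃ v ∈ K, ∃ y ∈ Y, G.Adj v y ∧ val y ≤ M := by
  let full : Finset (Finset V) :=
    {K | IsBig G k K ∧ K ⊆ C ∧ k ≤ #{v ∈ K | ∃ y ∈ Y, G.Adj v y} + 2}
  have memfull : ∀ K, K ∈ full ↔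
      IsBig G k K ∧ K ⊆ C ∧ k ≤ #{v ∈ K | ∃ y ∈ Y, G.Adj v y} + 2 := fun K => by simp [full]
  by_cases hne : full.Nonempty
  swap
  · refine ⟨0, univ.filter fun p => InBig G k p.1 ∧ p.1 ∈ C ∧ p.2 ∈ Y ∧ G.Adj p.1 p.2, ?_, h3, ?_⟩
    · intro p hp
      simp only [mem_filter, mem_univ, true_and] at hp
      exact ⟨hp.1, hp.2.1, hp.2.2.1, hp.2.2.2, hpos _⟩
    · intro K h1 h2 h4
      exact absurd ⟨K, (memfull K).2 ⟨h1, h2, h4⟩⟩ hne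
  -- The edges from `K` to `Y`. The threshold is the least `val` on `X K`, maximized over the
  -- cliques in `full`, so each of these cliques has an edge at or below it.
  let X : Finset V → Finset (V × V) := fun K => {p | p.1 ∈ K ∧ p.2 ∈ Y ∧ G.Adj p.1 p.2}
  have memX : ∀ K p, p ∈ X K ↔ p.1 ∈ K ∧ p.2 ∈ Y ∧ G.Adj p.1 p.2 := fun K p => by simp [X]
  have hX : ∀ K ∈ full, k ≤ #(X K) + 2 := by
    intro K hK
    refine ((memfull K).1 hK).2.2.trans (Nat.add_le_add_right ?_ 2)
    refine (card_le_card ?_).trans (card_image_le (s := X K) (f := Prod.fst))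
    intro v hv
    obtain ⟨h1, y, h2, h4⟩ := mem_filter.1 hv
    exact mem_image.2 ⟨(v, y), (memX K _).2 ⟨h1, h2, h4⟩, rfl⟩
  have hmin : ∀ K, ∃ m, K ∈ full → (∃ p ∈ X K, val p.2 = m) ∧ ∀ p ∈ X K, m ≤ val p.2 := by
    intro K
    by_cases hK : K ∈ full
    · obtain ⟨p, hp, h⟩ := exists_min_image (X K) (fun p => val p.2) (card_pos.1 (by
        have := hX K hK
        omega))
      exact ⟨val p.2, fun _ => ⟨⟨p, hp, rfl⟩, h⟩⟩
    · exact ⟨0, fun h => absurd h hK⟩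
  choose m hm using hmin
  obtain ⟨K, hK, hmax⟩ := exists_max_image full m hne
  obtain ⟨⟨p₀, hp₀, hpm⟩, hle⟩ := hm K hK
  obtain ⟨hb, hKC, -⟩ := (memfull K).1 hK
  have hKY : ∀ v ∈ K, v ∉ Y := by
    intro v hv hvY
    have h1 := hb.1 v hv
    have h2 := hY v hvY
    rw [IsLow] at h1
    omega
  refine ⟨m K, {p ∈ X K | m K < val p.2}, ?_, ?_, ?_⟩
  · intro p hp
    obtain ⟨hp, hlt⟩ := mem_filter.1 hp
    obtain ⟨h1, h2, h4⟩ := (memX K p).1 hp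
    exact ⟨⟨K, hb, h1⟩, hKC h1, h2, h4, hlt⟩
  · have h1 := hX K hK
    have h2 := card_filter_add_card_filter_not (s := X K) (fun p => m K < val p.2)
    -- By injectivity of `val`, the edges of `X K` not above the threshold all end at one vertex of
    -- degree `k`, which has at most two neighbours in `K`.
    have h4 : #{p ∈ X K | ¬ m K < val p.2} ≤ degOn G K p₀.2 := by
      refine card_le_card_of_injOn Prod.fst ?_ ?_
      · intro p hp
        obtain ⟨hp, hlt⟩ := mem_filter.1 (mem_coe.1 hp)
        have := hval ((le_antisymm (not_lt.1 hlt) (hle p hp)).trans hpm.symm)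
        obtain ⟨h5, h6, h7⟩ := (memX K p).1 hp
        exact mem_coe.2 (mem_filter.2 ⟨h5, this ▸ h7.symm⟩)
      · intro p hp q hq hpq
        obtain ⟨hp, hlt⟩ := mem_filter.1 (mem_coe.1 hp)
        obtain ⟨hq, hlt'⟩ := mem_filter.1 (mem_coe.1 hq)
        have e1 := le_antisymm (not_lt.1 hlt) (hle p hp)
        have e2 := le_antisymm (not_lt.1 hlt') (hle q hq)
        exact Prod.ext hpq (hval (e1.trans e2.symm))
    have h5 : degOn G K p₀.2 ≤ 2 := by
      have hy := ((memX K p₀).1 hp₀).2.1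
      obtain ⟨u, hu, hnadj⟩ := hb.exists_not_adj hcl (fun h => hKY _ h hy)
      exact degOn_clique_le_two hng hb.1 hb.2.1 (hY _ hy) (fun h => hKY _ h hy) hu hnadj
    -- From at least `k - 2` edges at most two are dropped; `k ≥ 7` leaves three.
    omega
  · intro K' h1 h2 h4
    have hK' := (memfull K').2 ⟨h1, h2, h4⟩
    obtain ⟨⟨p, hp, hpm'⟩, -⟩ := hm K' hK'
    obtain ⟨h5, h6, h7⟩ := (memX K' p).1 hp
    exact ⟨p.1, h5, p.2, h6, h7, hpm' ▸ hmax K' hK'⟩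

include hk hng hcl in
/-- The edges between big cliques and vertices of degree `k` have a component or a vertex meeting
at most two of them. -/
lemma not_three_le_fibres {F : Finset (V × V)} (hne : F.Nonempty)
    (hF : ∀ p ∈ F, InBig G k p.1 ∧ degOn G univ p.2 = k ∧ G.Adj p.1 p.2)
    (hT : ∀ p ∈ F, 3 ≤ #{q ∈ F | lowComp G k q.1 = lowComp G k p.1})
    (hy : ∀ p ∈ F, 3 ≤ #{q ∈ F | q.2 = p.2}) : False := by
  obtain ⟨p₀, hp₀⟩ := hne
  have : Nonempty V := ⟨p₀.1⟩
  let Y : Finset V := F.image Prod.snd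
  let 𝒯 : Finset (lowGraph G k).ConnectedComponent := F.image fun p => lowComp G k p.1
  let val : V → ℕ := fun v => (Fintype.equivFin V v : ℕ) + 1
  have hval : Function.Injective val := fun u v h =>
    (Fintype.equivFin V).injective (Fin.ext (Nat.succ_injective h))
  have hY : ∀ y ∈ Y, degOn G univ y = k := by
    intro y hy'
    obtain ⟨p, hp, rfl⟩ := mem_image.1 hy'
    exact (hF p hp).2.1
  -- All edges from big cliques of these components to `Y`, not just those in `F`: root edges are
  -- chosen and in-arcs are counted among these.
  let E : Finset (V × V) := {p | InBig G k p.1 ∧ lowComp G k p.1 ∈ 𝒯 ∧ p.2 ∈ Y ∧ G.Adj p.1 p.2}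
  have memE : ∀ p, p ∈ E ↔ InBig G k p.1 ∧ lowComp G k p.1 ∈ 𝒯 ∧ p.2 ∈ Y ∧ G.Adj p.1 p.2 :=
    fun p => by simp [E]
  have hFE : F ⊆ E := fun p hp => (memE p).2
    ⟨(hF p hp).1, mem_image_of_mem _ hp, mem_image_of_mem _ hp, (hF p hp).2.2⟩
  have hthr : ∀ T : (lowGraph G k).ConnectedComponent, ∃ (M : ℕ) (A : Finset (V × V)), T ∈ 𝒯 →
      (∀ p ∈ A, InBig G k p.1 ∧ lowComp G k p.1 = T ∧ p.2 ∈ Y ∧ G.Adj p.1 p.2 ∧ M < val p.2) ∧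
      3 ≤ #A ∧ ∀ K, IsBig G k K → (∀ v ∈ K, lowComp G k v = T) →
        k ≤ #{v ∈ K | ∃ y ∈ Y, G.Adj v y} + 2 → ∃ v ∈ K, ∃ y ∈ Y, G.Adj v y ∧ val y ≤ M := by
    intro T
    by_cases hTT : T ∈ 𝒯
    swap
    · exact ⟨0, ∅, fun h => absurd h hTT⟩
    obtain ⟨p, hp, hpT⟩ := mem_image.1 hTT
    obtain ⟨M, A, h1, h2, h3⟩ := exists_threshold hk hng hcl hY hval (fun v => Nat.succ_pos _)
      (C := {v | lowComp G k v = T}) (by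
        refine (hT p hp).trans (card_le_card fun q hq => ?_)
        obtain ⟨hq, hq'⟩ := mem_filter.1 hq
        have := hF q hq
        simp only [mem_filter, mem_univ, true_and]
        exact ⟨this.1, hq'.trans hpT, mem_image_of_mem _ hq, this.2.2⟩)
    refine ⟨M, A, fun _ => ⟨fun q hq => ?_, h2, fun K hK hKT => ?_⟩⟩
    · have := h1 q hq
      simpa using this
    · exact h3 K hK fun v hv => by simpa using hKT v hv
  choose M A hMA using hthr
  -- Each component receives one root edge above its threshold, and each vertex of `Y` keeps at
  -- least two edges that are not root edges.
  obtain ⟨g, hgA, hg⟩ := exists_choice 𝒯 E A Prod.snd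
    (fun T hT' p hp => by
      obtain ⟨h1, h2, h3, h4, -⟩ := (hMA T hT').1 p hp
      exact (memE p).2 ⟨h1, h2 ▸ hT', h3, h4⟩)
    (fun T hT' T' hT'' hne => by
      rw [Finset.disjoint_left]
      intro p hp hp'
      exact hne (((hMA T hT').1 p hp).2.1.symm.trans ((hMA T' hT'').1 p hp').2.1))
    (fun T hT' => (hMA T hT').2.1)
    (fun p hp => by
      obtain ⟨q, hq, hqp⟩ := mem_image.1 ((memE p).1 hp).2.2.1
      rw [← hqp]
      exact (hy q hq).trans (card_le_card (filter_subset_filter _ hFE)))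
  have hroot : Rooting G k Y 𝒯 val M (fun T => (g T).1) (fun T => (g T).2) :=
    { val_injective := hval
      val_pos := fun v => Nat.succ_pos _
      degOn_eq := hY
      inBig := fun T hT' => ((hMA T hT').1 _ (hgA T hT')).1
      lowComp_root := fun T hT' => ((hMA T hT').1 _ (hgA T hT')).2.1
      mem := fun T hT' => ((hMA T hT').1 _ (hgA T hT')).2.2.1
      adj := fun T hT' => ((hMA T hT').1 _ (hgA T hT')).2.2.2.1
      lt_val := fun T hT' => ((hMA T hT').1 _ (hgA T hT')).2.2.2.2
      count := by
        intro y hy'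
        obtain ⟨p, hp, rfl⟩ := mem_image.1 hy'
        refine (hg p (hFE hp)).trans (card_le_card_of_injOn Prod.fst ?_ ?_)
        · intro q hq
          obtain ⟨hq, hqp⟩ := mem_filter.1 (mem_coe.1 hq)
          obtain ⟨h1, h2, -, h4⟩ := (memE q).1 hq
          exact mem_coe.2 (mem_filter.2 ⟨mem_univ _, h1, h2, hqp ▸ h4⟩)
        · intro q hq q' hq' h
          exact Prod.ext h ((mem_filter.1 (mem_coe.1 hq)).2.trans
            (mem_filter.1 (mem_coe.1 hq')).2.symm)
      val_le := by
        intro K hK hKT hfull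
        obtain ⟨v₀, hv₀⟩ : K.Nonempty := card_pos.1 (by have := hK.2.2; omega)
        obtain ⟨v, hv, y, hy', h1, h2⟩ := (hMA _ (hKT v₀ hv₀)).2.2 K hK
          (fun v hv => hK.lowComp_eq hv hv₀) hfull
        exact ⟨v, hv, y, hy', h1, by rwa [hK.lowComp_eq hv hv₀]⟩ }
  refine hng _ ⟨p₀.2, ?_⟩ (hroot.good hk hng hcl)
  rw [mem_filter]
  exact ⟨mem_univ _, Or.inl (mem_image_of_mem _ hp₀)⟩

end Core

/-! ### Splitting a degenerate set of edges -/

section Degeneracy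

/-- A two-coloured degeneracy order yields a partition with small fibres. -/
lemma exists_subset_fibres_le {α β γ : Type*} [DecidableEq γ] (f : γ → α) (g : γ → β) (m : ℕ) {E : Finset γ}
    (h : ∀ F ⊆ E, F.Nonempty → ∃ p ∈ F, #{q ∈ F | f q = f p} ≤ m ∨ #{q ∈ F | g q = g p} ≤ m) :
    ∃ P ⊆ E, (∀ a, #{q ∈ E \ P | f q = a} ≤ m) ∧ ∀ b, #{q ∈ P | g q = b} ≤ m := by
  induction hn : #E using Nat.strong_induction_on generalizing E with
  | _ n ih =>
  subst hn
  rcases E.eq_empty_or_nonempty with rfl | hne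
  · exact ⟨∅, by simp, by simp, by simp⟩
  -- A small class of `f` stays outside `P`, a small class of `g` goes into `P`, and induction
  -- splits what remains.
  obtain ⟨p, hp, hp' | hp'⟩ := h E Subset.rfl hne
  · have hlt : #{q ∈ E | f q ≠ f p} < #E :=
      card_lt_card (filter_ssubset.2 ⟨p, hp, fun h => h rfl⟩)
    obtain ⟨P, hPE, h1, h2⟩ := ih _ hlt
      (fun F hF hne => h F (hF.trans (filter_subset _ _)) hne) rfl
    refine ⟨P, hPE.trans (filter_subset _ _), fun a => ?_, h2⟩
    by_cases ha : a = f p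
    · subst ha
      exact (card_le_card (filter_subset_filter _ sdiff_subset)).trans hp'
    · refine (card_le_card fun q hq => ?_).trans (h1 a)
      rw [mem_filter, mem_sdiff] at hq
      rw [mem_filter, mem_sdiff, mem_filter]
      exact ⟨⟨⟨hq.1.1, fun h => ha (hq.2.symm.trans h)⟩, hq.1.2⟩, hq.2⟩
  · have hlt : #{q ∈ E | g q ≠ g p} < #E :=
      card_lt_card (filter_ssubset.2 ⟨p, hp, fun h => h rfl⟩)
    obtain ⟨P, hPE, h1, h2⟩ := ih _ hlt
      (fun F hF hne => h F (hF.trans (filter_subset _ _)) hne) rfl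
    refine ⟨P ∪ {q ∈ E | g q = g p}, union_subset (hPE.trans (filter_subset _ _))
      (filter_subset _ _), fun a => (card_le_card fun q hq => ?_).trans (h1 a), fun b => ?_⟩
    · rw [mem_filter, mem_sdiff, mem_union, mem_filter] at hq
      rw [mem_filter, mem_sdiff, mem_filter]
      tauto
    · by_cases hb : b = g p
      · subst hb
        refine (card_le_card fun q hq => ?_).trans hp'
        rw [mem_filter, mem_union] at hq
        rcases hq with ⟨hq | hq, hq'⟩
        · exact absurd hq' (mem_filter.1 (hPE hq)).2
        · exact hq
      · refine (card_le_card fun q hq => ?_).trans (h2 b)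
        rw [mem_filter, mem_union, mem_filter] at hq
        rw [mem_filter]
        refine ⟨hq.1.resolve_right fun h => hb (hq.2.symm.trans h.2), hq.2⟩

end Degeneracy

/-! ### Discharging -/

section Discharging

variable {V : Type*} [Fintype V] {G : SimpleGraph V} {k : ℕ}

/-- A vertex of degree at most `k - 2` would be good by itself, with no arcs. -/
lemma le_degOn (hng : ∀ S : Finset V, S.Nonempty → ¬ Good G k S) (v : V) :
    k ≤ degOn G univ v + 1 := by
  by_contra hn
  refine hng {v} (singleton_nonempty v) ⟨∅, ⟨by simp, ?_⟩, ?_, ?_⟩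
  · intro u hu w hw huw
    rw [mem_singleton] at hu hw
    exact absurd (hu.trans hw.symm) huw.ne
  · rw [sigma_acyclic (fun _ => (0 : ℕ)) (by simp)]
    exact one_ne_zero
  · intro u hu
    rw [mem_singleton] at hu
    subst hu
    simp only [filter_empty, card_empty]
    omega

variable (hk : 7 ≤ k) (hng : ∀ S : Finset V, S.Nonempty → ¬ Good G k S)
  (hcl : ∀ K : Finset V, G.IsClique (K : Set V) → #K ≠ k)

/-- The edges between big cliques and vertices of degree `k`. -/
noncomputable def bigEdges (G : SimpleGraph V) (k : ℕ) : Finset (V × V) :=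
  {p | InBig G k p.1 ∧ degOn G univ p.2 = k ∧ G.Adj p.1 p.2}

lemma mem_bigEdges {p : V × V} :
    p ∈ bigEdges G k ↔ InBig G k p.1 ∧ degOn G univ p.2 = k ∧ G.Adj p.1 p.2 := by
  simp [bigEdges]

include hk hng hcl in
lemma exists_paid : ∃ P ⊆ bigEdges G k,
    (∀ T, #{q ∈ bigEdges G k \ P | lowComp G k q.1 = T} ≤ 2) ∧ ∀ y, #{q ∈ P | q.2 = y} ≤ 2 := by
  refine exists_subset_fibres_le (fun p : V × V => lowComp G k p.1) Prod.snd 2 ?_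
  intro F hF hne
  by_contra hn
  push Not at hn
  exact not_three_le_fibres hk hng hcl hne (fun p hp => mem_bigEdges.1 (hF hp))
    (fun p hp => (hn p hp).1) (fun p hp => (hn p hp).2)

variable {ε γ δ : ℝ}

/-- The charge sent along an edge from a high vertex to a low vertex. -/
noncomputable def pay (G : SimpleGraph V) (k : ℕ) (ε γ : ℝ) (P : Finset (V × V)) (p : V × V) : ℝ :=
  wt G k ε γ p.1 - if p ∈ bigEdges G k \ P then γ else 0

include hk hng hcl in
/-- The low vertices collect enough charge. -/
lemma le_sum_pay {P : Finset (V × V)}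
    (hP : ∀ T, #{q ∈ bigEdges G k \ P | lowComp G k q.1 = T} ≤ 2)
    (hε : 0 ≤ ε) (hεγ : ε ≤ γ) (hγδ : γ * (k - 3) = δ * (k - 1))
    (h0 : γ + ε ≤ ε * (k - 1) - δ) (h1 : δ ≤ ε * (k - 5))
    (h2 : δ ≤ 2 * ε) (h3 : 4 * ε ≤ (k - 2) * (2 * ε - δ)) (h4 : γ ≤ 3 * ε) :
    δ * #(lowSet G k) ≤
      ∑ t ∈ lowSet G k, ∑ y ∈ univ \ lowSet G k with G.Adj t y, pay G k ε γ P (t, y) := by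
  set L := lowSet G k with hL
  have hγ : 0 ≤ γ := hε.trans hεγ
  have hpay : ∀ t ∈ L, ∑ y ∈ univ \ L with G.Adj t y, pay G k ε γ P (t, y) =
      wt G k ε γ t * (k - 1 - degOn G L t) - γ * #{q ∈ bigEdges G k \ P | q.1 = t} := by
    intro t ht
    have hd : (degOn G L t : ℝ) + degOn G (univ \ L) t = k - 1 := by
      have h5 := mem_lowSet.1 ht
      rw [IsLow, ← union_sdiff_of_subset (subset_univ L), degOn_union _ disjoint_sdiff] at h5
      rw [← h5]
      push_cast
      ring
    simp only [pay]
    rw [Finset.sum_sub_distrib, Finset.sum_const, nsmul_eq_mul, ← hd, ← Finset.sum_filter,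
      Finset.sum_const, nsmul_eq_mul]
    have h5 : #{y ∈ {y ∈ univ \ L | G.Adj t y} | (t, y) ∈ bigEdges G k \ P} =
        #{q ∈ bigEdges G k \ P | q.1 = t} := by
      refine card_bij (fun y _ => (t, y)) ?_ ?_ ?_
      · intro y hy
        exact mem_filter.2 ⟨(mem_filter.1 hy).2, rfl⟩
      · intro y _ y' _ h
        exact (Prod.mk.inj h).2
      · rintro ⟨x, y⟩ hq
        obtain ⟨hq', rfl⟩ := mem_filter.1 hq
        refine ⟨y, ?_, rfl⟩
        obtain ⟨-, h6, h7⟩ := mem_bigEdges.1 (mem_sdiff.1 hq').1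
        rw [mem_filter, mem_filter, mem_sdiff]
        refine ⟨⟨⟨mem_univ _, fun h => ?_⟩, h7⟩, hq'⟩
        have := mem_lowSet.1 h
        rw [IsLow] at this
        simp only at h6
        omega
    rw [h5]
    change (degOn G (univ \ L) t : ℝ) * _ - _ = _
    ring
  rw [Finset.sum_congr rfl hpay]
  suffices h : 0 ≤ ∑ t ∈ L, (wt G k ε γ t * (k - 1 - degOn G L t) - δ -
      γ * #{q ∈ bigEdges G k \ P | q.1 = t}) by
    have e : ∑ t ∈ L, (wt G k ε γ t * (k - 1 - degOn G L t) - δ -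
        γ * #{q ∈ bigEdges G k \ P | q.1 = t}) = ∑ t ∈ L, (wt G k ε γ t * (k - 1 - degOn G L t) -
        γ * #{q ∈ bigEdges G k \ P | q.1 = t}) - δ * #L := by
      rw [mul_comm δ, ← nsmul_eq_mul, ← Finset.sum_const, ← Finset.sum_sub_distrib]
      exact Finset.sum_congr rfl fun t _ => by ring
    linarith
  rw [← Finset.sum_fiberwise_of_maps_to (g := lowComp G k) (t := L.image (lowComp G k))
    fun t ht => mem_image_of_mem _ ht]
  refine Finset.sum_nonneg fun T hT => ?_
  obtain ⟨t₀, ht₀, hT₀⟩ := mem_image.1 hT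
  set S := {t ∈ L | lowComp G k t = T} with hS
  have hSne : S.Nonempty := ⟨t₀, mem_filter.2 ⟨ht₀, hT₀⟩⟩
  have hSlow : ∀ t ∈ S, IsLow G k t := fun t ht => mem_lowSet.1 (mem_filter.1 ht).1
  have hdeg : ∀ t ∈ S, degOn G L t = degOn G S t := by
    intro t ht
    rw [degOn, degOn]
    congr 1
    ext u
    rw [mem_filter, mem_filter, hS, mem_filter]
    constructor
    · rintro ⟨h5, h6⟩
      refine ⟨⟨h5, ?_⟩, h6⟩
      rw [← (mem_filter.1 ht).2]
      exact lowComp_eq_of_adj (mem_lowSet.1 h5) (hSlow t ht) h6.symm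
    · rintro ⟨h5, h6⟩
      exact ⟨h5.1, h6⟩
  have hpsi := le_psi hk hng hcl hε hεγ hγδ h0 h1 h2 h3 h4 hSne hSlow (by
    intro K hK v hv hvS u hu
    refine mem_filter.2 ⟨hK.subset_lowSet hu, ?_⟩
    rw [hK.lowComp_eq hu hv]
    exact (mem_filter.1 hvS).2)
  have hsum : ∑ t ∈ S, (wt G k ε γ t * (k - 1 - degOn G L t) - δ -
      γ * #{q ∈ bigEdges G k \ P | q.1 = t}) =
      psi G k ε γ δ S - γ * #{q ∈ bigEdges G k \ P | lowComp G k q.1 = T} := by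
    rw [Finset.sum_sub_distrib, ← Finset.mul_sum, psi,
      Finset.sum_congr rfl fun t ht => by rw [hdeg t ht]]
    congr 2
    rw [← Nat.cast_sum, Nat.cast_inj, card_eq_sum_card_fiberwise (f := Prod.fst) (t := S)]
    · refine Finset.sum_congr rfl fun t ht => ?_
      congr 1
      ext q
      rw [mem_filter, mem_filter, mem_filter]
      constructor
      · rintro ⟨h5, rfl⟩
        exact ⟨⟨h5, (mem_filter.1 ht).2⟩, rfl⟩
      · rintro ⟨h5, h6⟩
        exact ⟨h5.1, h6⟩
    · intro q hq
      obtain ⟨h5, h6⟩ := mem_filter.1 (mem_coe.1 hq)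
      exact mem_coe.2 (mem_filter.2
        ⟨mem_lowSet.2 (mem_bigEdges.1 (mem_sdiff.1 h5).1).1.isLow, h6⟩)
  rw [hsum]
  -- A component containing a big clique has surplus `2 γ`, enough for its at most two unpaid edges;
  -- other components have no unpaid edges.
  by_cases hb : ∃ v ∈ S, InBig G k v
  · have h5 := hpsi.2 hb
    have h6 : (#{q ∈ bigEdges G k \ P | lowComp G k q.1 = T} : ℝ) ≤ 2 := by exact_mod_cast hP T
    nlinarith
  · have h6 : {q ∈ bigEdges G k \ P | lowComp G k q.1 = T} = ∅ := by
      rw [filter_eq_empty_iff]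
      intro q hq h7
      have h8 := (mem_bigEdges.1 (mem_sdiff.1 hq).1).1
      exact hb ⟨q.1, mem_filter.2 ⟨mem_lowSet.2 h8.isLow, h7⟩, h8⟩
    rw [h6, card_empty]
    have := hpsi.1
    push_cast
    linarith

/-- A high vertex can afford the charge it sends. -/
lemma sum_pay_le {P : Finset (V × V)} (hP : ∀ y, #{q ∈ P | q.2 = y} ≤ 2)
    (hε : 0 ≤ ε) (hεγ : ε ≤ γ) (h5 : 2 * γ + (k - 2) * ε = 1 - δ) (h6 : (k + 1) * γ + δ ≤ 2)
    (hγ1 : γ ≤ 1) {y : V} (hy : k ≤ degOn G univ y) :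
    ∑ t ∈ lowSet G k with G.Adj y t, pay G k ε γ P (t, y) ≤ degOn G univ y - (k - 1) - δ := by
  have hγ : 0 ≤ γ := hε.trans hεγ
  set N := {t ∈ lowSet G k | G.Adj y t} with hN
  have hNd : #N ≤ degOn G univ y := degOn_mono G (subset_univ _) y
  -- A vertex of degree `k` sends `γ` at most twice and otherwise at most `ε`, which `h5` balances
  -- against its charge 1. From degree `k + 1` on it can send `γ` along every edge, by `h6` and `γ ≤
  -- 1`.
  rcases hy.eq_or_lt with hyk | hyk
  · have hle : ∀ t ∈ N, pay G k ε γ P (t, y) ≤ ε + if (t, y) ∈ P then γ - ε else 0 := by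
      intro t ht
      by_cases htP : (t, y) ∈ P
      · rw [pay, if_pos htP, if_neg (fun h => (mem_sdiff.1 h).2 htP), wt]
        simp only
        split_ifs <;> linarith
      · rw [if_neg htP, pay, wt]
        simp only
        split_ifs with h7 h8 h8
        · linarith
        · exact absurd (mem_sdiff.2 ⟨mem_bigEdges.2 ⟨h7, hyk.symm, (mem_filter.1 ht).2.symm⟩, htP⟩) h8
        · linarith
        · linarith
    refine (Finset.sum_le_sum hle).trans ?_
    rw [Finset.sum_add_distrib, Finset.sum_const, nsmul_eq_mul, ← Finset.sum_filter,
      Finset.sum_const, nsmul_eq_mul]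
    have h7 : #{t ∈ N | (t, y) ∈ P} ≤ 2 := by
      refine le_trans (card_le_card_of_injOn (fun t => (t, y)) ?_ ?_) (hP y)
      · intro t ht
        exact mem_coe.2 (mem_filter.2 ⟨(mem_filter.1 (mem_coe.1 ht)).2, rfl⟩)
      · intro t _ t' _ h
        exact (Prod.mk.inj h).1
    have h8 : (#{t ∈ N | (t, y) ∈ P} : ℝ) ≤ 2 := by exact_mod_cast h7
    have h9 : (#N : ℝ) ≤ k := by exact_mod_cast hyk ▸ hNd
    rw [← hyk]
    nlinarith
  · have hle : ∀ t ∈ N, pay G k ε γ P (t, y) ≤ γ := by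
      intro t _
      rw [pay, wt]
      simp only
      split_ifs <;> linarith
    refine (Finset.sum_le_sum hle).trans ?_
    rw [Finset.sum_const, nsmul_eq_mul]
    have h8 : (#N : ℝ) ≤ degOn G univ y := by exact_mod_cast hNd
    have h9 : (k : ℝ) + 1 ≤ degOn G univ y := by exact_mod_cast hyk
    nlinarith

include hk hng hcl in
-- High vertices send no more than their excess over `k - 1 + δ`, and low vertices together receive
-- at least their deficit, so the charges `d(v) - (k - 1) - δ` have nonnegative sum.
lemma le_sum_degOn (hε : 0 ≤ ε) (hεγ : ε ≤ γ) (hγδ : γ * (k - 3) = δ * (k - 1))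
    (h0 : γ + ε ≤ ε * (k - 1) - δ) (h1 : δ ≤ ε * (k - 5))
    (h2 : δ ≤ 2 * ε) (h3 : 4 * ε ≤ (k - 2) * (2 * ε - δ)) (h4 : γ ≤ 3 * ε)
    (h5 : 2 * γ + (k - 2) * ε = 1 - δ) (h6 : (k + 1) * γ + δ ≤ 2) (hγ1 : γ ≤ 1) :
    (k - 1 + δ) * Fintype.card V ≤ ∑ v, (degOn G univ v : ℝ) := by
  obtain ⟨P, -, hP1, hP2⟩ := exists_paid hk hng hcl
  have a1 := le_sum_pay hk hng hcl hP1 hε hεγ hγδ h0 h1 h2 h3 h4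
  set L := lowSet G k with hL
  have a2 : ∑ t ∈ L, ∑ y ∈ univ \ L with G.Adj t y, pay G k ε γ P (t, y) =
      ∑ y ∈ univ \ L, ∑ t ∈ L with G.Adj y t, pay G k ε γ P (t, y) := by
    refine Finset.sum_comm' fun t y => ?_
    rw [mem_filter, mem_filter, G.adj_comm]
    tauto
  have a3 : ∑ y ∈ univ \ L, ∑ t ∈ L with G.Adj y t, pay G k ε γ P (t, y) ≤
      ∑ y ∈ univ \ L, ((degOn G univ y : ℝ) - (k - 1) - δ) := by
    refine Finset.sum_le_sum fun y hy => sum_pay_le hP2 hε hεγ h5 h6 hγ1 ?_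
    have h7 := le_degOn hng y
    rw [mem_sdiff, hL, mem_lowSet, IsLow] at hy
    have := hy.2
    omega
  have a4 : ∑ v ∈ L, ((degOn G univ v : ℝ) - (k - 1) - δ) = - (δ * #L) := by
    rw [Finset.sum_congr rfl fun v hv => (by
      have h7 := mem_lowSet.1 hv
      rw [IsLow] at h7
      rw [← h7]
      push_cast
      ring : ((degOn G univ v : ℝ) - (k - 1) - δ) = -δ), Finset.sum_const, nsmul_eq_mul]
    ring
  have a5 : ∑ v, ((degOn G univ v : ℝ) - (k - 1) - δ) =
      ∑ v, (degOn G univ v : ℝ) - (k - 1 + δ) * Fintype.card V := by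
    rw [Finset.sum_congr rfl fun v _ => (by ring :
      (degOn G univ v : ℝ) - (k - 1) - δ = degOn G univ v - (k - 1 + δ)), Finset.sum_sub_distrib,
      Finset.sum_const, nsmul_eq_mul, Finset.card_univ]
    ring
  rw [← Finset.sum_sdiff (subset_univ L), a4] at a5
  linarith

end Discharging

/-! ### The numerical parameters -/

section Numerics

/-- `δ` is the increment in the bound, and the two balance equations of `le_sum_degOn` then
determine `γ` and `ε`. The other conditions become polynomial inequalities after multiplying by `(k
- 2) * Q`. -/
lemma le_sum_degOn_explicit {V : Type*} [Fintype V] {G : SimpleGraph V} {k : ℕ} (hk : 7 ≤ k)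
    (hng : ∀ S : Finset V, S.Nonempty → ¬ Good G k S)
    (hcl : ∀ K : Finset V, G.IsClique (K : Set V) → #K ≠ k) :
    ((k : ℝ) - 1 + ((k : ℝ) - 3) * (2 * (k : ℝ) - 5) /
      ((k : ℝ) ^ 3 + (k : ℝ) ^ 2 - 15 * (k : ℝ) + 15)) * Fintype.card V ≤
        ∑ v, (degOn G univ v : ℝ) := by
  -- Written in `x = k - 7 ≥ 0`, the polynomials below that are not evidently nonnegative expand
  -- without negative coefficients, so `positivity` settles them.
  obtain ⟨x, hx⟩ : ∃ x : ℝ, x = (k : ℝ) - 7 := ⟨_, rfl⟩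
  have hkx : (k : ℝ) = x + 7 := by linarith
  have hx0 : 0 ≤ x := by
    have : (7 : ℝ) ≤ k := by exact_mod_cast hk
    linarith
  have hQ : 0 < (k : ℝ) ^ 3 + (k : ℝ) ^ 2 - 15 * (k : ℝ) + 15 := by
    rw [hkx]
    ring_nf
    positivity
  have hk2 : (0 : ℝ) < k - 2 := by linarith
  set Q := (k : ℝ) ^ 3 + (k : ℝ) ^ 2 - 15 * (k : ℝ) + 15 with hQdef
  have hk2Q : 0 < (k - 2) * Q := mul_pos hk2 hQ
  obtain ⟨ε, hε⟩ : ∃ ε : ℝ, ε * ((k - 2) * Q) = (k : ℝ) ^ 3 - 5 * k ^ 2 + 10 * k - 10 :=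
    ⟨_, div_mul_cancel₀ _ hk2Q.ne'⟩
  obtain ⟨γ, hγ⟩ : ∃ γ : ℝ, γ * Q = (k - 1) * (2 * k - 5) := ⟨_, div_mul_cancel₀ _ hQ.ne'⟩
  obtain ⟨δ, hδ, hδQ⟩ : ∃ δ : ℝ, ((k : ℝ) - 3) * (2 * (k : ℝ) - 5) / Q = δ ∧
      δ * Q = (k - 3) * (2 * k - 5) := ⟨_, rfl, div_mul_cancel₀ _ hQ.ne'⟩
  rw [hδ]
  have le_of : ∀ p q N : ℝ, (q - p) * ((k - 2) * Q) = N → 0 ≤ N → p ≤ q := by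
    intro p q N h1 h2
    rw [← h1] at h2
    exact sub_nonneg.1 (nonneg_of_mul_nonneg_left h2 hk2Q)
  have eq_of : ∀ p q : ℝ, (p - q) * ((k - 2) * Q) = 0 → p = q := by
    intro p q h
    exact sub_eq_zero.1 ((mul_eq_zero.1 h).resolve_right hk2Q.ne')
  refine le_sum_degOn hk hng hcl (ε := ε) (γ := γ) ?_ ?_ ?_ ?_ ?_ ?_ ?_ ?_ ?_ ?_ ?_
  · refine le_of _ _ ((k : ℝ) ^ 3 - 5 * k ^ 2 + 10 * k - 10) (by linear_combination hε) ?_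
    rw [hkx]
    ring_nf
    positivity
  · refine le_of _ _ (k * (k - 3) ^ 2) (by linear_combination (k - 2) * hγ - hε) (by positivity)
  · exact eq_of _ _ (by linear_combination (k - 2) * (k - 3) * hγ - (k - 2) * (k - 1) * hδQ)
  · refine le_of _ _ ((k - 2) * ((k : ℝ) ^ 3 - 5 * k ^ 2 + 10 * k - 10 - (k - 3) * (2 * k - 5) -
      (k - 1) * (2 * k - 5))) (by linear_combination (k - 2) * hε - (k - 2) * hγ - (k - 2) * hδQ) ?_
    rw [hkx]
    ring_nf
    positivity
  · refine le_of _ _ ((k - 5) * ((k : ℝ) ^ 3 - 5 * k ^ 2 + 10 * k - 10) -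
      (k - 2) * ((k - 3) * (2 * k - 5))) (by linear_combination (k - 5) * hε - (k - 2) * hδQ) ?_
    rw [hkx]
    ring_nf
    positivity
  · refine le_of _ _ (5 * k ^ 2 - 17 * k + 10) (by linear_combination 2 * hε - (k - 2) * hδQ) ?_
    rw [hkx]
    ring_nf
    positivity
  · refine le_of _ _ (k ^ 3 - 7 * k ^ 2 + 4 * k + 20)
      (by linear_combination (2 * (k - 2) - 4) * hε - (k - 2) ^ 2 * hδQ) ?_
    rw [hkx]
    ring_nf
    positivity
  · refine le_of _ _ (k ^ 3 - 4 * k ^ 2 + 11 * k - 20)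
      (by linear_combination 3 * hε - (k - 2) * hγ) ?_
    rw [hkx]
    ring_nf
    positivity
  · exact eq_of _ _ (by
      linear_combination 2 * (k - 2) * hγ + (k - 2) * hε + (k - 2) * hδQ - (k - 2) * hQdef)
  · refine le_of _ _ ((k - 2) * (5 * k ^ 2 - 17 * k + 10)) (by
      linear_combination - (k - 2) * hδQ - (k + 1) * (k - 2) * hγ + 2 * (k - 2) * hQdef) ?_
    rw [hkx]
    ring_nf
    positivity
  · refine le_of _ _ ((k - 2) * (k ^ 3 - k ^ 2 - 8 * k + 10)) (by
      linear_combination - (k - 2) * hγ + (k - 2) * hQdef) ?_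
    rw [hkx]
    ring_nf
    positivity

/-- After cross-multiplication the difference is `x * (x - 3) ^ 3`. -/
lemma kierstead_rabern_lt {x : ℝ} (hx : 7 ≤ x) :
    2 * (x - 2) * (x - 3) / ((x - 1) * (x ^ 2 + 3 * x - 12)) <
      (x - 3) * (2 * x - 5) / (x ^ 3 + x ^ 2 - 15 * x + 15) := by
  have h1 : 0 < (x - 1) * (x ^ 2 + 3 * x - 12) := mul_pos (by linarith) (by nlinarith)
  have h2 : 0 < x ^ 3 + x ^ 2 - 15 * x + 15 := by nlinarith [mul_nonneg (sub_nonneg.2 hx) (sq_nonneg x)]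
  rw [div_lt_div_iff₀ h1 h2, ← sub_pos]
  have : 0 < (x - 3) * (x * (x - 3) ^ 2) :=
    mul_pos (by linarith) (mul_pos (by linarith) (pow_pos (by linarith) 2))
  linarith

end Numerics

end AlonTarsi

theorem mainTheorem1 {V : Type*} [Fintype V] (G : SimpleGraph V) (k : ℕ) (hk : 7 ≤ k)
    (hG : AlonTarsi.IsATCritical G k)
    (hne : ¬ Nonempty (G ≃g (⊤ : SimpleGraph (Fin k)))) :
    AlonTarsi.avgDegree G ≥
        ((k : ℝ) - 1) +
          ((k : ℝ) - 3) * (2 * (k : ℝ) - 5) / ((k : ℝ) ^ 3 + (k : ℝ) ^ 2 - 15 * (k : ℝ) + 15) ∧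
      ((k : ℝ) - 1) +
          ((k : ℝ) - 3) * (2 * (k : ℝ) - 5) / ((k : ℝ) ^ 3 + (k : ℝ) ^ 2 - 15 * (k : ℝ) + 15) >
        ((k : ℝ) - 1) +
          2 * ((k : ℝ) - 2) * ((k : ℝ) - 3) /
            (((k : ℝ) - 1) * ((k : ℝ) ^ 2 + 3 * (k : ℝ) - 12)) := by
  refine ⟨?_, by
    have := AlonTarsi.kierstead_rabern_lt (x := k) (by exact_mod_cast hk)
    linarith⟩
  -- With no vertices the out-degree condition is vacuous and the Alon–Tarsi number would be 0.
  have hV : Nonempty V := by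
    by_contra hV
    rw [not_nonempty_iff] at hV
    have h0 : AlonTarsi.IsAT G (fun _ => 0) := by
      obtain ⟨m, D, h1, h2, -⟩ := AlonTarsi.exists_isAT G
      exact ⟨D, h1, h2, fun v => isEmptyElim v⟩
    have h1 : AlonTarsi.atNumber G ≤ 0 := Nat.sInf_le h0
    have := hG.1
    omega
  have hle := AlonTarsi.le_sum_degOn_explicit hk (fun S hS => hG.not_good (by omega) hS)
    (fun K hK => hG.card_clique_ne (by omega) hne hK)
  rw [ge_iff_le, AlonTarsi.avgDegree, le_div_iff₀ (by exact_mod_cast Fintype.card_pos)]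
  refine hle.trans (le_of_eq (Finset.sum_congr rfl fun v _ => ?_))
  rw [AlonTarsi.degOn, ← SimpleGraph.card_neighborFinset_eq_degree]
  congr 2
  ext u
  simp
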